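/- **Setting.** Let $n\ge 0$, $T_{\max}\ge 2$, let $T$ be a random variable with values in $\{2,\dots,T_{\max}\}$ and $\mathbb P(T=T_{\max})>0$, and let $D_t=\mathbb 1_{\{T>t\}}$, $0\le t\le T_{\max}$ (so $D_0=D_1=1$), $q_t=\mathbb P(D_t=0\mid D_{t-1}=1)$, $2\le t\le T_{\max}$. Let $\xi_1$ be deterministic and let $\xi_t$ have finite support $\{\xi_{t1},\dots,\xi_{tM_t}\}$ with $p_{tj}=\mathbb P(\xi_t=\xi_{tj})>0$; $\xi_1,\dots,\xi_{T_{\max}}$ are mutually independent and independent of $T$. Given $x_0\in\mathbb R^n$, consider $$\inf\ \mathbb E\Big[\sum_{t=1}^{T_{\max}}D_{t-1}f_t(x_t,x_{t-1},\xi_t)\Big],\quad x_t\in X_t(x_{t-1},\xi_t)\text{ a.s.},\ x_t\text{ is }\sigma(\xi_j,D_j,j\le t)\text{-measurable},\ t=1,\dots,T_{\max},\tag{P}$$ with $x_t\in\mathbb R^n$. One of the following holds. *Linear case.* $f_t(x_t,x_{t-1},\xi_t)=c_t^Tx_t$ and $X_t(x_{t-1},\xi_t)=\{x_t\ge0: A_tx_t+B_tx_{t-1}=b_t\}$,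 where $A_t,B_t,b_t,c_t$ are functions of $\xi_t$, and (H2-L): $X_1(x_0,\xi_1)$ is nonempty and bounded, and for all $x_1\in X_1(x_0,\xi_1)$, $t\in\{2,\dots,T_{\max}\}$, realizations $\tilde\xi_2,\dots,\tilde\xi_t$, and $x_\tau\in X_\tau(x_{\tau-1},\tilde\xi_\tau)$, $\tau=2,\dots,t-1$, the set $X_t(x_{t-1},\tilde\xi_t)$ is nonempty and bounded. *Nonlinear case.* $X_t(x_{t-1},\xi_t)=\{x_t\in\mathcal X_t: g_t(x_t,x_{t-1},\xi_t)\le0,\ A_tx_t+B_tx_{t-1}=b_t\}$, where $A_t,B_t,b_t$ are functions of $\xi_t$, $f_t$ and the components of $g_t$ are extended-real valued, and (H2-NL): with $\mathcal X_0=\{x_0\}$ and $C^{\varepsilon}=\{x:\mathrm{dist}(x,C)\le\varepsilon\}$, for each $t=1,\dots,T_{\max}$ there is $\varepsilon_t>0$ such that (a) $\mathcal X_t$ is nonempty, convex and compact; (b) $f_t(x,y,\cdot)$ is measurable for all $x,y$, and each $f_t(\cdot,\cdot,\xi_{tj})$ is convex, lower semicontinuous and finite on $\mathcal X_t\times\mathcal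 X_{t-1}^{\varepsilon_t}$; (c) so is each component of $g_t(\cdot,\cdot,\xi_{tj})$; (d) $X_t(x_{t-1},\xi_{tj})\neq\emptyset$ for all $j$ and $x_{t-1}\in\mathcal X_{t-1}^{\varepsilon_t}$; (e) if $t\ge2$, for each $j$ there is $(\bar x,\bar y)\in(\mathrm{ri}(\mathcal X_t)\times\mathcal X_{t-1})\cap\mathrm{ri}(\{g_t(\cdot,\cdot,\xi_{tj})\le0\})$ with $\bar x\in X_t(\bar y,\xi_{tj})$. **Dynamic programming.** Put $\mathcal Q_{T_{\max}+1}\equiv0$, $\mathcal Q_t(\cdot,0)\equiv0$ and, for $t=T_{\max},\dots,2$, $$\mathcal Q_t(x,1)=(1-q_t)\sum_jp_{tj}\mathfrak Q_t(x,1,\xi_{tj},1)+q_t\sum_jp_{tj}\mathfrak Q_t(x,1,\xi_{tj},0),$$ $$\mathfrak Q_t(x,d,\xi,d')=\inf_{y\in X_t(x,\xi)}d\,f_t(y,x,\xi)+\mathcal Q_{t+1}(y,d').$$ **Algorithm SDDP-TSto (run without stopping).** *Initialization:* for $2\le t\le T_{\max}$ fix an affine function $\theta_t^0+\langle\beta_t^0,\cdot\rangle\le\mathcal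 Q_t(\cdot,1)$. For $k\ge 0$ write $\mathcal Q_t^k(x,1)=\max_{0\le j\le k}\theta_t^j+\langle\beta_t^j,x\rangle$ for $2\le t\le T_{\max}$, and $\mathcal Q_t^k(\cdot,0)\equiv0$, $\mathcal Q_{T_{\max}+1}^k\equiv0$. At iteration $k\ge1$: *Forward pass:* draw a sample $\gamma^k=((\tilde\xi^k_1,\tilde D^k_1),\dots,(\tilde\xi^k_{T_{\max}},\tilde D^k_{T_{\max}}))$ with the law of $((\xi_1,D_1),\dots,(\xi_{T_{\max}},D_{T_{\max}}))$. With $x_0^k=x_0$ and $\tilde D_0^k=1$, for $t=1,\dots,T_{\max}$ let $x_t^k$ be an optimal solution of $$\inf_{x_t\in X_t(x_{t-1}^k,\tilde\xi_t^k)}\tilde D_{t-1}^kf_t(x_t,x_{t-1}^k,\tilde\xi_t^k)+\mathcal Q_{t+1}^{k-1}(x_t,\tilde D_t^k).$$ *Backward pass:* for $t=T_{\max},\dots,2$ let $\underline{\mathfrak Q}_t^k(x,1,\xi,1)=\inf_{y\in X_t(x,\xi)}f_t(y,x,\xi)+\mathcal Q^k_{t+1}(y,1)$, choose for each $j$ a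 subgradient $\beta_{tj}^k$ of $\underline{\mathfrak Q}_t^k(\cdot,1,\xi_{tj},1)$ and a subgradient $\gamma_{tj}^k$ of $\mathfrak Q_t(\cdot,1,\xi_{tj},0)$, both at $x_{t-1}^k$, and set $\beta_t^k=(1-q_t)\sum_jp_{tj}\beta_{tj}^k+q_t\sum_jp_{tj}\gamma_{tj}^k$ and $$\theta_t^k=(1-q_t)\sum_jp_{tj}\big(\underline{\mathfrak Q}_t^k(x_{t-1}^k,1,\xi_{tj},1)-\langle\beta_{tj}^k,x_{t-1}^k\rangle\big)+q_t\sum_jp_{tj}\big(\mathfrak Q_t(x_{t-1}^k,1,\xi_{tj},0)-\langle\gamma_{tj}^k,x_{t-1}^k\rangle\big).$$ *Lower bound:* $\underline L_k=\inf_{x_1\in X_1(x_0,\xi_1)}f_1(x_1,x_0,\xi_1)+\mathcal Q_2^k(x_1,1)$. All choices are made from the data sampled so far: $x_t^k$ is a measurable function of $\gamma^1,\dots,\gamma^{k-1}$ and of the first $t$ stages of $\gamma^k$; $\beta_{tj}^k$ and $\gamma_{tj}^k$ are measurable functions of $\gamma^1,\dots,\gamma^k$. **Theorem.** If $\gamma^1,\gamma^2,\dots$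 are independent, then: (i) almost surely, $\mathcal Q_t^k(x,1)\le\mathcal Q_t(x,1)$ for all $t=2,\dots,T_{\max}+1$, $k\ge0$ and $x\in\mathbb R^n$; (ii) almost surely, $\underline L_k$ is a lower bound on the optimal value of (P) for all $k\ge1$; (iii) the optimal value of (P) is finite and, almost surely, $\lim_{k\to\infty}f_1(x_1^k,x_0,\xi_1)+\mathcal Q_2^k(x_1^k,1)$ equals this optimal value. -/

import Mathlib

open MeasureTheory ProbabilityTheory Filter Topology
open scoped Matrix ENNReal

namespace SDDP

/-- The decision space `ℝⁿ` with its Euclidean structure. -/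
abbrev Dec (n : ℕ) : Type := EuclideanSpace ℝ (Fin n)

/-! ### Stage data: costs and constraints -/

/-- Costs `f_t(x_t, x_{t-1}, ξ_t)` (extended-real valued) and feasible sets `X_t(x_{t-1}, ξ_t)`. -/
structure StageModel (n : ℕ) (Ξ : Type*) where
  /-- `cost t x_t x_{t-1} ξ_t` -/
  cost : ℕ → Dec n → Dec n → Ξ → EReal
  /-- `feas t x_{t-1} ξ_t` -/
  feas : ℕ → Dec n → Ξ → Set (Dec n)

/-- Data of a multistage linear program; the entries of `A_t, B_t, b_t, c_t` are functions of the
random vector `ξ_t`. -/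
structure LinearData (n : ℕ) (Ξ : Type*) where
  rows : ℕ → ℕ
  A : (t : ℕ) → Ξ → Matrix (Fin (rows t)) (Fin n) ℝ
  B : (t : ℕ) → Ξ → Matrix (Fin (rows t)) (Fin n) ℝ
  b : (t : ℕ) → Ξ → Fin (rows t) → ℝ
  c : ℕ → Ξ → Fin n → ℝ

/-- `f_t = c_tᵀ x_t` and `X_t(y, ξ) = {x : A_t x + B_t y = b_t, x ≥ 0}`. -/
def LinearData.toModel {n : ℕ} {Ξ : Type*} (L : LinearData n Ξ) : StageModel n Ξ where
  cost t x _ ξ := ((L.c t ξ ⬝ᵥ x.ofLp : ℝ) : EReal)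
  feas t y ξ := {x | L.A t ξ *ᵥ x.ofLp + L.B t ξ *ᵥ y.ofLp = L.b t ξ ∧ ∀ i, 0 ≤ x i}

/-- Data of a multistage convex program. -/
structure NonlinearData (n : ℕ) (Ξ : Type*) where
  rows : ℕ → ℕ
  ineqs : ℕ → ℕ
  A : (t : ℕ) → Ξ → Matrix (Fin (rows t)) (Fin n) ℝ
  B : (t : ℕ) → Ξ → Matrix (Fin (rows t)) (Fin n) ℝ
  b : (t : ℕ) → Ξ → Fin (rows t) → ℝ
  /-- the set of stage-`t` decisions `𝒳_t` -/
  dom : ℕ → Set (Dec n)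
  /-- `f t x_t x_{t-1} ξ_t` -/
  f : ℕ → Dec n → Dec n → Ξ → EReal
  /-- `g t i x_t x_{t-1} ξ_t` -/
  g : (t : ℕ) → Fin (ineqs t) → Dec n → Dec n → Ξ → EReal

/-- `X_t(y, ξ) = {x ∈ 𝒳_t : g_t(x, y, ξ) ≤ 0, A_t x + B_t y = b_t}`. -/
def NonlinearData.toModel {n : ℕ} {Ξ : Type*} (N : NonlinearData n Ξ) : StageModel n Ξ where
  cost := N.f
  feas t y ξ := {x | x ∈ N.dom t ∧ (∀ i, N.g t i x y ξ ≤ 0) ∧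
    N.A t ξ *ᵥ x.ofLp + N.B t ξ *ᵥ y.ofLp = N.b t ξ}

/-- Assumption (H2-L): the first stage feasible set is nonempty and bounded, and so is the feasible
set of every later stage after any sequence of feasible decisions along any realization. -/
def LinearData.H2L {n : ℕ} {Ξ : Type*} (L : LinearData n Ξ) (Tmax : ℕ) (Θ : ℕ → Finset Ξ) (ξ₁ : Ξ)
    (x₀ : Dec n) : Prop :=
  (L.toModel.feas 1 x₀ ξ₁).Nonempty ∧ Bornology.IsBounded (L.toModel.feas 1 x₀ ξ₁) ∧
  ∀ t ∈ Finset.Icc 2 Tmax, ∀ ζ : ℕ → Ξ, (∀ τ ∈ Finset.Icc 2 t, ζ τ ∈ Θ τ) →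
    ∀ x : ℕ → Dec n, x 1 ∈ L.toModel.feas 1 x₀ ξ₁ →
      (∀ τ ∈ Finset.Icc 2 (t - 1), x τ ∈ L.toModel.feas τ (x (τ - 1)) (ζ τ)) →
      (L.toModel.feas t (x (t - 1)) (ζ t)).Nonempty ∧
        Bornology.IsBounded (L.toModel.feas t (x (t - 1)) (ζ t))

/-- An extended-real valued function is convex, lower semicontinuous and finite on the set `C`. -/
def ConvexLscFiniteOn {V : Type*} [AddCommGroup V] [Module ℝ V] [TopologicalSpace V]
    (C : Set V) (h : V → EReal) : Prop :=
  (∀ z ∈ C, h z ≠ ⊤ ∧ h z ≠ ⊥) ∧ ConvexOn ℝ C (fun z => (h z).toReal) ∧ LowerSemicontinuousOn h C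

/-- Assumption (H2-NL)-(a)-(e), with the convention `𝒳_0 = {x_0}`; `cthickening ε C` is the set of
points at distance at most `ε` from `C`. -/
def NonlinearData.H2NL {n : ℕ} {Ξ : Type*} [MeasurableSpace Ξ] (N : NonlinearData n Ξ) (Tmax : ℕ)
    (Θ : ℕ → Finset Ξ) (x₀ : Dec n) : Prop :=
  N.dom 0 = {x₀} ∧
  ∀ t ∈ Finset.Icc 1 Tmax, ∃ ε : ℝ, 0 < ε ∧
    -- (a)
    ((N.dom t).Nonempty ∧ Convex ℝ (N.dom t) ∧ IsCompact (N.dom t)) ∧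
    -- (b)
    (∀ x y, Measurable (fun ξ => N.f t x y ξ)) ∧
    (∀ θ ∈ Θ t, ConvexLscFiniteOn (N.dom t ×ˢ Metric.cthickening ε (N.dom (t - 1)))
      (fun z : Dec n × Dec n => N.f t z.1 z.2 θ)) ∧
    -- (c)
    (∀ θ ∈ Θ t, ∀ i, ConvexLscFiniteOn (N.dom t ×ˢ Metric.cthickening ε (N.dom (t - 1)))
      (fun z : Dec n × Dec n => N.g t i z.1 z.2 θ)) ∧
    -- (d)
    (∀ θ ∈ Θ t, ∀ y ∈ Metric.cthickening ε (N.dom (t - 1)), (N.toModel.feas t y θ).Nonempty) ∧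
    -- (e)
    (2 ≤ t → ∀ θ ∈ Θ t, ∃ x ∈ intrinsicInterior ℝ (N.dom t), ∃ y ∈ N.dom (t - 1),
      (x, y) ∈ intrinsicInterior ℝ {z : Dec n × Dec n | ∀ i, N.g t i z.1 z.2 θ ≤ 0} ∧
      x ∈ N.toModel.feas t y θ)

/-! ### The uncertainty: a random number of stages and stagewise independent discrete data -/

/-- The random number of stages `T` and the process `(ξ_t)`: `T` takes values in
`{2, …, Tmax}`, `Tmax` being a possible value; `ξ_1` is deterministic; `ξ_t` has finite support
`Θ_t`; the `ξ_t` are mutually independent and independent of `T`. -/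
structure Uncertainty {Ω : Type*} [MeasurableSpace Ω] (P : Measure Ω) (Ξ : Type*)
    [MeasurableSpace Ξ] where
  Tmax : ℕ
  T : Ω → ℕ
  ξ : ℕ → Ω → Ξ
  ξ₁ : Ξ
  Θ : ℕ → Finset Ξ
  measurable_T : Measurable T
  measurable_ξ : ∀ t ∈ Finset.Icc 1 Tmax, Measurable (ξ t)
  T_mem : ∀ᵐ ω ∂P, T ω ∈ Finset.Icc 2 Tmax
  Tmax_pos : 0 < P {ω | T ω = Tmax}
  support_one : Θ 1 = {ξ₁}
  ξ_mem : ∀ t ∈ Finset.Icc 1 Tmax, ∀ᵐ ω ∂P, ξ t ω ∈ Θ t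
  ξ_pos : ∀ t ∈ Finset.Icc 1 Tmax, ∀ θ ∈ Θ t, 0 < P {ω | ξ t ω = θ}
  indep_ξ : iIndepFun (fun t : Finset.Icc 1 Tmax => ξ t) P
  indep_T : IndepFun T (fun ω (t : Finset.Icc 1 Tmax) => ξ t ω) P

namespace Uncertainty

variable {Ω : Type*} [MeasurableSpace Ω] {P : Measure Ω} {Ξ : Type*} [MeasurableSpace Ξ]

/-- The death process `D_t = 1_{T > t}`. -/
def D (U : Uncertainty P Ξ) (t : ℕ) (ω : Ω) : ℕ := if t < U.T ω then 1 else 0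

/-- `p_t(θ) = ℙ(ξ_t = θ)`. -/
noncomputable def p (U : Uncertainty P Ξ) (t : ℕ) (θ : Ξ) : ℝ := P.real {ω | U.ξ t ω = θ}

/-- `q_t = ℙ(D_t = 0 | D_{t-1} = 1)`. -/
noncomputable def q (U : Uncertainty P Ξ) (t : ℕ) : ℝ :=
  (ProbabilityTheory.cond P {ω | U.D (t - 1) ω = 1}).real {ω | U.D t ω = 0}

/-- The sigma-algebra generated by `ξ_j, D_j`, `1 ≤ j ≤ t`. -/
abbrev filt (U : Uncertainty P Ξ) (t : ℕ) : MeasurableSpace Ω :=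
  ⨆ j ∈ Finset.Icc 1 t,
    (MeasurableSpace.comap (U.ξ j) inferInstance ⊔ MeasurableSpace.comap (U.D j) inferInstance)

/-- The trajectory `((ξ_1, D_1), …, (ξ_Tmax, D_Tmax))`. -/
def traj (U : Uncertainty P Ξ) (ω : Ω) : Finset.Icc 1 U.Tmax → Ξ × ℕ :=
  fun t => (U.ξ t ω, U.D t ω)

end Uncertainty

/-! ### The stochastic program -/

/-- Expectation of an extended-real random variable, `𝔼[Z⁺] - 𝔼[Z⁻]`. -/
noncomputable def expect {Ω : Type*} [MeasurableSpace Ω] (P : Measure Ω) (Z : Ω → EReal) : EReal :=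
  ((∫⁻ ω, (Z ω).toENNReal ∂P : ℝ≥0∞) : EReal) - ((∫⁻ ω, (-Z ω).toENNReal ∂P : ℝ≥0∞) : EReal)

section Problem

variable {Ω : Type*} [MeasurableSpace Ω] {P : Measure Ω} {Ξ : Type*} [MeasurableSpace Ξ] {n : ℕ}

/-- Feasible nonanticipative policies: `x_t` is measurable with respect to `σ(ξ_j, D_j, j ≤ t)`
and `x_t ∈ X_t(x_{t-1}, ξ_t)` almost surely. -/
def IsPolicy (M : StageModel n Ξ) (U : Uncertainty P Ξ) (x₀ : Dec n) (x : ℕ → Ω → Dec n) : Prop :=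
  (∀ ω, x 0 ω = x₀) ∧
  (∀ t ∈ Finset.Icc 1 U.Tmax, Measurable[U.filt t] (x t)) ∧
  (∀ t ∈ Finset.Icc 1 U.Tmax, ∀ᵐ ω ∂P, x t ω ∈ M.feas t (x (t - 1) ω) (U.ξ t ω))

/-- Total cost `∑_{t=1}^{Tmax} D_{t-1} f_t(x_t, x_{t-1}, ξ_t)` of a policy. -/
noncomputable def totalCost (M : StageModel n Ξ) (U : Uncertainty P Ξ) (x : ℕ → Ω → Dec n)
    (ω : Ω) : EReal :=
  ∑ t ∈ Finset.Icc 1 U.Tmax,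
    (U.D (t - 1) ω : EReal) * M.cost t (x t ω) (x (t - 1) ω) (U.ξ t ω)

/-- The optimal value of the multistage stochastic program: the infimum of the expected total cost
over all feasible nonanticipative policies. -/
noncomputable def optVal (M : StageModel n Ξ) (U : Uncertainty P Ξ) (x₀ : Dec n) : EReal :=
  ⨅ (x : ℕ → Ω → Dec n) (_ : IsPolicy M U x₀ x), expect P (totalCost M U x)

/-! ### Dynamic programming equations -/

/-- `inf { d f_t(y, x, ξ) + V(y, d') : y ∈ X_t(x, ξ) }`, where `x = x_{t-1}`, `d = D_{t-1}`,
`ξ = ξ_t`, `d' = D_t` and `V` is a (true or approximate) cost-to-go function of stage `t + 1`. -/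
noncomputable def stageVal (M : StageModel n Ξ) (V : Dec n → ℕ → EReal) (t : ℕ) (x : Dec n) (d : ℕ)
    (ξ : Ξ) (d' : ℕ) : EReal :=
  ⨅ y ∈ M.feas t x ξ, ((d : EReal) * M.cost t y x ξ + V y d')

/-- Cost-to-go function with `r` remaining stages, i.e. of stage `Tmax + 1 - r`. -/
noncomputable def costToGoAux (M : StageModel n Ξ) (U : Uncertainty P Ξ) :
    ℕ → Dec n → ℕ → EReal
  | 0, _, _ => 0
  | r + 1, x, d =>
    if d = 0 then 0 else
      ((1 - U.q (U.Tmax - r) : ℝ) : EReal) * ∑ θ ∈ U.Θ (U.Tmax - r),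
          (U.p (U.Tmax - r) θ : EReal) * stageVal M (costToGoAux M U r) (U.Tmax - r) x 1 θ 1 +
        (U.q (U.Tmax - r) : EReal) * ∑ θ ∈ U.Θ (U.Tmax - r),
          (U.p (U.Tmax - r) θ : EReal) * stageVal M (costToGoAux M U r) (U.Tmax - r) x 1 θ 0

/-- The cost-to-go functions `𝒬_t(x_{t-1}, D_{t-1})`, `t = 2, …, Tmax + 1`. -/
noncomputable def costToGo (M : StageModel n Ξ) (U : Uncertainty P Ξ) (t : ℕ) :
    Dec n → ℕ → EReal :=
  costToGoAux M U (U.Tmax + 1 - t)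

theorem costToGo_last (M : StageModel n Ξ) (U : Uncertainty P Ξ) (x : Dec n) (d : ℕ) :
    costToGo M U (U.Tmax + 1) x d = 0 := by
  simp [costToGo, costToGoAux]

theorem costToGo_zero (M : StageModel n Ξ) (U : Uncertainty P Ξ) (t : ℕ) (x : Dec n) :
    costToGo M U t x 0 = 0 := by
  unfold costToGo
  cases U.Tmax + 1 - t <;> simp [costToGoAux]

/-- The dynamic programming recursion. -/
theorem costToGo_one (M : StageModel n Ξ) (U : Uncertainty P Ξ) (t : ℕ) (ht : t ≤ U.Tmax)
    (x : Dec n) :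
    costToGo M U t x 1 =
      ((1 - U.q t : ℝ) : EReal) * ∑ θ ∈ U.Θ t,
          (U.p t θ : EReal) * stageVal M (costToGo M U (t + 1)) t x 1 θ 1 +
        (U.q t : EReal) * ∑ θ ∈ U.Θ t,
          (U.p t θ : EReal) * stageVal M (costToGo M U (t + 1)) t x 1 θ 0 := by
  have h1 : U.Tmax + 1 - t = (U.Tmax - t) + 1 := by omega
  have h2 : U.Tmax - (U.Tmax - t) = t := by omega
  have h3 : U.Tmax + 1 - (t + 1) = U.Tmax - t := by omega
  unfold costToGo
  rw [h1, h3, costToGoAux, h2]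
  simp

end Problem

/-! ### The algorithm SDDP-TSto -/

/-- `s` is a subgradient at `x` of the extended-real valued function `h`, finite at `x`. -/
def IsSubgradientAt {n : ℕ} (h : Dec n → EReal) (x s : Dec n) : Prop :=
  h x ≠ ⊤ ∧ h x ≠ ⊥ ∧ ∀ y, h x + ((inner ℝ s (y - x) : ℝ) : EReal) ≤ h y

/-- The random sequences manipulated by SDDP-TSto. The first index is the iteration `k`, the second
one the stage `t`; `Ω'` is the probability space carrying the forward samples. -/
structure Trace (n : ℕ) (Ξ Ω' : Type*) where
  /-- sampled `ξ_t^k` -/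
  ξs : ℕ → ℕ → Ω' → Ξ
  /-- sampled `D_t^k` -/
  Ds : ℕ → ℕ → Ω' → ℕ
  /-- forward decisions `x_t^k` -/
  x : ℕ → ℕ → Ω' → Dec n
  /-- cut intercepts `θ_t^k` -/
  θ : ℕ → ℕ → Ω' → ℝ
  /-- cut slopes `β_t^k` -/
  β : ℕ → ℕ → Ω' → Dec n
  /-- subgradients `β_{t j}^k`, indexed by the realization of `ξ_t` -/
  βs : ℕ → ℕ → Ξ → Ω' → Dec n
  /-- subgradients `γ_{t j}^k`, indexed by the realization of `ξ_t` -/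
  γs : ℕ → ℕ → Ξ → Ω' → Dec n

namespace Trace

variable {n : ℕ} {Ξ Ω' : Type*}

/-- `𝒬_t^k(x, d)`: the maximum of the first `k + 1` cuts for `d = 1` and `t ≤ Tmax`; zero for
`d = 0` or `t = Tmax + 1`. -/
noncomputable def approx (S : Trace n Ξ Ω') (Tmax k t : ℕ) (ω : Ω') (x : Dec n) (d : ℕ) : EReal :=
  if d = 0 ∨ Tmax < t then 0 else
    (((Finset.range (k + 1)).sup' Finset.nonempty_range_add_one
      (fun j => S.θ j t ω + inner ℝ (S.β j t ω) x) : ℝ) : EReal)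

/-- The trajectory sampled at iteration `k`. -/
def sample (S : Trace n Ξ Ω') (Tmax k : ℕ) (ω : Ω') : Finset.Icc 1 Tmax → Ξ × ℕ :=
  fun t => (S.ξs k t ω, S.Ds k t ω)

/-- The information available at stage `t` of the forward pass of iteration `k`: the samples of the
iterations before `k`, and the first `t` stages of the sample of iteration `k`. -/
abbrev info [MeasurableSpace Ξ] (S : Trace n Ξ Ω') (Tmax k t : ℕ) : MeasurableSpace Ω' :=
  (⨆ i ∈ Finset.Ico 1 k, MeasurableSpace.comap (S.sample Tmax i) inferInstance) ⊔
    ⨆ s ∈ Finset.Icc 1 t, (MeasurableSpace.comap (S.ξs k s) inferInstance ⊔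
      MeasurableSpace.comap (S.Ds k s) inferInstance)

/-- The lower bound computed at the end of iteration `k`,
`inf { f_1(x_1, x_0, ξ_1) + 𝒬_2^k(x_1, 1) : x_1 ∈ X_1(x_0, ξ_1) }`. -/
noncomputable def lowerBound (S : Trace n Ξ Ω') (M : StageModel n Ξ) (Tmax : ℕ) (ξ₁ : Ξ)
    (x₀ : Dec n) (k : ℕ) (ω : Ω') : EReal :=
  ⨅ y ∈ M.feas 1 x₀ ξ₁, (M.cost 1 y x₀ ξ₁ + S.approx Tmax k 2 ω y 1)

end Trace

/-- `S` is produced by SDDP-TSto with independent forward samples (never stopped). -/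
structure IsRun {Ω Ω' Ξ : Type*} [MeasurableSpace Ω] [MeasurableSpace Ω'] [MeasurableSpace Ξ]
    {n : ℕ} {P : Measure Ω} (P' : Measure Ω') (M : StageModel n Ξ) (U : Uncertainty P Ξ)
    (x₀ : Dec n) (S : Trace n Ξ Ω') : Prop where
  /-- samples are random variables -/
  measurable_ξs : ∀ k, 1 ≤ k → ∀ t ∈ Finset.Icc 1 U.Tmax, Measurable (S.ξs k t)
  measurable_Ds : ∀ k, 1 ≤ k → ∀ t ∈ Finset.Icc 1 U.Tmax, Measurable (S.Ds k t)
  /-- each sampled trajectory has the law of `((ξ_1, D_1), …, (ξ_Tmax, D_Tmax))` -/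
  sample_law : ∀ k, 1 ≤ k → IdentDistrib (S.sample U.Tmax k) U.traj P' P
  /-- the samples of the iterations `1, 2, …` are independent -/
  sample_indep : iIndepFun (fun k : ℕ => S.sample U.Tmax (k + 1)) P'
  /-- conventions `x_0^k = x_0` and `D_0^k = 1` -/
  x_zero : ∀ k ω, S.x k 0 ω = x₀
  D_zero : ∀ k ω, S.Ds k 0 ω = 1
  /-- initialization: a deterministic affine minorant of each cost-to-go function -/
  init : ∀ t ∈ Finset.Icc 2 U.Tmax, ∃ (a : ℝ) (s : Dec n),
    (∀ ω, S.θ 0 t ω = a ∧ S.β 0 t ω = s) ∧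
    ∀ x, ((a + inner ℝ s x : ℝ) : EReal) ≤ costToGo M U t x 1
  /-- decisions and subgradients are computed from the data sampled so far -/
  x_adapted : ∀ k, 1 ≤ k → ∀ t ∈ Finset.Icc 1 U.Tmax, Measurable[S.info U.Tmax k t] (S.x k t)
  βs_adapted : ∀ k, 1 ≤ k → ∀ t ∈ Finset.Icc 2 U.Tmax, ∀ θ ∈ U.Θ t,
    Measurable[S.info U.Tmax k U.Tmax] (S.βs k t θ)
  γs_adapted : ∀ k, 1 ≤ k → ∀ t ∈ Finset.Icc 2 U.Tmax, ∀ θ ∈ U.Θ t,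
    Measurable[S.info U.Tmax k U.Tmax] (S.γs k t θ)
  /-- forward pass: `x_t^k` is an optimal solution of the stage-`t` problem built on `𝒬_{t+1}^{k-1}` -/
  forward : ∀ k, 1 ≤ k → ∀ t ∈ Finset.Icc 1 U.Tmax, ∀ᵐ ω ∂P',
    S.x k t ω ∈ M.feas t (S.x k (t - 1) ω) (S.ξs k t ω) ∧
    ∀ y ∈ M.feas t (S.x k (t - 1) ω) (S.ξs k t ω),
      (S.Ds k (t - 1) ω : EReal) * M.cost t (S.x k t ω) (S.x k (t - 1) ω) (S.ξs k t ω) +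
          S.approx U.Tmax (k - 1) (t + 1) ω (S.x k t ω) (S.Ds k t ω) ≤
        (S.Ds k (t - 1) ω : EReal) * M.cost t y (S.x k (t - 1) ω) (S.ξs k t ω) +
          S.approx U.Tmax (k - 1) (t + 1) ω y (S.Ds k t ω)
  /-- backward pass: subgradients at `x_{t-1}^k` of the approximate stage value functions built on
  `𝒬_{t+1}^k` (stage `t` is not the last one) and of the value functions of the last stage -/
  βs_subgradient : ∀ k, 1 ≤ k → ∀ t ∈ Finset.Icc 2 U.Tmax, ∀ θ ∈ U.Θ t, ∀ᵐ ω ∂P',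
    IsSubgradientAt (fun x => stageVal M (S.approx U.Tmax k (t + 1) ω) t x 1 θ 1)
      (S.x k (t - 1) ω) (S.βs k t θ ω)
  γs_subgradient : ∀ k, 1 ≤ k → ∀ t ∈ Finset.Icc 2 U.Tmax, ∀ θ ∈ U.Θ t, ∀ᵐ ω ∂P',
    IsSubgradientAt (fun x => stageVal M (costToGo M U (t + 1)) t x 1 θ 0)
      (S.x k (t - 1) ω) (S.γs k t θ ω)
  /-- backward pass: the new cut -/
  θ_eq : ∀ k, 1 ≤ k → ∀ t ∈ Finset.Icc 2 U.Tmax, ∀ᵐ ω ∂P',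
    S.θ k t ω =
      (1 - U.q t) * ∑ θ ∈ U.Θ t, U.p t θ *
          ((stageVal M (S.approx U.Tmax k (t + 1) ω) t (S.x k (t - 1) ω) 1 θ 1).toReal -
            inner ℝ (S.βs k t θ ω) (S.x k (t - 1) ω)) +
        U.q t * ∑ θ ∈ U.Θ t, U.p t θ *
          ((stageVal M (costToGo M U (t + 1)) t (S.x k (t - 1) ω) 1 θ 0).toReal -
            inner ℝ (S.γs k t θ ω) (S.x k (t - 1) ω))
  β_eq : ∀ k, 1 ≤ k → ∀ t ∈ Finset.Icc 2 U.Tmax, ∀ᵐ ω ∂P',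
    S.β k t ω = (1 - U.q t) • ∑ θ ∈ U.Θ t, U.p t θ • S.βs k t θ ω +
      U.q t • ∑ θ ∈ U.Θ t, U.p t θ • S.γs k t θ ω

end SDDP

/-!
The proof works on bounded sets `K t` that contain all stage-`t` decisions reachable from `x₀`
(`IsInvariant`). On these sets the cost-to-go functions are finite, and their affine minorants from
the initialization bound them below.

*Validity.* By downward induction on the stage, the subgradient inequalities make every cut an
affine minorant of the true cost-to-go function (`RunsAt.approx_le_costToGo`).

*The optimal value.* Along a policy, the expected total cost equals the optimal value of the first
stage problem plus the expected suboptimalities in the successive stage problems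
(`IsPolicy.expect_totalCost`). These are nonnegative and can be made arbitrarily small, hence
`optVal_eq`. The probabilistic input is `IsFreshSample.setIntegral_stage`: averaging over
`(ξ_t, D_t)`, given `D_{t-1} = 1`, may be done inside an expectation. As all data are finitely
valued, the integrands are handled as functions of the data rather than through measurability: this
is `DeterminedBy`.

*Convergence.* Let the gap be the difference between the true cost-to-go function and its current
approximation at the next trial point. The newest cut is exact for the approximate stage problems,
so the expected gap of stage `t` exceeds that of stage `t + 1`, both on the event that the sampled
process is still alive, by at most the expected increase of the approximation at the trial point
(`IsRun.setIntegral_gap_le`). Summing up, the expected first stage gap is at most the sum of the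
expected increases over all stages. These tend to zero by dominated convergence, once the increases
do so pointwise. The first stage optimal values thus converge in mean, and almost surely because
they are monotone.

*Increases.* That the increases vanish is deterministic (`tendsto_cutMax_increment`). It is usually
derived from bounds on the slopes of the cuts; here it comes from a geometric property,
`Extrapolates`, which does not need them. Let a cut exceed all earlier ones by `ε` at its trial point,
infinitely often. Among these trial points there are an earlier one `u` and a later one `v` such
that `u + c • (u - v)` lies in a set where the cost-to-go function is bounded, for a large `c`. The
cut computed at `u` lies below the later cut at `v` by `ε`, while the two cuts have nearly equal
values at their own trial points; so it rises by `ε / 2` from `v` to `u`, hence by `c * ε / 2` from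
`u` to the prolonged point, which contradicts its validity.

In the nonlinear case extrapolation follows from compactness, in a neighborhood of `𝒳_{t-1}`, on
which the cost-to-go function is convex and therefore bounded. In the linear case trial points need
not have a neighborhood in which the problems are feasible. There, paths of decisions along fixed
realizations form a polyhedron given by equations and nonnegativity constraints, and extrapolation
inside it amounts to `c * v i ≤ (1 + c) * u i` for all coordinates; two such paths exist in any
sequence by Dickson's lemma (`exists_lt_forall_mul_le`).
-/

namespace SDDP

/-! ### Vanishing increments of a maximum of cuts -/

/-- Among any sequence of points of `K` there are an earlier one `u j` and a later one `u k` such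
that the segment from `u k` to `u j` can be prolonged beyond `u j` inside `R`, by an arbitrarily
large prescribed factor. -/
def Extrapolates {n : ℕ} (K R : Set (Dec n)) : Prop :=
  ∀ u : ℕ → Dec n, (∀ k, u k ∈ K) → ∀ c : ℝ, 0 < c → ∃ j k, j < k ∧ u j + c • (u j - u k) ∈ R

/-- The maximum of the affine functions `θ j + ⟪β j, ·⟫`, `0 ≤ j ≤ k`. -/
noncomputable def cutMax {n : ℕ} (θ : ℕ → ℝ) (β : ℕ → Dec n) (k : ℕ) (y : Dec n) : ℝ :=
  (Finset.range (k + 1)).sup' Finset.nonempty_range_add_one (fun j => θ j + inner ℝ (β j) y)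

section CutMax

variable {n : ℕ} {θ : ℕ → ℝ} {β : ℕ → Dec n}

theorem le_cutMax {j k : ℕ} (h : j ≤ k) (y : Dec n) :
    θ j + inner ℝ (β j) y ≤ cutMax θ β k y :=
  Finset.le_sup' (fun j => θ j + inner ℝ (β j) y) (Finset.mem_range.2 (by omega))

theorem cutMax_le {k : ℕ} {y : Dec n} {c : ℝ} (h : ∀ j ≤ k, θ j + inner ℝ (β j) y ≤ c) :
    cutMax θ β k y ≤ c :=
  Finset.sup'_le _ _ fun j hj => h j (by simpa [Nat.lt_succ_iff] using hj)

theorem cutMax_mono {j k : ℕ} (h : j ≤ k) (y : Dec n) : cutMax θ β j y ≤ cutMax θ β k y :=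
  cutMax_le fun _ hi => le_cutMax (hi.trans h) y

theorem cutMax_succ_le (k : ℕ) (y : Dec n) :
    cutMax θ β (k + 1) y ≤ max (cutMax θ β k y) (θ (k + 1) + inner ℝ (β (k + 1)) y) := by
  refine cutMax_le fun j hj => ?_
  rcases Nat.lt_or_ge j (k + 1) with h | h
  · exact (le_cutMax (by omega) y).trans (le_max_left _ _)
  · obtain rfl : j = k + 1 := by omega
    exact le_max_right _ _

/-- If all cuts lie below a constant on `R`, the increase of the maximum of the cuts at the point
where the newest cut was computed tends to zero. No bound on the slopes is assumed: two trial
points whose difference can be prolonged inside `R` by a large factor suffice, as a cut cannot drop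
much from the first point to the second one without exceeding the constant on the prolongation. -/
theorem tendsto_cutMax_increment {K R : Set (Dec n)} (hKR : Extrapolates K R) (hsub : K ⊆ R)
    {x : ℕ → Dec n} (hx : ∀ k, x (k + 1) ∈ K) {c₀ C : ℝ}
    (hup : ∀ k, ∀ y ∈ R, θ k + inner ℝ (β k) y ≤ C)
    (hlow : ∀ y ∈ K, c₀ ≤ θ 0 + inner ℝ (β 0) y) :
    Tendsto (fun k => cutMax θ β (k + 1) (x (k + 1)) - cutMax θ β k (x (k + 1))) atTop (𝓝 0) := by
  -- Otherwise infinitely many cuts rise by at least `ε` above the previous ones at their own trial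
  -- point. Their values there are bounded: pass to a subsequence along which they differ little.
  by_contra hcon
  rw [Metric.tendsto_atTop] at hcon
  push Not at hcon
  obtain ⟨ε, hε, hfreq⟩ := hcon
  obtain ⟨φ, hφ, hφε⟩ := extraction_of_frequently_atTop
    (frequently_atTop.2 fun N => let ⟨k, h1, h2⟩ := hfreq N; ⟨k, h1, h2⟩)
  set a : ℕ → Dec n → ℝ := fun k y => θ k + inner ℝ (β k) y with ha
  have hinc : ∀ i, cutMax θ β (φ i) (x (φ i + 1)) + ε ≤ a (φ i + 1) (x (φ i + 1)) := by
    intro i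
    have h1 := hφε i
    rw [Real.dist_eq, sub_zero, abs_of_nonneg (sub_nonneg.2 (cutMax_mono (by omega) _))] at h1
    have h2 := cutMax_succ_le (θ := θ) (β := β) (φ i) (x (φ i + 1))
    rcases le_max_iff.1 h2 with h | h
    · linarith
    · exact le_trans (by linarith) h
  have hval : ∀ i, a (φ i + 1) (x (φ i + 1)) ∈ Set.Icc c₀ C := fun i =>
    ⟨(hlow _ (hx _)).trans ((le_cutMax (Nat.zero_le _) _).trans (by linarith [hinc i])),
      hup _ _ (hsub (hx _))⟩
  obtain ⟨l, -, ψ, hψ, hlim⟩ := isCompact_Icc.tendsto_subseq hval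
  obtain ⟨N, hN⟩ := Metric.cauchySeq_iff.1 hlim.cauchySeq (ε / 2) (by positivity)
  have hCc : 0 ≤ C - c₀ := by linarith [(hval 0).1, (hval 0).2]
  -- From the trial point of iteration `r + 1` to the earlier one of iteration `p + 1` the cut `p + 1`
  -- will be shown to rise by `ε / 2`; this factor then takes it above `C` on the prolongation.
  have hc : 0 < 2 * (C - c₀ + 1) / ε := by positivity
  obtain ⟨j, k, hjk, hR⟩ := hKR (fun i => x (φ (ψ (N + i)) + 1)) (fun i => hx _) _ hc
  set p := φ (ψ (N + j)) with hp
  set r := φ (ψ (N + k)) with hr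
  have hpr : p < r := hφ (hψ (by omega))
  have h1 := hup (p + 1) _ hR
  have h2 : a (p + 1) (x (r + 1)) ≤ cutMax θ β r (x (r + 1)) := le_cutMax (by omega) _
  have h3 := hinc (ψ (N + k))
  have h4 := hN (N + k) (by omega) (N + j) (by omega)
  have h5 := (hval (ψ (N + j))).1
  simp only [Function.comp, Real.dist_eq, ← hp, ← hr] at h4 h3 h5
  have h6 := (abs_lt.1 h4).2
  simp only [ha, inner_add_right, inner_smul_right, inner_sub_right] at h1 h2 h3 h5 h6
  have h7 : 2 * (C - c₀ + 1) / ε * (ε / 2) = C - c₀ + 1 := by field_simp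
  have h8 : ε / 2 ≤ inner ℝ (β (p + 1)) (x (p + 1)) - inner ℝ (β (p + 1)) (x (r + 1)) := by
    linarith
  have h9 := mul_le_mul_of_nonneg_left h8 hc.le
  linarith

end CutMax

/-! ### Extrapolation in compact sets and in polyhedra -/

/-- Far enough in a convergent subsequence, differences are small compared with `ε / c`. -/
theorem extrapolates_cthickening {n : ℕ} {K : Set (Dec n)} (hK : IsCompact K) {ε : ℝ} (hε : 0 < ε) :
    Extrapolates K (Metric.cthickening ε K) := by
  intro u hu c hc
  obtain ⟨l, -, ψ, hψ, hlim⟩ := hK.tendsto_subseq hu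
  obtain ⟨N, hN⟩ := Metric.cauchySeq_iff.1 hlim.cauchySeq (ε / c) (by positivity)
  refine ⟨ψ N, ψ (N + 1), hψ (by omega), ?_⟩
  refine Metric.mem_cthickening_of_dist_le _ (u (ψ N)) ε K (hu _) ?_
  have h := hN N le_rfl (N + 1) (by omega)
  rw [dist_eq_norm] at h
  rw [dist_eq_norm, add_sub_cancel_left, norm_smul, Real.norm_of_nonneg hc.le]
  simp only [Function.comp] at h
  rw [lt_div_iff₀ hc] at h
  linarith

/-- A logarithmic grading of `[0, B]` by `ℕ∞`, reversing the order up to a factor close to one. -/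
theorem exists_log_grading {B c : ℝ} (hc : 0 < c) :
    ∃ N : ℝ → ℕ∞, ∀ u v, 0 ≤ u → u ≤ B → 0 ≤ v → v ≤ B → N u ≤ N v → c * v ≤ (1 + c) * u := by
  classical
  -- The grade of `u` is the `k` with `B * r ^ (k + 1) < u ≤ B * r ^ k`, and `⊤` for `u = 0`.
  set r : ℝ := c / (1 + c) with hr
  have hr0 : 0 < r := by positivity
  have hr1 : r < 1 := by rw [hr, div_lt_one (by positivity)]; linarith
  have key : ∀ u : ℝ, ∃ m : ℕ∞, 0 ≤ u → u ≤ B → (u = 0 ∧ m = ⊤) ∨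
      ∃ k : ℕ, m = k ∧ B * r ^ (k + 1) < u ∧ u ≤ B * r ^ k := by
    intro u
    by_cases hu : 0 < u ∧ u ≤ B
    · have hB : 0 < B := hu.1.trans_le hu.2
      obtain ⟨k, h1, h2⟩ := exists_nat_pow_near_of_lt_one (x := u / B) (div_pos hu.1 hB)
        ((div_le_one hB).2 hu.2) hr0 hr1
      refine ⟨k, fun _ _ => Or.inr ⟨k, rfl, ?_, ?_⟩⟩
      · rw [lt_div_iff₀ hB] at h1; linarith
      · rw [div_le_iff₀ hB] at h2; linarith
    · refine ⟨⊤, fun h0 hB => Or.inl ⟨?_, rfl⟩⟩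
      by_contra hne
      exact hu ⟨lt_of_le_of_ne h0 (Ne.symm hne), hB⟩
  choose N hN using key
  refine ⟨N, fun u v hu0 huB hv0 hvB huv => ?_⟩
  rcases hN v hv0 hvB with ⟨rfl, -⟩ | ⟨m, hm, -, hm2⟩
  · simp only [mul_zero]; positivity
  rcases hN u hu0 huB with ⟨rfl, hu⟩ | ⟨k, hk, hk1, -⟩
  · rw [hu, hm] at huv
    exact absurd huv (by simp)
  · rw [hk, hm] at huv
    have hkm : k ≤ m := by exact_mod_cast huv
    have hB : 0 ≤ B := hu0.trans huB
    have h1 : B * r ^ m ≤ B * r ^ k :=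
      mul_le_mul_of_nonneg_left (pow_le_pow_of_le_one hr0.le hr1.le hkm) hB
    have h2 : r * v ≤ u := by
      calc r * v ≤ r * (B * r ^ k) := mul_le_mul_of_nonneg_left (hm2.trans h1) hr0.le
        _ = B * r ^ (k + 1) := by ring
        _ ≤ u := hk1.le
    have h3 : (1 + c) * (r * v) = c * v := by rw [hr]; field_simp
    rw [← h3]
    exact mul_le_mul_of_nonneg_left h2 (by positivity)

/-- Dickson's lemma for bounded nonnegative vectors: in a sequence of such vectors there are two
for which the later one is at most the earlier one, up to a factor close to one. -/
theorem exists_lt_forall_mul_le {ι : Type*} [Finite ι] {B c : ℝ} (hc : 0 < c) (w : ℕ → ι → ℝ)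
    (hw0 : ∀ k i, 0 ≤ w k i) (hwB : ∀ k i, w k i ≤ B) :
    ∃ j k, j < k ∧ ∀ i, c * w k i ≤ (1 + c) * w j i := by
  obtain ⟨N, hN⟩ := exists_log_grading (B := B) hc
  obtain ⟨j, k, hjk, h⟩ := wellQuasiOrdered_le (fun k i => N (w k i))
  exact ⟨j, k, hjk, fun i => hN _ _ (hw0 _ _) (hwB _ _) (hw0 _ _) (hwB _ _) (h i)⟩

/-- If `{x ≥ 0 : A x = r}` is nonempty and bounded, then `{x ≥ 0 : A x ∈ s}` is bounded for every
bounded set `s`: the recession cone does not depend on the right-hand side. -/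
theorem isBounded_nonneg_preimage {n m : ℕ} (A : Matrix (Fin m) (Fin n) ℝ) {r : Fin m → ℝ}
    (hne : {x : Dec n | A *ᵥ x.ofLp = r ∧ ∀ i, 0 ≤ x i}.Nonempty)
    (hb : Bornology.IsBounded {x : Dec n | A *ᵥ x.ofLp = r ∧ ∀ i, 0 ≤ x i})
    {s : Set (Fin m → ℝ)} (hs : Bornology.IsBounded s) :
    Bornology.IsBounded {x : Dec n | A *ᵥ x.ofLp ∈ s ∧ ∀ i, 0 ≤ x i} := by
  obtain ⟨x₀, hx₀, hx₀'⟩ := hne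
  have hcont : Continuous fun x : Dec n => A *ᵥ x.ofLp :=
    Continuous.matrix_mulVec continuous_const (PiLp.continuous_ofLp 2 _)
  -- On unit vectors of the nonnegative orthant `‖A x‖` is bounded away from zero, since `A x = 0`
  -- would make `{x ≥ 0 : A x = r}` unbounded in the direction `x`.
  set C : Set (Dec n) := {x | (∀ i, 0 ≤ x i) ∧ ‖x‖ = 1} with hC
  have hCclosed : IsClosed C := by
    have h1 : IsClosed {x : Dec n | ∀ i, 0 ≤ x i} := by
      simp only [Set.ofPred_forall]
      exact isClosed_iInter fun i => isClosed_le continuous_const (by fun_prop)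
    exact h1.inter (isClosed_eq continuous_norm continuous_const)
  have hCcomp : IsCompact C := by
    refine (isCompact_sphere (0 : Dec n) 1).of_isClosed_subset hCclosed ?_
    intro x hx; simpa using hx.2
  have hpos : ∀ x ∈ C, 0 < ‖A *ᵥ x.ofLp‖ := by
    intro x hx
    rw [norm_pos_iff]
    intro h0
    obtain ⟨ρ, hρ⟩ := hb.exists_norm_le
    have hρ0 : 0 ≤ ρ := (norm_nonneg _).trans (hρ x₀ ⟨hx₀, hx₀'⟩)
    have hmem : x₀ + (ρ + ‖x₀‖ + 1) • x ∈ {x : Dec n | A *ᵥ x.ofLp = r ∧ ∀ i, 0 ≤ x i} := by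
      refine ⟨?_, fun i => ?_⟩
      · simp [Matrix.mulVec_add, Matrix.mulVec_smul, h0, hx₀]
      · have := hx₀' i
        have := hx.1 i
        simp only [PiLp.add_apply, PiLp.smul_apply, smul_eq_mul]
        positivity
    have h1 := hρ _ hmem
    have h2 : ‖(ρ + ‖x₀‖ + 1) • x‖ = ρ + ‖x₀‖ + 1 := by
      rw [norm_smul, hx.2, mul_one, Real.norm_of_nonneg (by positivity)]
    rw [add_comm] at h1
    have h4 : ‖(ρ + ‖x₀‖ + 1) • x‖ ≤ ‖(ρ + ‖x₀‖ + 1) • x + x₀‖ + ‖x₀‖ := by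
      simpa using norm_sub_le ((ρ + ‖x₀‖ + 1) • x + x₀) x₀
    linarith
  obtain ⟨κ, hκ, hκle⟩ : ∃ κ > 0, ∀ x ∈ C, κ ≤ ‖A *ᵥ x.ofLp‖ := by
    rcases C.eq_empty_or_nonempty with h | h
    · exact ⟨1, one_pos, by simp [h]⟩
    · obtain ⟨z, hz, hmin⟩ := hCcomp.exists_isMinOn h hcont.norm.continuousOn
      exact ⟨_, hpos z hz, fun x hx => hmin hx⟩
  obtain ⟨ρ, hρ⟩ := hs.exists_norm_le
  refine isBounded_iff_forall_norm_le.2 ⟨ρ / κ, fun x hx => ?_⟩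
  rw [le_div_iff₀ hκ]
  have hxρ := hρ _ hx.1
  rcases eq_or_ne x 0 with rfl | hx0
  · simpa using (norm_nonneg _).trans hxρ
  have hn : 0 < ‖x‖ := norm_pos_iff.2 hx0
  have h1 := hκle (‖x‖⁻¹ • x) ⟨fun i => ?_, ?_⟩
  · rw [WithLp.ofLp_smul, Matrix.mulVec_smul, norm_smul, norm_inv, norm_norm] at h1
    have h2 := mul_le_mul_of_nonneg_left h1 hn.le
    rw [mul_inv_cancel_left₀ hn.ne'] at h2
    linarith
  · have := hx.2 i
    simp only [PiLp.smul_apply, smul_eq_mul]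
    positivity
  · rw [norm_smul, norm_inv, norm_norm, inv_mul_cancel₀ hn.ne']

/-! ### Finiteness of the value functions -/

theorem ereal_coe_sum {ι : Type*} (s : Finset ι) (f : ι → ℝ) :
    ((∑ i ∈ s, f i : ℝ) : EReal) = ∑ i ∈ s, (f i : EReal) := by
  classical
  induction s using Finset.induction_on with
  | empty => simp
  | insert a s ha ih => rw [Finset.sum_insert ha, Finset.sum_insert ha, EReal.coe_add, ih]

/-- The extended-real valued function `h` is finite and bounded below on `K`. -/
def FiniteBddBelowOn {α : Type*} (h : α → EReal) (K : Set α) : Prop :=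
  (∀ y ∈ K, h y ≠ ⊤) ∧ ∃ m : ℝ, ∀ y ∈ K, (m : EReal) ≤ h y

namespace FiniteBddBelowOn

variable {α : Type*} {h : α → EReal} {K : Set α}

theorem ne_bot (H : FiniteBddBelowOn h K) {y : α} (hy : y ∈ K) : h y ≠ ⊥ := by
  obtain ⟨m, hm⟩ := H.2
  exact ne_bot_of_le_ne_bot (EReal.coe_ne_bot m) (hm y hy)

theorem coe_toReal (H : FiniteBddBelowOn h K) {y : α} (hy : y ∈ K) : ((h y).toReal : EReal) = h y :=
  EReal.coe_toReal (H.1 y hy) (H.ne_bot hy)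

end FiniteBddBelowOn

theorem exists_le_affine_of_isBounded {n : ℕ} {K : Set (Dec n)} (hK : Bornology.IsBounded K) (a : ℝ)
    (s : Dec n) : ∃ m : ℝ, ∀ y ∈ K, m ≤ a + inner ℝ s y := by
  obtain ⟨ρ, hρ⟩ := hK.exists_norm_le
  refine ⟨a - ‖s‖ * ρ, fun y hy => ?_⟩
  have h1 := abs_le.1 (abs_real_inner_le_norm s y)
  have h2 := mul_le_mul_of_nonneg_left (hρ y hy) (norm_nonneg s)
  linarith [h1.1]

section StageVal

variable {n : ℕ} {Ξ : Type*} {M : StageModel n Ξ} {K : Set (Dec n)} {t : ℕ} {x y : Dec n} {θ : Ξ}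
  {V W : Dec n → ℕ → EReal} {d : ℕ}

/-- The stage-`t` problem at the decision `x` and the realization `θ` is feasible, its feasible
decisions lie in `K`, and its cost is finite and bounded below. -/
structure Recourse (M : StageModel n Ξ) (K : Set (Dec n)) (t : ℕ) (x : Dec n) (θ : Ξ) : Prop where
  nonempty : (M.feas t x θ).Nonempty
  subset : M.feas t x θ ⊆ K
  cost : FiniteBddBelowOn (fun y => M.cost t y x θ) (M.feas t x θ)

theorem stageVal_one (M : StageModel n Ξ) (V : Dec n → ℕ → EReal) (t : ℕ) (x : Dec n) (θ : Ξ)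
    (d : ℕ) : stageVal M V t x 1 θ d = ⨅ y ∈ M.feas t x θ, (M.cost t y x θ + V y d) := by
  simp [stageVal]

theorem stageVal_mono (h : ∀ y, V y d ≤ W y d) :
    stageVal M V t x 1 θ d ≤ stageVal M W t x 1 θ d :=
  iInf₂_mono fun y _ => add_le_add le_rfl (h y)

theorem stageVal_le (hy : y ∈ M.feas t x θ) :
    stageVal M V t x 1 θ d ≤ M.cost t y x θ + V y d := by
  rw [stageVal_one]
  exact iInf₂_le y hy

namespace Recourse

variable (H : Recourse M K t x θ) (hV : FiniteBddBelowOn (fun y => V y d) K)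
include H hV

theorem coe_toReal_add (hy : y ∈ M.feas t x θ) :
    (((M.cost t y x θ).toReal + (V y d).toReal : ℝ) : EReal) = M.cost t y x θ + V y d := by
  rw [EReal.coe_add, H.cost.coe_toReal hy, hV.coe_toReal (H.subset hy)]

theorem stageVal_ne_top : stageVal M V t x 1 θ d ≠ ⊤ := by
  obtain ⟨y, hy⟩ := H.nonempty
  refine ne_top_of_le_ne_top ?_ (stageVal_le hy)
  rw [← H.coe_toReal_add hV hy]
  exact EReal.coe_ne_top _

theorem stageVal_ne_bot : stageVal M V t x 1 θ d ≠ ⊥ := by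
  obtain ⟨m, hm⟩ := H.cost.2
  obtain ⟨m', hm'⟩ := hV.2
  refine ne_bot_of_le_ne_bot (EReal.coe_ne_bot (m + m')) ?_
  rw [stageVal_one, EReal.coe_add]
  exact le_iInf₂ fun y hy => add_le_add (hm y hy) (hm' y (H.subset hy))

theorem coe_toReal_stageVal :
    ((stageVal M V t x 1 θ d).toReal : EReal) = stageVal M V t x 1 θ d :=
  EReal.coe_toReal (H.stageVal_ne_top hV) (H.stageVal_ne_bot hV)

theorem toReal_stageVal_le (hy : y ∈ M.feas t x θ) :
    (stageVal M V t x 1 θ d).toReal ≤ (M.cost t y x θ).toReal + (V y d).toReal := by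
  rw [← EReal.coe_le_coe_iff, H.coe_toReal_stageVal hV, H.coe_toReal_add hV hy]
  exact stageVal_le hy

theorem exists_le_add {δ : ℝ} (hδ : 0 < δ) : ∃ y ∈ M.feas t x θ,
    (M.cost t y x θ).toReal + (V y d).toReal ≤ (stageVal M V t x 1 θ d).toReal + δ := by
  have h1 : stageVal M V t x 1 θ d < (((stageVal M V t x 1 θ d).toReal + δ : ℝ) : EReal) := by
    conv_lhs => rw [← H.coe_toReal_stageVal hV]
    rw [EReal.coe_lt_coe_iff]
    linarith
  conv_lhs at h1 => rw [stageVal_one]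
  obtain ⟨y, hy⟩ := iInf_lt_iff.1 h1
  obtain ⟨hy1, hy2⟩ := iInf_lt_iff.1 hy
  rw [← H.coe_toReal_add hV hy1, EReal.coe_lt_coe_iff] at hy2
  exact ⟨y, hy1, hy2.le⟩

end Recourse

end StageVal

/-! ### Probabilities of the data process -/

section Prob

variable {Ω : Type*} [MeasurableSpace Ω] {P : Measure Ω} {Ξ : Type*} [MeasurableSpace Ξ]

namespace Uncertainty

theorem p_nonneg (U : Uncertainty P Ξ) (t : ℕ) (θ : Ξ) : 0 ≤ U.p t θ := measureReal_nonneg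

theorem two_le_Tmax [IsProbabilityMeasure P] (U : Uncertainty P Ξ) : 2 ≤ U.Tmax := by
  obtain ⟨ω, hω⟩ := U.T_mem.exists
  have := Finset.mem_Icc.1 hω
  omega

theorem D_eq_one_iff (U : Uncertainty P Ξ) {t : ℕ} {ω : Ω} : U.D t ω = 1 ↔ t < U.T ω := by
  simp [D]

theorem D_mem (U : Uncertainty P Ξ) (t : ℕ) (ω : Ω) : U.D t ω = 0 ∨ U.D t ω = 1 := by
  unfold D; split <;> simp

theorem measurable_D (U : Uncertainty P Ξ) (t : ℕ) : Measurable (U.D t) :=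
  Measurable.ite (measurableSet_lt measurable_const U.measurable_T) measurable_const
    measurable_const

theorem alive_pos (U : Uncertainty P Ξ) {t : ℕ} (ht : t < U.Tmax) : P {ω | U.D t ω = 1} ≠ 0 := by
  refine (U.Tmax_pos.trans_le (measure_mono fun ω hω => ?_)).ne'
  simp only [Set.mem_ofPred_eq] at hω ⊢
  rw [U.D_eq_one_iff, hω]
  exact ht

theorem measurableSet_alive (U : Uncertainty P Ξ) (t : ℕ) (d : ℕ) :
    MeasurableSet {ω | U.D t ω = d} :=
  U.measurable_D t (measurableSet_singleton d)

theorem q_nonneg (U : Uncertainty P Ξ) (t : ℕ) : 0 ≤ U.q t := measureReal_nonneg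

variable [IsProbabilityMeasure P]

theorem q_le_one (U : Uncertainty P Ξ) {t : ℕ} (ht : t ∈ Finset.Icc 2 U.Tmax) : U.q t ≤ 1 := by
  have h := Finset.mem_Icc.1 ht
  have := cond_isProbabilityMeasure (U.alive_pos (t := t - 1) (by omega))
  exact measureReal_le_one

theorem q_mul (U : Uncertainty P Ξ) {t : ℕ} (ht : t ∈ Finset.Icc 2 U.Tmax) :
    U.q t * P.real {ω | U.D (t - 1) ω = 1} = P.real {ω | U.D (t - 1) ω = 1 ∧ U.D t ω = 0} := by
  have h := Finset.mem_Icc.1 ht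
  rw [q, measureReal_def, cond_apply (U.measurableSet_alive _ _), ENNReal.toReal_mul,
    ENNReal.toReal_inv, ← measureReal_def, ← measureReal_def]
  have h0 : P.real {ω | U.D (t - 1) ω = 1} ≠ 0 := by
    rw [measureReal_def, Ne, ENNReal.toReal_eq_zero_iff]
    push Not
    exact ⟨U.alive_pos (by omega), measure_ne_top _ _⟩
  rw [mul_right_comm, inv_mul_cancel₀ h0, one_mul]
  rfl

theorem one_sub_q_mul (U : Uncertainty P Ξ) {t : ℕ} (ht : t ∈ Finset.Icc 2 U.Tmax) :
    (1 - U.q t) * P.real {ω | U.D (t - 1) ω = 1} =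
      P.real {ω | U.D (t - 1) ω = 1 ∧ U.D t ω = 1} := by
  have h1 : P.real {ω | U.D (t - 1) ω = 1} =
      P.real {ω | U.D (t - 1) ω = 1 ∧ U.D t ω = 0} +
        P.real {ω | U.D (t - 1) ω = 1 ∧ U.D t ω = 1} := by
    rw [← measureReal_union]
    · congr 1
      ext ω
      rcases U.D_mem t ω with h | h <;> simp [h]
    · rw [Set.disjoint_left]
      rintro ω ⟨-, h⟩ ⟨-, h'⟩
      omega
    · exact (U.measurableSet_alive _ _).inter (U.measurableSet_alive _ _)
  rw [sub_mul, one_mul, U.q_mul ht, h1]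
  ring

end Uncertainty

end Prob

/-! ### Cost-to-go functions on the trial sets -/

section CostToGo

variable {Ω : Type*} [MeasurableSpace Ω] {P : Measure Ω}
  {Ξ : Type*} [MeasurableSpace Ξ] {n : ℕ} {M : StageModel n Ξ} {U : Uncertainty P Ξ}
  {x₀ : Dec n} {K : ℕ → Set (Dec n)}

/-- Bounded sets `K t` containing all decisions that can be reached at stage `t` from `x₀`, with
feasible stage problems from every point of these sets. -/
structure IsInvariant (M : StageModel n Ξ) (U : Uncertainty P Ξ) (x₀ : Dec n)
    (K : ℕ → Set (Dec n)) : Prop where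
  init_mem : x₀ ∈ K 0
  recourse : ∀ t ∈ Finset.Icc 1 U.Tmax, ∀ x ∈ K (t - 1), ∀ θ ∈ U.Θ t, Recourse M (K t) t x θ
  bounded : ∀ t ∈ Finset.Icc 1 U.Tmax, Bornology.IsBounded (K t)

/-- Every cost-to-go function has an affine minorant. -/
def HasAffineMinorants (M : StageModel n Ξ) (U : Uncertainty P Ξ) : Prop :=
  ∀ t ∈ Finset.Icc 2 U.Tmax, ∃ (a : ℝ) (s : Dec n),
    ∀ x, ((a + inner ℝ s x : ℝ) : EReal) ≤ costToGo M U t x 1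

theorem costToGo_eq_coe {t : ℕ} (ht : t ∈ Finset.Icc 2 U.Tmax) {x : Dec n}
    (hx : ∀ θ ∈ U.Θ t, Recourse M (K t) t x θ)
    (hV : ∀ d, d = 0 ∨ d = 1 → FiniteBddBelowOn (fun y => costToGo M U (t + 1) y d) (K t)) :
    costToGo M U t x 1 = (((1 - U.q t) * ∑ θ ∈ U.Θ t, U.p t θ *
          (stageVal M (costToGo M U (t + 1)) t x 1 θ 1).toReal +
        U.q t * ∑ θ ∈ U.Θ t, U.p t θ *
          (stageVal M (costToGo M U (t + 1)) t x 1 θ 0).toReal : ℝ) : EReal) := by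
  rw [costToGo_one M U t (Finset.mem_Icc.1 ht).2, EReal.coe_add, EReal.coe_mul (1 - U.q t),
    EReal.coe_mul (U.q t), ereal_coe_sum, ereal_coe_sum]
  simp only [EReal.coe_mul]
  congr 2
  · refine Finset.sum_congr rfl fun θ hθ => ?_
    rw [(hx θ hθ).coe_toReal_stageVal (hV 1 (Or.inr rfl))]
  · refine Finset.sum_congr rfl fun θ hθ => ?_
    rw [(hx θ hθ).coe_toReal_stageVal (hV 0 (Or.inl rfl))]

/-- Finiteness from above comes from the recursion, boundedness from below from the affine
minorants. -/
theorem IsInvariant.finiteBddBelowOn_costToGo (hK : IsInvariant M U x₀ K)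
    (hmin : HasAffineMinorants M U) {t : ℕ} (ht : t ∈ Finset.Icc 2 (U.Tmax + 1)) (d : ℕ)
    (hd : d = 0 ∨ d = 1) : FiniteBddBelowOn (fun y => costToGo M U t y d) (K (t - 1)) := by
  have zero : FiniteBddBelowOn (fun y => costToGo M U t y 0) (K (t - 1)) :=
    ⟨fun y _ => by simp [costToGo_zero], 0, fun y _ => by simp [costToGo_zero]⟩
  rcases hd with rfl | rfl
  · exact zero
  suffices H : ∀ r : ℕ, ∀ t ∈ Finset.Icc 2 (U.Tmax + 1), U.Tmax + 1 - t = r →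
      FiniteBddBelowOn (fun y => costToGo M U t y 1) (K (t - 1)) from H _ t ht rfl
  intro r
  induction r with
  | zero =>
    intro t ht hr
    obtain rfl : t = U.Tmax + 1 := by have := Finset.mem_Icc.1 ht; omega
    exact ⟨fun y _ => by simp [costToGo_last], 0, fun y _ => by simp [costToGo_last]⟩
  | succ r ih =>
    intro t ht hr
    have ht1 := Finset.mem_Icc.1 ht
    have ht2 : t ∈ Finset.Icc 2 U.Tmax := Finset.mem_Icc.2 (by omega)
    have ih' := ih (t + 1) (Finset.mem_Icc.2 (by omega)) (by omega)
    refine ⟨fun x hx => ?_, ?_⟩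
    · beta_reduce
      rw [costToGo_eq_coe ht2 (hK.recourse t (Finset.mem_Icc.2 (by omega)) x hx) ?_]
      · exact EReal.coe_ne_top _
      · rintro d (rfl | rfl)
        · exact ⟨fun y _ => by simp [costToGo_zero], 0, fun y _ => by simp [costToGo_zero]⟩
        · exact ih'
    · obtain ⟨a, s, has⟩ := hmin t ht2
      obtain ⟨m, hm⟩ := exists_le_affine_of_isBounded
        (hK.bounded (t - 1) (Finset.mem_Icc.2 (by omega))) a s
      exact ⟨m, fun y hy => (EReal.coe_le_coe_iff.2 (hm y hy)).trans (has y)⟩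

end CostToGo

/-! ### Random variables determined by finitely valued data -/

/-- Up to a null set, the value of `F` at `ω` depends only on the class of `ω` for `r`: it is a
function of the data that `r` compares. -/
def DeterminedBy {Ω β : Type*} [MeasurableSpace Ω] (μ : Measure Ω) (r : Ω → Ω → Prop)
    (F : Ω → β) : Prop :=
  ∃ A ∈ ae μ, ∀ ω ∈ A, ∀ ω' ∈ A, r ω ω' → F ω = F ω'

namespace DeterminedBy

variable {Ω β γ δ : Type*} [MeasurableSpace Ω] {μ : Measure Ω} {r r' : Ω → Ω → Prop}
  {F : Ω → β} {G : Ω → γ}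

theorem of_forall (h : ∀ ω ω', r ω ω' → F ω = F ω') : DeterminedBy μ r F :=
  ⟨Set.univ, univ_mem, fun ω _ ω' _ hr => h ω ω' hr⟩

theorem mono (h : DeterminedBy μ r F) (hr : ∀ ω ω', r' ω ω' → r ω ω') : DeterminedBy μ r' F :=
  let ⟨A, hA, H⟩ := h
  ⟨A, hA, fun ω h1 ω' h2 h3 => H ω h1 ω' h2 (hr ω ω' h3)⟩

theorem comp₂ (h : DeterminedBy μ r F) (h' : DeterminedBy μ r G) (φ : β → γ → δ) :
    DeterminedBy μ r (fun ω => φ (F ω) (G ω)) :=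
  let ⟨A, hA, H⟩ := h
  let ⟨A', hA', H'⟩ := h'
  ⟨A ∩ A', inter_mem hA hA', fun ω h1 ω' h2 h3 => by
    simp only [H ω h1.1 ω' h2.1 h3, H' ω h1.2 ω' h2.2 h3]⟩

theorem of_imp (h : DeterminedBy μ r F) (hG : ∀ ω ω', F ω = F ω' → G ω = G ω') :
    DeterminedBy μ r G :=
  let ⟨A, hA, H⟩ := h
  ⟨A, hA, fun ω h1 ω' h2 h3 => hG ω ω' (H ω h1 ω' h2 h3)⟩

theorem congr (h : DeterminedBy μ r F) {F' : Ω → β} (hF : F' =ᵐ[μ] F) : DeterminedBy μ r F' :=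
  let ⟨A, hA, H⟩ := h
  ⟨A ∩ {ω | F' ω = F ω}, inter_mem hA hF, fun ω h1 ω' h2 h3 => by
    rw [show F' ω = F ω from h1.2, show F' ω' = F ω' from h2.2, H ω h1.1 ω' h2.1 h3]⟩

theorem pi {ι : Type*} [Countable ι] {β : ι → Type*} {F : (i : ι) → Ω → β i}
    (h : ∀ i, DeterminedBy μ r (F i)) : DeterminedBy μ r (fun ω i => F i ω) := by
  choose A hA H using h
  refine ⟨⋂ i, A i, countable_iInter_mem.2 hA, fun ω h1 ω' h2 h3 => funext fun i => ?_⟩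
  exact H i ω (Set.mem_iInter.1 h1 i) ω' (Set.mem_iInter.1 h2 i) h3

/-- The function `φ` need not be measurable; for finitely valued data this does not matter. -/
theorem exists_comp [Nonempty β] {h : Ω → δ} (H : DeterminedBy μ (fun ω ω' => h ω = h ω') F) :
    ∃ φ : δ → β, F =ᵐ[μ] φ ∘ h := by
  classical
  obtain ⟨A, hA, H⟩ := H
  refine ⟨fun w => if hw : ∃ ω ∈ A, h ω = w then F hw.choose else Classical.arbitrary β, ?_⟩
  filter_upwards [hA] with ω hω
  have hw : ∃ ω' ∈ A, h ω' = h ω := ⟨ω, hω, rfl⟩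
  simp only [Function.comp, dif_pos hw]
  exact H ω hω _ hw.choose_spec.1 hw.choose_spec.2.symm

end DeterminedBy

/-- The `σ`-algebra of all sets that are unions of classes of the symmetric relation `r`. -/
@[reducible]
def saturated {Ω : Type*} (r : Ω → Ω → Prop) (hsymm : ∀ ω ω', r ω ω' → r ω' ω) :
    MeasurableSpace Ω where
  MeasurableSet' s := ∀ ω ω', r ω ω' → ω ∈ s → ω' ∈ s
  measurableSet_empty _ _ _ h := h
  measurableSet_compl _ hs ω ω' h h1 h2 := h1 (hs ω' ω (hsymm _ _ h) h2)
  measurableSet_iUnion f hf ω ω' h h1 := by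
    obtain ⟨i, hi⟩ := Set.mem_iUnion.1 h1
    exact Set.mem_iUnion.2 ⟨i, hf i ω ω' h hi⟩

theorem comap_le_saturated {Ω β : Type*} [mβ : MeasurableSpace β] {r : Ω → Ω → Prop}
    (hsymm : ∀ ω ω', r ω ω' → r ω' ω) {f : Ω → β} (hf : ∀ ω ω', r ω ω' → f ω = f ω') :
    MeasurableSpace.comap f mβ ≤ saturated r hsymm := by
  rintro _ ⟨s, -, rfl⟩ ω ω' h h1
  rw [Set.mem_preimage] at h1 ⊢
  rwa [← hf ω ω' h]

/-- A function measurable for a `σ`-algebra generated by given data is, without any exceptional set,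
a function of the data. -/
theorem eq_of_measurable_saturated {Ω β : Type*} [MeasurableSpace β] [MeasurableSingletonClass β]
    {m : MeasurableSpace Ω} {r : Ω → Ω → Prop} {hsymm : ∀ ω ω', r ω ω' → r ω' ω}
    (hm : m ≤ saturated r hsymm) {F : Ω → β} (hF : Measurable[m] F) {ω ω' : Ω} (h : r ω ω') :
    F ω = F ω' :=
  (hm _ (hF (measurableSet_singleton (F ω))) ω ω' h rfl : F ω' = F ω).symm

section FiniteRange

variable {Ω δ : Type*} [MeasurableSpace Ω] {μ : Measure Ω} {h : Ω → δ} {F : Ω → ℝ} {φ : δ → ℝ}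
  {W : Finset δ}

theorem ae_eq_sum_indicator (hW : ∀ᵐ ω ∂μ, h ω ∈ W) (hF : F =ᵐ[μ] φ ∘ h) :
    F =ᵐ[μ] fun ω => ∑ w ∈ W, (h ⁻¹' {w}).indicator (fun _ => φ w) ω := by
  classical
  filter_upwards [hW, hF] with ω h1 h2
  rw [h2, Finset.sum_eq_single_of_mem (h ω) h1]
  · simp
  · intro w _ hne
    exact Set.indicator_of_notMem (fun h3 => hne h3.symm) _

variable [IsProbabilityMeasure μ] [MeasurableSpace δ] [MeasurableSingletonClass δ]

theorem integrable_of_finite_range (hh : Measurable h) (hW : ∀ᵐ ω ∂μ, h ω ∈ W)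
    (hF : F =ᵐ[μ] φ ∘ h) : Integrable F μ := by
  refine Integrable.congr ?_ (ae_eq_sum_indicator hW hF).symm
  exact integrable_finsetSum _ fun w _ =>
    (integrable_const _).indicator (hh (measurableSet_singleton w))

theorem setIntegral_of_finite_range (hh : Measurable h) (hW : ∀ᵐ ω ∂μ, h ω ∈ W)
    (hF : F =ᵐ[μ] φ ∘ h) {E : Set Ω} :
    ∫ ω in E, F ω ∂μ = ∑ w ∈ W, μ.real (h ⁻¹' {w} ∩ E) * φ w := by
  rw [integral_congr_ae (ae_restrict_of_ae (ae_eq_sum_indicator hW hF)), integral_finsetSum]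
  · refine Finset.sum_congr rfl fun w _ => ?_
    have hw : MeasurableSet (h ⁻¹' {w}) := hh (measurableSet_singleton w)
    rw [integral_indicator_const _ hw, measureReal_restrict_apply hw, smul_eq_mul]
  · exact fun w _ => ((integrable_const _).indicator (hh (measurableSet_singleton w))).restrict

end FiniteRange

/-! ### A sampled stage, given the previous ones -/

section FreshSample

variable {Ω : Type*} [MeasurableSpace Ω] {P : Measure Ω} {Ξ : Type*} [MeasurableSpace Ξ]

/-- Constraints satisfied almost surely by the trajectory `((ξ_t, D_t))_t`: the values lie in the
supports, a process alive at a stage was alive before, and it is alive at stage `1`. -/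
def Uncertainty.validTraj (U : Uncertainty P Ξ) : Set (Finset.Icc 1 U.Tmax → Ξ × ℕ) :=
  {c | (∀ s : Finset.Icc 1 U.Tmax, (c s).1 ∈ U.Θ s ∧ ((c s).2 = 0 ∨ (c s).2 = 1)) ∧
    (∀ s s', s ≤ s' → (c s').2 = 1 → (c s).2 = 1) ∧ ∀ s : Finset.Icc 1 U.Tmax, s.1 = 1 → (c s).2 = 1}

theorem Uncertainty.measurableSet_validTraj [MeasurableSingletonClass Ξ] (U : Uncertainty P Ξ) :
    MeasurableSet U.validTraj := by
  have h1 : ∀ s : Finset.Icc 1 U.Tmax, Measurable fun c : Finset.Icc 1 U.Tmax → Ξ × ℕ => (c s).1 :=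
    fun s => measurable_fst.comp (measurable_pi_apply s)
  have h2 : ∀ s : Finset.Icc 1 U.Tmax, Measurable fun c : Finset.Icc 1 U.Tmax → Ξ × ℕ => (c s).2 :=
    fun s => measurable_snd.comp (measurable_pi_apply s)
  have h3 : U.validTraj =
      (⋂ s : Finset.Icc 1 U.Tmax, (fun c => (c s).1) ⁻¹' (U.Θ s) ∩ (fun c => (c s).2) ⁻¹' {0, 1}) ∩
      ((⋂ s : Finset.Icc 1 U.Tmax, ⋂ s' : Finset.Icc 1 U.Tmax,
          (fun c => ((c s').2, (c s).2)) ⁻¹' {p | s ≤ s' → p.1 = 1 → p.2 = 1}) ∩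
        ⋂ s : Finset.Icc 1 U.Tmax, (fun c => (c s).2) ⁻¹' {p | s.1 = 1 → p = 1}) := by
    ext c
    simp only [Uncertainty.validTraj, Set.mem_inter_iff, Set.mem_iInter, Set.mem_preimage,
      Set.mem_insert_iff, Set.mem_singleton_iff, Finset.mem_coe, Set.mem_ofPred_eq]
  rw [h3]
  refine MeasurableSet.inter (MeasurableSet.iInter fun s => ?_) (MeasurableSet.inter
    (MeasurableSet.iInter fun s => MeasurableSet.iInter fun s' => ?_)
    (MeasurableSet.iInter fun s => ?_))
  · exact (h1 s (U.Θ s).measurableSet).inter (h2 s (Set.toFinite _).measurableSet)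
  · exact ((h2 s').prodMk (h2 s)) MeasurableSet.of_discrete
  · exact h2 s MeasurableSet.of_discrete

theorem Uncertainty.ae_traj_valid (U : Uncertainty P Ξ) : ∀ᵐ ω ∂P, U.traj ω ∈ U.validTraj := by
  have h1 : ∀ᵐ ω ∂P, ∀ s : Finset.Icc 1 U.Tmax, U.ξ s ω ∈ U.Θ s :=
    ae_all_iff.2 fun s => U.ξ_mem s s.2
  filter_upwards [h1, U.T_mem] with ω h1 h2
  refine ⟨fun s => ⟨h1 s, U.D_mem s ω⟩, fun s s' hs h => ?_, fun s hs => ?_⟩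
  · have h' : U.D s' ω = 1 := h
    have hs' : (s : ℕ) ≤ s' := hs
    rw [U.D_eq_one_iff] at h'
    exact U.D_eq_one_iff.2 (by omega)
  · have := (Finset.mem_Icc.1 h2).1
    exact U.D_eq_one_iff.2 (by omega)

/-- The probability `ℙ(D_t = d | D_{t-1} = 1)`. -/
noncomputable def Uncertainty.trans (U : Uncertainty P Ξ) (t d : ℕ) : ℝ :=
  if d = 1 then 1 - U.q t else U.q t

theorem Uncertainty.trans_mul [IsProbabilityMeasure P] (U : Uncertainty P Ξ) {t : ℕ}
    (ht : t ∈ Finset.Icc 2 U.Tmax) {d : ℕ} (hd : d = 0 ∨ d = 1) :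
    U.trans t d * P.real {ω | U.D (t - 1) ω = 1} = P.real {ω | U.D (t - 1) ω = 1 ∧ U.D t ω = d} := by
  rcases hd with rfl | rfl
  · simpa [Uncertainty.trans] using U.q_mul ht
  · simpa [Uncertainty.trans] using U.one_sub_q_mul ht

variable [MeasurableSingletonClass Ξ]

/-- The factorization of probabilities due to the independence of `(ξ_s)_{s < t}`, `ξ_t` and the
death process. -/
theorem Uncertainty.measureReal_prefix [IsProbabilityMeasure P] (U : Uncertainty P Ξ) {t : ℕ}
    (ht : t ∈ Finset.Icc 2 U.Tmax) (θ : Ξ) {d : ℕ} (hd : d = 0 ∨ d = 1)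
    (e : Finset.Icc 1 U.Tmax → Ξ) :
    P.real {ω | (∀ s : Finset.Icc 1 U.Tmax, s.1 < t → U.ξ s ω = e s) ∧ U.ξ t ω = θ ∧
        U.D (t - 1) ω = 1 ∧ U.D t ω = d} =
      U.trans t d * U.p t θ * P.real {ω | (∀ s : Finset.Icc 1 U.Tmax, s.1 < t → U.ξ s ω = e s) ∧
        U.D (t - 1) ω = 1} := by
  have ht1 : t ∈ Finset.Icc 1 U.Tmax := by
    have := Finset.mem_Icc.1 ht; exact Finset.mem_Icc.2 (by omega)
  set τ : Finset.Icc 1 U.Tmax := ⟨t, ht1⟩ with hτ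
  set A₀ : Set (Finset.Icc 1 U.Tmax → Ξ) := ⋂ s, {v | s.1 < t → v s = e s} with hA₀
  have hm₀ : MeasurableSet A₀ := by
    refine MeasurableSet.iInter fun s => ?_
    by_cases hs : s.1 < t
    · simp only [hs, forall_const]
      exact (measurable_pi_apply s : Measurable fun v : Finset.Icc 1 U.Tmax → Ξ => v s)
        (measurableSet_singleton (e s))
    · simp [hs]
  set A₁ : Set (Finset.Icc 1 U.Tmax → Ξ) := A₀ ∩ (fun v => v τ) ⁻¹' {θ} with hA₁
  have hm₁ : MeasurableSet A₁ := hm₀.inter (measurable_pi_apply τ (measurableSet_singleton θ))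
  set ξv : Ω → Finset.Icc 1 U.Tmax → Ξ := fun ω s => U.ξ s ω with hξv
  have hind : P.real (ξv ⁻¹' A₁) = P.real (ξv ⁻¹' A₀) * U.p t θ := by
    classical
    have hdisj : Disjoint (Finset.univ.filter fun s : Finset.Icc 1 U.Tmax => s.1 < t) {τ} := by
      simp [hτ]
    have h1 := U.indep_ξ.indepFun_finset _ _ hdisj (fun s => U.measurable_ξ s s.2)
    have h2 := h1.measure_inter_preimage_eq_mul
      (⋂ s, (fun v => v s) ⁻¹' {e s}) ((fun v => v ⟨τ, Finset.mem_singleton_self τ⟩) ⁻¹' {θ})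
      (MeasurableSet.iInter fun s => measurable_pi_apply s (measurableSet_singleton _))
      (measurable_pi_apply _ (measurableSet_singleton θ))
    have h3 : (fun a (i : (Finset.univ.filter fun s : Finset.Icc 1 U.Tmax => s.1 < t)) =>
        U.ξ (i.1 : ℕ) a) ⁻¹' (⋂ s, (fun v => v s) ⁻¹' {e s}) = ξv ⁻¹' A₀ := by
      ext ω
      simp [hA₀, hξv]
    rw [h3] at h2
    have h4 := congrArg ENNReal.toReal h2
    rw [ENNReal.toReal_mul] at h4
    exact h4
  have hT := U.indep_T
  have hcomb : ∀ (S : Set ℕ) (A : Set (Finset.Icc 1 U.Tmax → Ξ)), MeasurableSet A →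
      P.real (U.T ⁻¹' S ∩ ξv ⁻¹' A) = P.real (U.T ⁻¹' S) * P.real (ξv ⁻¹' A) := by
    intro S A hA
    have h4 := congrArg ENNReal.toReal
      (hT.measure_inter_preimage_eq_mul S A (MeasurableSet.of_discrete) hA)
    rw [ENNReal.toReal_mul] at h4
    exact h4
  have hS₀ : {ω | U.D (t - 1) ω = 1} = U.T ⁻¹' {m | t - 1 < m} := by
    ext ω; simp [U.D_eq_one_iff]
  have hS₁ : {ω | U.D (t - 1) ω = 1 ∧ U.D t ω = d} =
      U.T ⁻¹' {m | t - 1 < m ∧ (if t < m then 1 else 0) = d} := by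
    ext ω; simp [U.D_eq_one_iff]; simp [Uncertainty.D]
  have e₀ : {ω | (∀ s : Finset.Icc 1 U.Tmax, s.1 < t → U.ξ s ω = e s) ∧ U.D (t - 1) ω = 1} =
      U.T ⁻¹' {m | t - 1 < m} ∩ ξv ⁻¹' A₀ := by
    rw [← hS₀]
    ext ω; simp [hA₀, hξv, and_comm]
  have e₁ : {ω | (∀ s : Finset.Icc 1 U.Tmax, s.1 < t → U.ξ s ω = e s) ∧ U.ξ t ω = θ ∧
        U.D (t - 1) ω = 1 ∧ U.D t ω = d} =
      U.T ⁻¹' {m | t - 1 < m ∧ (if t < m then 1 else 0) = d} ∩ ξv ⁻¹' A₁ := by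
    rw [← hS₁]
    ext ω; simp [hA₁, hA₀, hξv, hτ]; tauto
  rw [e₀, e₁, hcomb _ _ hm₀, hcomb _ _ hm₁, hind, ← hS₀, ← hS₁, ← U.trans_mul ht hd]
  ring

/-- `c` is a random trajectory with the law of `((ξ_t, D_t))_t`, independent of the finitely valued
random variable `X`. -/
structure IsFreshSample {Ω' α : Type*} [MeasurableSpace Ω'] [MeasurableSpace α] (μ : Measure Ω')
    (U : Uncertainty P Ξ) (X : Ω' → α) (c : Ω' → Finset.Icc 1 U.Tmax → Ξ × ℕ) : Prop where
  measurable_past : Measurable X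
  finite_past : ∃ s : Finset α, ∀ᵐ ω ∂μ, X ω ∈ s
  law : IdentDistrib c U.traj μ P
  measurable_cur : Measurable c
  indep : IndepFun X c μ

/-- Two outcomes with the same past and the same first stages `s ≤ t` of the current trajectory. -/
def SamePrefix {Ω' α β : Type*} {N : ℕ} (X : Ω' → α) (c : Ω' → Finset.Icc 1 N → β) (t : ℕ)
    (ω ω' : Ω') : Prop :=
  X ω = X ω' ∧ ∀ s : Finset.Icc 1 N, s.1 ≤ t → c ω s = c ω' s

namespace IsFreshSample

variable {Ω' α : Type*} [MeasurableSpace Ω'] [MeasurableSpace α] [MeasurableSingletonClass α]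
  {μ : Measure Ω'} [IsProbabilityMeasure μ] {U : Uncertainty P Ξ} {X : Ω' → α}
  {c : Ω' → Finset.Icc 1 U.Tmax → Ξ × ℕ}

omit [MeasurableSingletonClass α] [IsProbabilityMeasure μ] in
theorem ae_valid (H : IsFreshSample μ U X c) : ∀ᵐ ω ∂μ, c ω ∈ U.validTraj :=
  H.law.symm.ae_snd U.measurableSet_validTraj U.ae_traj_valid

omit [IsProbabilityMeasure μ] in
/-- Conditionally on the past and on the stages before `t`, on the event `D_{t-1} = 1` the pair
`(ξ_t, D_t)` takes the value `(θ, d)` with probability `ℙ(ξ_t = θ) ℙ(D_t = d | D_{t-1} = 1)`. -/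
theorem measureReal_atom [IsProbabilityMeasure P] (H : IsFreshSample μ U X c) {t : ℕ}
    (ht : t ∈ Finset.Icc 1 U.Tmax) (ht' : t - 1 ∈ Finset.Icc 1 U.Tmax) (θ : Ξ) {d : ℕ}
    (hd : d = 0 ∨ d = 1) (w : α × (Finset.Icc 1 U.Tmax → Ξ × ℕ)) :
    μ.real ((fun ω => (X ω, fun s : Finset.Icc 1 U.Tmax =>
        if s.1 ≤ t - 1 then c ω s else (U.ξ₁, 0))) ⁻¹' {w} ∩
        {ω | (c ω ⟨t - 1, ht'⟩).2 = 1 ∧ c ω ⟨t, ht⟩ = (θ, d)}) =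
      U.trans t d * U.p t θ * μ.real ((fun ω => (X ω, fun s : Finset.Icc 1 U.Tmax =>
        if s.1 ≤ t - 1 then c ω s else (U.ξ₁, 0))) ⁻¹' {w} ∩
        {ω | (c ω ⟨t - 1, ht'⟩).2 = 1}) := by
  have hm : t ∈ Finset.Icc 2 U.Tmax := by
    have h1 := Finset.mem_Icc.1 ht; have h2 := Finset.mem_Icc.1 ht'
    exact Finset.mem_Icc.2 (by omega)
  have hm' := Finset.mem_Icc.1 hm
  obtain ⟨a, e⟩ := w
  set B : Set (Finset.Icc 1 U.Tmax → Ξ × ℕ) :=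
    ⋂ s : Finset.Icc 1 U.Tmax, {v | (if s.1 ≤ t - 1 then v s else (U.ξ₁, 0)) = e s} with hB
  have hBm : MeasurableSet B := by
    refine MeasurableSet.iInter fun s => ?_
    by_cases hs : s.1 ≤ t - 1
    · simp only [hs, if_true]
      exact (measurable_pi_apply s : Measurable fun v : Finset.Icc 1 U.Tmax → Ξ × ℕ => v s)
        (measurableSet_singleton (e s))
    · simp [hs]
  set E₀ : Set (Finset.Icc 1 U.Tmax → Ξ × ℕ) := (fun v => (v ⟨t - 1, ht'⟩).2) ⁻¹' {1} with hE₀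
  have hE₀m : MeasurableSet E₀ :=
    (measurable_snd.comp (measurable_pi_apply _)) (measurableSet_singleton 1)
  set E₁ : Set (Finset.Icc 1 U.Tmax → Ξ × ℕ) :=
    E₀ ∩ (fun v => v ⟨t, ht⟩) ⁻¹' {(θ, d)} with hE₁
  have hE₁m : MeasurableSet E₁ :=
    hE₀m.inter (measurable_pi_apply _ (measurableSet_singleton _))
  have key : ∀ S : Set (Finset.Icc 1 U.Tmax → Ξ × ℕ), MeasurableSet S →
      μ.real (X ⁻¹' {a} ∩ c ⁻¹' S) = μ.real (X ⁻¹' {a}) * P.real (U.traj ⁻¹' S) := by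
    intro S hS
    have h1 := congrArg ENNReal.toReal
      (H.indep.measure_inter_preimage_eq_mul {a} S (measurableSet_singleton a) hS)
    rw [ENNReal.toReal_mul, H.law.measure_mem_eq hS] at h1
    exact h1
  have e₀ : (fun ω => (X ω, fun s : Finset.Icc 1 U.Tmax =>
        if s.1 ≤ t - 1 then c ω s else (U.ξ₁, 0))) ⁻¹' {(a, e)} ∩
        {ω | (c ω ⟨t - 1, ht'⟩).2 = 1} = X ⁻¹' {a} ∩ c ⁻¹' (B ∩ E₀) := by
    ext ω
    simp only [Set.mem_inter_iff, Set.mem_preimage, Set.mem_singleton_iff, Prod.mk.injEq,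
      Set.mem_ofPred_eq, hB, hE₀, Set.mem_iInter, funext_iff, and_assoc]
  have e₁ : (fun ω => (X ω, fun s : Finset.Icc 1 U.Tmax =>
        if s.1 ≤ t - 1 then c ω s else (U.ξ₁, 0))) ⁻¹' {(a, e)} ∩
        {ω | (c ω ⟨t - 1, ht'⟩).2 = 1 ∧ c ω ⟨t, ht⟩ = (θ, d)} = X ⁻¹' {a} ∩ c ⁻¹' (B ∩ E₁) := by
    ext ω
    simp only [Set.mem_inter_iff, Set.mem_preimage, Set.mem_singleton_iff, Prod.mk.injEq,
      Set.mem_ofPred_eq, hB, hE₀, hE₁, Set.mem_iInter, funext_iff, and_assoc]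
  rw [e₀, e₁, key _ (hBm.inter hE₀m), key _ (hBm.inter hE₁m)]
  suffices h : P.real (U.traj ⁻¹' (B ∩ E₁)) =
      U.trans t d * U.p t θ * P.real (U.traj ⁻¹' (B ∩ E₀)) by rw [h]; ring
  rcases (U.traj ⁻¹' (B ∩ E₀)).eq_empty_or_nonempty with h0 | ⟨ω₀, h0⟩
  · have h1 : U.traj ⁻¹' (B ∩ E₁) = ∅ :=
      Set.subset_empty_iff.1 (h0 ▸ Set.preimage_mono
        (Set.inter_subset_inter_right _ Set.inter_subset_left))
    rw [h0, h1]
    simp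
  -- While the process is alive all `D_s` equal one, so that the prefix reduces to that of `ξ`.
  have alive : ∀ ω, U.D (t - 1) ω = 1 → ∀ s : ℕ, s ≤ t - 1 → U.D s ω = 1 := by
    intro ω h s hs
    rw [U.D_eq_one_iff] at h ⊢
    omega
  have hω₀ : U.D (t - 1) ω₀ = 1 := h0.2
  have hpre : ∀ ω, U.D (t - 1) ω = 1 →
      (U.traj ω ∈ B ↔ ∀ s : Finset.Icc 1 U.Tmax, s.1 < t → U.ξ s ω = U.ξ s ω₀) := by
    intro ω hω
    have h2 := Set.mem_iInter.1 h0.1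
    refine ⟨fun h s hs => ?_, fun h => Set.mem_iInter.2 fun s => ?_⟩
    · have h3 := (Set.mem_iInter.1 h s : _ = _).trans (h2 s : _ = _).symm
      rw [if_pos (by omega), if_pos (by omega)] at h3
      exact (Prod.mk.inj h3).1
    · refine Eq.trans ?_ (h2 s : _ = _)
      by_cases hs : s.1 ≤ t - 1
      · rw [if_pos hs, if_pos hs]
        exact Prod.ext (h s (by omega)) ((alive ω hω s hs).trans (alive ω₀ hω₀ s hs).symm)
      · rw [if_neg hs, if_neg hs]
  have f₀ : U.traj ⁻¹' (B ∩ E₀) = {ω | (∀ s : Finset.Icc 1 U.Tmax, s.1 < t →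
      U.ξ s ω = U.ξ s ω₀) ∧ U.D (t - 1) ω = 1} := by
    ext ω
    exact ⟨fun h => ⟨(hpre ω h.2).1 h.1, h.2⟩, fun h => ⟨(hpre ω h.2).2 h.1, h.2⟩⟩
  have f₁ : U.traj ⁻¹' (B ∩ E₁) = {ω | (∀ s : Finset.Icc 1 U.Tmax, s.1 < t →
      U.ξ s ω = U.ξ s ω₀) ∧ U.ξ t ω = θ ∧ U.D (t - 1) ω = 1 ∧ U.D t ω = d} := by
    ext ω
    refine ⟨fun h => ?_, fun h => ?_⟩
    · have h3 := Prod.mk.inj (h.2.2 : (U.ξ t ω, U.D t ω) = (θ, d))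
      exact ⟨(hpre ω h.2.1).1 h.1, h3.1, h.2.1, h3.2⟩
    · exact ⟨(hpre ω h.2.2.1).2 h.1, h.2.2.1, Prod.ext h.2.1 h.2.2.2⟩
  rw [f₀, f₁, U.measureReal_prefix hm θ hd]

omit [MeasurableSingletonClass α] [IsProbabilityMeasure μ] in
/-- A finite set carrying the past and the truncated current trajectory. -/
theorem exists_finite_support (H : IsFreshSample μ U X c) (t : ℕ) :
    Measurable (fun ω => (X ω, fun s : Finset.Icc 1 U.Tmax =>
        if s.1 ≤ t then c ω s else (U.ξ₁, 0))) ∧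
    ∃ W : Finset (α × (Finset.Icc 1 U.Tmax → Ξ × ℕ)), ∀ᵐ ω ∂μ,
      (X ω, fun s : Finset.Icc 1 U.Tmax => if s.1 ≤ t then c ω s else (U.ξ₁, 0)) ∈ W := by
  classical
  refine ⟨H.measurable_past.prodMk (measurable_pi_lambda _ fun s => ?_), ?_⟩
  · by_cases hs : s.1 ≤ t
    · simp only [hs, if_true]
      exact (measurable_pi_apply s).comp H.measurable_cur
    · simp [hs]
  obtain ⟨s, hs⟩ := H.finite_past
  refine ⟨s ×ˢ Fintype.piFinset fun i : Finset.Icc 1 U.Tmax => insert (U.ξ₁, 0) (U.Θ i ×ˢ {0, 1}), ?_⟩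
  filter_upwards [hs, H.ae_valid] with ω h1 h2
  refine Finset.mem_product.2 ⟨h1, Fintype.mem_piFinset.2 fun i => ?_⟩
  by_cases hi : i.1 ≤ t
  · have := h2.1 i
    simp only [hi, if_true, Finset.mem_insert, Finset.mem_product, Finset.mem_singleton]
    exact Or.inr this
  · simp [hi]

omit [MeasurableSingletonClass Ξ] [MeasurableSpace α] [MeasurableSingletonClass α]
  [IsProbabilityMeasure μ] in
theorem exists_comp_of_determinedBy {F : Ω' → ℝ} {t : ℕ}
    (hF : DeterminedBy μ (SamePrefix X c t) F) :
    ∃ φ : α × (Finset.Icc 1 U.Tmax → Ξ × ℕ) → ℝ, F =ᵐ[μ] φ ∘ (fun ω => (X ω,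
      fun s : Finset.Icc 1 U.Tmax => if s.1 ≤ t then c ω s else (U.ξ₁, 0))) := by
  refine DeterminedBy.exists_comp (hF.mono fun ω ω' h => ?_)
  obtain ⟨h1, h2⟩ := Prod.mk.inj h
  refine ⟨h1, fun s hs => ?_⟩
  have := congrFun h2 s
  rwa [if_pos hs, if_pos hs] at this

theorem integrable (H : IsFreshSample μ U X c) {F : Ω' → ℝ} {t : ℕ}
    (hF : DeterminedBy μ (SamePrefix X c t) F) : Integrable F μ := by
  obtain ⟨φ, hφ⟩ := exists_comp_of_determinedBy hF
  obtain ⟨hm, W, hW⟩ := H.exists_finite_support t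
  exact integrable_of_finite_range hm hW hφ

/-- Expectation over one stage: averaging over the values of `(ξ_t, D_t)` may be done inside an
expectation, when the integrands depend on the past and on the previous stages only. -/
theorem setIntegral_stage [IsProbabilityMeasure P] (H : IsFreshSample μ U X c) {t : ℕ}
    (ht : t ∈ Finset.Icc 1 U.Tmax) (ht' : t - 1 ∈ Finset.Icc 1 U.Tmax) {F : Ξ → ℕ → Ω' → ℝ}
    (hF : ∀ θ ∈ U.Θ t, ∀ d, d = 0 ∨ d = 1 → DeterminedBy μ (SamePrefix X c (t - 1)) (F θ d)) :
    ∫ ω in {ω | (c ω ⟨t - 1, ht'⟩).2 = 1}, ((1 - U.q t) * ∑ θ ∈ U.Θ t, U.p t θ * F θ 1 ω +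
        U.q t * ∑ θ ∈ U.Θ t, U.p t θ * F θ 0 ω) ∂μ =
      ∫ ω in {ω | (c ω ⟨t - 1, ht'⟩).2 = 1}, F (c ω ⟨t, ht⟩).1 (c ω ⟨t, ht⟩).2 ω ∂μ := by
  classical
  set E : Set Ω' := {ω | (c ω ⟨t - 1, ht'⟩).2 = 1} with hE
  have hI : ∀ θ ∈ U.Θ t, ∀ d, d = 0 ∨ d = 1 → Integrable (F θ d) (μ.restrict E) :=
    fun θ hθ d hd => (H.integrable (hF θ hθ d hd)).restrict
  have hcm : ∀ p : Ξ × ℕ, MeasurableSet {ω | c ω ⟨t, ht⟩ = p} := fun p =>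
    ((measurable_pi_apply _).comp H.measurable_cur) (measurableSet_singleton p)
  have key : ∀ θ ∈ U.Θ t, ∀ d, d = 0 ∨ d = 1 →
      ∫ ω in E, {ω | c ω ⟨t, ht⟩ = (θ, d)}.indicator (F θ d) ω ∂μ =
        U.trans t d * U.p t θ * ∫ ω in E, F θ d ω ∂μ := by
    intro θ hθ d hd
    obtain ⟨φ, hφ⟩ := exists_comp_of_determinedBy (hF θ hθ d hd)
    obtain ⟨hm, W, hW⟩ := H.exists_finite_support (t - 1)
    rw [setIntegral_indicator (hcm _), setIntegral_of_finite_range hm hW hφ,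
      setIntegral_of_finite_range hm hW hφ, Finset.mul_sum]
    refine Finset.sum_congr rfl fun w _ => ?_
    rw [← mul_assoc, ← H.measureReal_atom ht ht' θ hd w]
    rfl
  have hsplit : (fun ω => F (c ω ⟨t, ht⟩).1 (c ω ⟨t, ht⟩).2 ω) =ᵐ[μ.restrict E] fun ω =>
      ∑ θ ∈ U.Θ t, ({ω | c ω ⟨t, ht⟩ = (θ, 1)}.indicator (F θ 1) ω +
        {ω | c ω ⟨t, ht⟩ = (θ, 0)}.indicator (F θ 0) ω) := by
    refine ae_restrict_of_ae ?_
    filter_upwards [H.ae_valid] with ω hω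
    have h1 := hω.1 ⟨t, ht⟩
    rw [Finset.sum_eq_single_of_mem _ h1.1]
    · generalize hp : c ω ⟨t, ht⟩ = p at h1
      obtain ⟨θ, d⟩ := p
      rcases h1.2 with h | h <;> simp only at h <;> subst h <;> simp [hp]
    · intro θ _ hne
      have h3 : ∀ d, ω ∉ {ω | c ω ⟨t, ht⟩ = (θ, d)} := by
        rintro d (h4 : c ω ⟨t, ht⟩ = (θ, d))
        exact hne (by rw [h4])
      rw [Set.indicator_of_notMem (h3 1), Set.indicator_of_notMem (h3 0), add_zero]
  have h0 : (0 : ℕ) = 0 ∨ (0 : ℕ) = 1 := Or.inl rfl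
  have h1 : (1 : ℕ) = 0 ∨ (1 : ℕ) = 1 := Or.inr rfl
  have hJ : ∀ θ ∈ U.Θ t, Integrable (fun ω => {ω | c ω ⟨t, ht⟩ = (θ, 1)}.indicator (F θ 1) ω +
      {ω | c ω ⟨t, ht⟩ = (θ, 0)}.indicator (F θ 0) ω) (μ.restrict E) := fun θ hθ =>
    ((hI θ hθ 1 h1).indicator (hcm _)).add ((hI θ hθ 0 h0).indicator (hcm _))
  rw [integral_congr_ae hsplit, integral_finsetSum _ hJ,
    integral_add ((integrable_finsetSum _ fun θ hθ => (hI θ hθ 1 h1).const_mul _).const_mul _)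
      ((integrable_finsetSum _ fun θ hθ => (hI θ hθ 0 h0).const_mul _).const_mul _),
    integral_const_mul, integral_const_mul,
    integral_finsetSum _ fun θ hθ => (hI θ hθ 1 h1).const_mul _,
    integral_finsetSum _ fun θ hθ => (hI θ hθ 0 h0).const_mul _, Finset.mul_sum, Finset.mul_sum,
    ← Finset.sum_add_distrib]
  refine Finset.sum_congr rfl fun θ hθ => ?_
  rw [integral_add ((hI θ hθ 1 h1).indicator (hcm _)) ((hI θ hθ 0 h0).indicator (hcm _)),
    key θ hθ 1 h1, key θ hθ 0 h0, integral_const_mul, integral_const_mul]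
  simp only [Uncertainty.trans, if_true, zero_ne_one, if_false]
  ring

end IsFreshSample

end FreshSample

/-! ### The optimal value of the stochastic program -/

theorem expect_congr {Ω : Type*} [MeasurableSpace Ω] {P : Measure Ω} {Z Z' : Ω → EReal}
    (h : Z =ᵐ[P] Z') : expect P Z = expect P Z' := by
  unfold expect
  rw [lintegral_congr_ae (f := fun ω => (Z ω).toENNReal) (g := fun ω => (Z' ω).toENNReal)
      (h.mono fun ω hω => by simp only [hω]),
    lintegral_congr_ae (f := fun ω => (-Z ω).toENNReal) (g := fun ω => (-Z' ω).toENNReal)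
      (h.mono fun ω hω => by simp only [hω])]

theorem expect_coe {Ω : Type*} [MeasurableSpace Ω] {P : Measure Ω} {f : Ω → ℝ}
    (hf : Integrable f P) : expect P (fun ω => (f ω : EReal)) = ((∫ ω, f ω ∂P : ℝ) : EReal) := by
  rw [integral_eq_lintegral_pos_part_sub_lintegral_neg_part hf, EReal.coe_sub,
    EReal.coe_ennreal_toReal hf.lintegral_lt_top.ne,
    EReal.coe_ennreal_toReal
      (show Integrable (fun ω => -f ω) P from hf.neg).lintegral_lt_top.ne]
  rfl

section Policy

variable {Ω : Type*} [MeasurableSpace Ω] {P : Measure Ω} {Ξ : Type*} [MeasurableSpace Ξ] {n : ℕ}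
  {M : StageModel n Ξ} {U : Uncertainty P Ξ} {x₀ : Dec n} {K : ℕ → Set (Dec n)}

theorem Uncertainty.measurable_traj (U : Uncertainty P Ξ) : Measurable U.traj :=
  measurable_pi_lambda _ fun s => (U.measurable_ξ s s.2).prodMk (U.measurable_D s)

/-- The process `((ξ_t, D_t))_t` itself, with a trivial past. -/
theorem Uncertainty.isFreshSample [IsProbabilityMeasure P] (U : Uncertainty P Ξ) :
    IsFreshSample P U (fun _ : Ω => ()) U.traj where
  measurable_past := measurable_const
  finite_past := ⟨{()}, by simp⟩
  law := IdentDistrib.refl U.measurable_traj.aemeasurable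
  measurable_cur := U.measurable_traj
  indep := indepFun_const_left () U.traj

theorem SamePrefix.symm {Ω' α β : Type*} {N : ℕ} {X : Ω' → α} {c : Ω' → Finset.Icc 1 N → β} {t : ℕ}
    (ω ω' : Ω') (h : SamePrefix X c t ω ω') : SamePrefix X c t ω' ω :=
  ⟨h.1.symm, fun s hs => (h.2 s hs).symm⟩

theorem SamePrefix.mono {Ω' α β : Type*} {N : ℕ} {X : Ω' → α} {c : Ω' → Finset.Icc 1 N → β}
    {t t' : ℕ} (ht : t' ≤ t) (ω ω' : Ω') (h : SamePrefix X c t ω ω') : SamePrefix X c t' ω ω' :=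
  ⟨h.1, fun s hs => h.2 s (hs.trans ht)⟩

/-- Two outcomes with the same `ξ_s` and `D_s`, `1 ≤ s ≤ t`. -/
abbrev Uncertainty.SameHistory (U : Uncertainty P Ξ) (t : ℕ) : Ω → Ω → Prop :=
  SamePrefix (fun _ : Ω => ()) U.traj t

theorem Uncertainty.SameHistory.eq {t s : ℕ} (hs : s ∈ Finset.Icc 1 U.Tmax) (hst : s ≤ t) {ω ω' : Ω}
    (h : U.SameHistory t ω ω') : U.ξ s ω = U.ξ s ω' ∧ U.D s ω = U.D s ω' :=
  Prod.mk.inj (h.2 ⟨s, hs⟩ hst)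

theorem Uncertainty.filt_le_saturated (U : Uncertainty P Ξ) {t : ℕ} (ht : t ≤ U.Tmax) :
    U.filt t ≤ saturated (U.SameHistory t) SamePrefix.symm := by
  refine iSup₂_le fun j hj => ?_
  have hj' := Finset.mem_Icc.1 hj
  have hj2 : j ∈ Finset.Icc 1 U.Tmax := Finset.mem_Icc.2 (by omega)
  exact sup_le (comap_le_saturated _ fun ω ω' h => (Uncertainty.SameHistory.eq hj2 hj'.2 h).1)
    (comap_le_saturated _ fun ω ω' h => (Uncertainty.SameHistory.eq hj2 hj'.2 h).2)

theorem Uncertainty.determinedBy_D (U : Uncertainty P Ξ) {t : ℕ} (ht : t ≤ U.Tmax) :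
    DeterminedBy P (U.SameHistory t) (U.D t) := by
  rcases Nat.eq_zero_or_pos t with rfl | h0
  · have h1 : U.D 0 =ᵐ[P] fun _ => 1 := by
      filter_upwards [U.T_mem] with ω hω
      have := (Finset.mem_Icc.1 hω).1
      exact U.D_eq_one_iff.2 (by omega)
    exact DeterminedBy.congr (DeterminedBy.of_forall fun _ _ _ => rfl) h1
  · exact DeterminedBy.of_forall fun ω ω' h =>
      (Uncertainty.SameHistory.eq (Finset.mem_Icc.2 ⟨h0, ht⟩) le_rfl h).2

/-- The real cost-to-go `𝒬_t(y, d)`. -/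
noncomputable def toGo (M : StageModel n Ξ) (U : Uncertainty P Ξ) (t : ℕ) (y : Dec n) (d : ℕ) : ℝ :=
  (costToGo M U t y d).toReal

/-- The real optimal value of the stage-`t` problem with the true cost-to-go function. -/
noncomputable def stageOpt (M : StageModel n Ξ) (U : Uncertainty P Ξ) (t : ℕ) (x : Dec n) (θ : Ξ)
    (d : ℕ) : ℝ :=
  (stageVal M (costToGo M U (t + 1)) t x 1 θ d).toReal

/-- The suboptimality of a policy in the stage-`t` problem, counted while the process is alive. -/
noncomputable def excess (M : StageModel n Ξ) (U : Uncertainty P Ξ) (x : ℕ → Ω → Dec n) (t : ℕ)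
    (ω : Ω) : ℝ :=
  U.D (t - 1) ω * ((M.cost t (x t ω) (x (t - 1) ω) (U.ξ t ω)).toReal +
    toGo M U (t + 1) (x t ω) (U.D t ω) - stageOpt M U t (x (t - 1) ω) (U.ξ t ω) (U.D t ω))

theorem toGo_zero (t : ℕ) (y : Dec n) : toGo M U t y 0 = 0 := by
  simp [toGo, costToGo_zero]

theorem toGo_last (y : Dec n) (d : ℕ) : toGo M U (U.Tmax + 1) y d = 0 := by
  simp [toGo, costToGo_last]

namespace IsPolicy

variable {x : ℕ → Ω → Dec n}

theorem eq_of_sameHistory (hx : IsPolicy M U x₀ x) {t : ℕ} (ht : t ≤ U.Tmax) {ω ω' : Ω}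
    (h : U.SameHistory t ω ω') : x t ω = x t ω' := by
  rcases Nat.eq_zero_or_pos t with rfl | h0
  · rw [hx.1, hx.1]
  · exact eq_of_measurable_saturated (U.filt_le_saturated ht)
      (hx.2.1 t (Finset.mem_Icc.2 ⟨h0, ht⟩)) h

theorem ae_mem (hx : IsPolicy M U x₀ x) (hK : IsInvariant M U x₀ K) :
    ∀ᵐ ω ∂P, ∀ t ≤ U.Tmax, x t ω ∈ K t := by
  have h1 : ∀ᵐ ω ∂P, ∀ t ∈ Finset.Icc 1 U.Tmax, U.ξ t ω ∈ U.Θ t ∧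
      x t ω ∈ M.feas t (x (t - 1) ω) (U.ξ t ω) := by
    refine (ae_ball_iff (Finset.countable_toSet _)).2 fun t ht => ?_
    exact (U.ξ_mem t ht).and (hx.2.2 t ht)
  filter_upwards [h1] with ω h1 t
  induction t with
  | zero => intro _; rw [hx.1]; exact hK.init_mem
  | succ t ih =>
    intro ht
    have ht' : t + 1 ∈ Finset.Icc 1 U.Tmax := Finset.mem_Icc.2 (by omega)
    obtain ⟨h2, h3⟩ := h1 _ ht'
    exact (hK.recourse _ ht' _ (ih (by omega)) _ h2).subset h3

variable [IsProbabilityMeasure P] [MeasurableSingletonClass Ξ]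

theorem integrable_stage (hx : IsPolicy M U x₀ x) {t : ℕ} (ht : t ∈ Finset.Icc 1 U.Tmax)
    (F : ℕ → ℕ → Dec n → Dec n → Ξ → ℝ) : Integrable
      (fun ω => F (U.D (t - 1) ω) (U.D t ω) (x (t - 1) ω) (x t ω) (U.ξ t ω)) P := by
  have ht' := Finset.mem_Icc.1 ht
  refine U.isFreshSample.integrable (t := t) ?_
  have h1 : DeterminedBy P (U.SameHistory t) (U.D (t - 1)) :=
    (U.determinedBy_D (by omega)).mono (SamePrefix.mono (by omega))
  have h2 : DeterminedBy P (U.SameHistory t)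
      (fun ω => (U.D t ω, x (t - 1) ω, x t ω, U.ξ t ω)) := by
    refine DeterminedBy.of_forall fun ω ω' h => ?_
    obtain ⟨h3, h4⟩ := Uncertainty.SameHistory.eq ht le_rfl h
    rw [h3, h4, hx.eq_of_sameHistory ht'.2 h,
      hx.eq_of_sameHistory (t := t - 1) (by omega) (SamePrefix.mono (by omega) _ _ h)]
  exact h1.comp₂ h2 fun d p => F d p.1 p.2.1 p.2.2.1 p.2.2.2

/-- The dynamic programming equation, integrated along a policy. -/
theorem integral_toGo (hx : IsPolicy M U x₀ x) (hK : IsInvariant M U x₀ K)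
    (hmin : HasAffineMinorants M U) {t : ℕ} (ht : t ∈ Finset.Icc 2 U.Tmax) :
    ∫ ω, toGo M U t (x (t - 1) ω) (U.D (t - 1) ω) ∂P =
      ∫ ω, U.D (t - 1) ω * stageOpt M U t (x (t - 1) ω) (U.ξ t ω) (U.D t ω) ∂P := by
  have ht0 := Finset.mem_Icc.1 ht
  have ht1 : t ∈ Finset.Icc 1 U.Tmax := Finset.mem_Icc.2 (by omega)
  have ht2 : t - 1 ∈ Finset.Icc 1 U.Tmax := Finset.mem_Icc.2 (by omega)
  have hm : MeasurableSet {ω | U.D (t - 1) ω = 1} := U.measurableSet_alive _ _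
  have key := U.isFreshSample.setIntegral_stage ht1 ht2
    (F := fun θ d ω => stageOpt M U t (x (t - 1) ω) θ d) fun θ _ d _ => DeterminedBy.of_forall
      fun ω ω' h => by rw [hx.eq_of_sameHistory (t := t - 1) (by omega) h]
  have hset : {ω | (U.traj ω ⟨t - 1, ht2⟩).2 = 1} = {ω | U.D (t - 1) ω = 1} := rfl
  rw [hset, ← integral_indicator hm, ← integral_indicator hm] at key
  refine Eq.trans (integral_congr_ae ?_) (key.trans (integral_congr_ae ?_))
  · filter_upwards [hx.ae_mem hK] with ω hω
    rcases U.D_mem (t - 1) ω with h | h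
    · rw [h, toGo_zero, Set.indicator_of_notMem]
      exact fun h' => by simp [h] at h'
    · rw [h, Set.indicator_of_mem (show ω ∈ {ω | U.D (t - 1) ω = 1} from h), toGo,
        costToGo_eq_coe ht (hK.recourse t ht1 _ (hω (t - 1) (by omega)))
          (fun d hd => hK.finiteBddBelowOn_costToGo hmin (Finset.mem_Icc.2 (by omega)) d hd)]
      rfl
  · filter_upwards with ω
    rcases U.D_mem (t - 1) ω with h | h
    · rw [h, Set.indicator_of_notMem]
      · simp
      · exact fun h' => by simp [h] at h'
    · rw [h, Set.indicator_of_mem (show ω ∈ {ω | U.D (t - 1) ω = 1} from h)]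
      simp [Uncertainty.traj]

/-- The expected cost of a policy is the optimal value of the first stage problem plus the sum of
the expected suboptimalities in the successive stage problems. -/
theorem expect_totalCost (hx : IsPolicy M U x₀ x) (hK : IsInvariant M U x₀ K)
    (hmin : HasAffineMinorants M U) : expect P (totalCost M U x) =
      ((stageOpt M U 1 x₀ U.ξ₁ 1 + ∑ t ∈ Finset.Icc 1 U.Tmax, ∫ ω, excess M U x t ω ∂P : ℝ) :
        EReal) := by
  set cost : ℕ → Ω → ℝ := fun t ω =>
    U.D (t - 1) ω * (M.cost t (x t ω) (x (t - 1) ω) (U.ξ t ω)).toReal with hcost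
  have hci : ∀ t ∈ Finset.Icc 1 U.Tmax, Integrable (cost t) P := fun t ht =>
    hx.integrable_stage ht fun d _ y y' θ => d * (M.cost t y' y θ).toReal
  have hreal : totalCost M U x =ᵐ[P]
      fun ω => ((∑ t ∈ Finset.Icc 1 U.Tmax, cost t ω : ℝ) : EReal) := by
    have h1 : ∀ᵐ ω ∂P, ∀ t ∈ Finset.Icc 1 U.Tmax, U.ξ t ω ∈ U.Θ t ∧
        x t ω ∈ M.feas t (x (t - 1) ω) (U.ξ t ω) := by
      refine (ae_ball_iff (Finset.countable_toSet _)).2 fun t ht => ?_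
      exact (U.ξ_mem t ht).and (hx.2.2 t ht)
    filter_upwards [h1, hx.ae_mem hK] with ω h1 h2
    rw [ereal_coe_sum]
    refine Finset.sum_congr rfl fun t ht => ?_
    have ht' := Finset.mem_Icc.1 ht
    have h3 := (hK.recourse t ht _ (h2 (t - 1) (by omega)) _ (h1 t ht).1).cost.coe_toReal
      (h1 t ht).2
    rw [hcost, EReal.coe_mul, h3]
    rfl
  have hfirst : ∀ᵐ ω ∂P, U.D 0 ω = 1 ∧ U.D 1 ω = 1 ∧ U.ξ 1 ω = U.ξ₁ := by
    have h1 := U.two_le_Tmax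
    filter_upwards [U.T_mem, U.ξ_mem 1 (Finset.mem_Icc.2 (by omega))] with ω h2 h3
    have h4 := (Finset.mem_Icc.1 h2).1
    rw [U.support_one, Finset.mem_singleton] at h3
    exact ⟨U.D_eq_one_iff.2 (by omega), U.D_eq_one_iff.2 (by omega), h3⟩
  -- The sum of the suboptimalities telescopes, by `integral_toGo`.
  have hstep : ∀ t ∈ Finset.Icc 1 U.Tmax, ∫ ω, excess M U x t ω ∂P = ∫ ω, cost t ω ∂P +
      ∫ ω, toGo M U (t + 1) (x t ω) (U.D t ω) ∂P -
      ∫ ω, U.D (t - 1) ω * stageOpt M U t (x (t - 1) ω) (U.ξ t ω) (U.D t ω) ∂P := by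
    intro t ht
    have hi1 := hx.integrable_stage ht fun _ d _ y' _ => toGo M U (t + 1) y' d
    have hi2 := hx.integrable_stage ht fun d d' y _ θ => d * stageOpt M U t y θ d'
    rw [← integral_add (hci t ht) hi1, ← integral_sub (show Integrable
      (fun ω => cost t ω + toGo M U (t + 1) (x t ω) (U.D t ω)) P from (hci t ht).add hi1) hi2]
    refine integral_congr_ae (Eventually.of_forall fun ω => ?_)
    have h1 : (U.D (t - 1) ω : ℝ) * toGo M U (t + 1) (x t ω) (U.D t ω) =
        toGo M U (t + 1) (x t ω) (U.D t ω) := by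
      rcases U.D_mem t ω with h | h
      · rw [h, toGo_zero, mul_zero]
      · have h' : U.D (t - 1) ω = 1 := by
          rw [U.D_eq_one_iff] at h ⊢; omega
        rw [h', Nat.cast_one, one_mul]
    simp only [excess, hcost]
    rw [mul_sub, mul_add, h1]
  have hsum : ∀ m, m + 1 ≤ U.Tmax → ∑ t ∈ Finset.Icc 1 (m + 1), ∫ ω, excess M U x t ω ∂P =
      ∑ t ∈ Finset.Icc 1 (m + 1), ∫ ω, cost t ω ∂P +
        ∫ ω, toGo M U (m + 2) (x (m + 1) ω) (U.D (m + 1) ω) ∂P - stageOpt M U 1 x₀ U.ξ₁ 1 := by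
    intro m
    induction m with
    | zero =>
      intro hm
      have h1 : ∫ ω, (U.D 0 ω : ℝ) * stageOpt M U 1 (x 0 ω) (U.ξ 1 ω) (U.D 1 ω) ∂P =
          stageOpt M U 1 x₀ U.ξ₁ 1 := by
        have h2 : (fun ω => (U.D 0 ω : ℝ) * stageOpt M U 1 (x 0 ω) (U.ξ 1 ω) (U.D 1 ω)) =ᵐ[P]
            fun _ => stageOpt M U 1 x₀ U.ξ₁ 1 := by
          filter_upwards [hfirst] with ω h
          rw [h.1, h.2.1, h.2.2, hx.1, Nat.cast_one, one_mul]
        rw [integral_congr_ae h2]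
        simp
      simp only [zero_add, Finset.Icc_self, Finset.sum_singleton]
      rw [hstep 1 (Finset.mem_Icc.2 ⟨le_rfl, hm⟩), ← h1]
    | succ m ih =>
      intro hm
      have h1 := hx.integral_toGo hK hmin (t := m + 2) (Finset.mem_Icc.2 (by omega))
      rw [Finset.sum_Icc_succ_top (b := m + 1) (by omega),
        Finset.sum_Icc_succ_top (b := m + 1) (by omega),
        ih (by omega), hstep (m + 1 + 1) (Finset.mem_Icc.2 (by omega))]
      simp only [show m + 2 - 1 = m + 1 from rfl] at h1 ⊢
      rw [h1]
      ring
  have hT := U.two_le_Tmax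
  have hlast := hsum (U.Tmax - 1) (by omega)
  rw [show U.Tmax - 1 + 1 = U.Tmax by omega, show U.Tmax - 1 + 2 = U.Tmax + 1 by omega] at hlast
  simp only [toGo_last, integral_zero, add_zero] at hlast
  rw [expect_congr hreal, expect_coe (integrable_finsetSum _ hci), integral_finsetSum _ hci, hlast]
  congr 1
  ring

omit [IsProbabilityMeasure P] [MeasurableSingletonClass Ξ] in
theorem ae_excess_nonneg (hx : IsPolicy M U x₀ x) (hK : IsInvariant M U x₀ K)
    (hmin : HasAffineMinorants M U) {t : ℕ} (ht : t ∈ Finset.Icc 1 U.Tmax) :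
    0 ≤ᵐ[P] excess M U x t := by
  have ht' := Finset.mem_Icc.1 ht
  filter_upwards [hx.ae_mem hK, U.ξ_mem t ht, hx.2.2 t ht] with ω h1 h2 h3
  have h4 := (hK.recourse t ht _ (h1 (t - 1) (by omega)) _ h2).toReal_stageVal_le
    (hK.finiteBddBelowOn_costToGo hmin (t := t + 1) (Finset.mem_Icc.2 (by omega)) _
      (U.D_mem t ω)) h3
  exact mul_nonneg (Nat.cast_nonneg _) (sub_nonneg.2 h4)

end IsPolicy

theorem measurable_ite_mem_finset {Ω' α : Type*} [MeasurableSpace Ω'] [MeasurableSpace α]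
    [MeasurableSingletonClass α] [DecidableEq α] {g : Ω' → α} (hg : Measurable g) (S : Finset α)
    (Ψ : α → Dec n) : Measurable (fun ω => if g ω ∈ S then Ψ (g ω) else 0) := by
  have h : (fun ω => if g ω ∈ S then Ψ (g ω) else 0) =
      fun ω => ∑ p ∈ S, (g ⁻¹' {p}).indicator (fun _ => Ψ p) ω := by
    funext ω
    split_ifs with hω
    · rw [Finset.sum_eq_single_of_mem _ hω]
      · simp
      · exact fun p _ hp => Set.indicator_of_notMem (fun h => hp h.symm) _
    · refine (Finset.sum_eq_zero fun p hp => Set.indicator_of_notMem (fun h => hω ?_) _).symm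
      rwa [show g ω = p from h]
  rw [h]
  exact Finset.measurable_sum _ fun p _ =>
    measurable_const.indicator (hg (measurableSet_singleton p))

variable [MeasurableSingletonClass Ξ]

/-- Nearly optimal policies, obtained by nearly solving the stage problem of each stage. -/
theorem exists_policy_excess_le (hK : IsInvariant M U x₀ K) (hmin : HasAffineMinorants M U) {δ : ℝ}
    (hδ : 0 < δ) : ∃ x, IsPolicy M U x₀ x ∧
      ∀ t ∈ Finset.Icc 1 U.Tmax, ∀ᵐ ω ∂P, excess M U x t ω ≤ δ := by
  classical
  have hsel : ∀ (t : ℕ) (y : Dec n) (θ : Ξ) (d : ℕ), ∃ z, t ∈ Finset.Icc 1 U.Tmax →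
      y ∈ K (t - 1) → θ ∈ U.Θ t → (d = 0 ∨ d = 1) → z ∈ M.feas t y θ ∧
        (M.cost t z y θ).toReal + toGo M U (t + 1) z d ≤ stageOpt M U t y θ d + δ := by
    intro t y θ d
    by_cases h : t ∈ Finset.Icc 1 U.Tmax ∧ y ∈ K (t - 1) ∧ θ ∈ U.Θ t ∧ (d = 0 ∨ d = 1)
    · have ht' := Finset.mem_Icc.1 h.1
      obtain ⟨z, hz, hz'⟩ := (hK.recourse t h.1 y h.2.1 θ h.2.2.1).exists_le_add
        (hK.finiteBddBelowOn_costToGo hmin (t := t + 1) (Finset.mem_Icc.2 (by omega)) d h.2.2.2) hδ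
      exact ⟨z, fun _ _ _ _ => ⟨hz, hz'⟩⟩
    · exact ⟨0, fun h1 h2 h3 h4 => absurd ⟨h1, h2, h3, h4⟩ h⟩
  choose Φ hΦ using hsel
  -- Outside of the support of `ξ` the decision is set to zero, so that it takes finitely many values.
  let x : ℕ → Ω → Dec n := fun t => Nat.rec (fun _ => x₀) (fun t xt ω =>
    if U.ξ (t + 1) ω ∈ U.Θ (t + 1) then Φ (t + 1) (xt ω) (U.ξ (t + 1) ω) (U.D (t + 1) ω) else 0) t
  have hxs : ∀ t ω, x (t + 1) ω = if U.ξ (t + 1) ω ∈ U.Θ (t + 1) then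
      Φ (t + 1) (x t ω) (U.ξ (t + 1) ω) (U.D (t + 1) ω) else 0 := fun _ _ => rfl
  have hmono : ∀ t, U.filt t ≤ U.filt (t + 1) := fun t =>
    biSup_mono fun i hi => by
      have := Finset.mem_Icc.1 hi
      exact Finset.mem_Icc.2 (by omega)
  have hfilt : ∀ t, MeasurableSpace.comap (U.ξ (t + 1)) inferInstance ⊔
      MeasurableSpace.comap (U.D (t + 1)) inferInstance ≤ U.filt (t + 1) := fun t =>
    le_iSup₂_of_le (f := fun j (_ : j ∈ Finset.Icc 1 (t + 1)) =>
      MeasurableSpace.comap (U.ξ j) inferInstance ⊔ MeasurableSpace.comap (U.D j) inferInstance)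
      (t + 1) (Finset.mem_Icc.2 (by omega)) le_rfl
  have hmeas : ∀ t, Measurable[U.filt t] (x t) ∧ (Set.range (x t)).Finite := by
    intro t
    induction t with
    | zero => exact ⟨measurable_const, (Set.finite_singleton x₀).subset (by rintro _ ⟨ω, rfl⟩; rfl)⟩
    | succ t ih =>
      set S : Finset (Dec n × Ξ × ℕ) := ih.2.toFinset ×ˢ U.Θ (t + 1) ×ˢ {0, 1} with hS
      have heq : x (t + 1) = fun ω => if (x t ω, U.ξ (t + 1) ω, U.D (t + 1) ω) ∈ S then
          (fun p : Dec n × Ξ × ℕ => Φ (t + 1) p.1 p.2.1 p.2.2)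
            (x t ω, U.ξ (t + 1) ω, U.D (t + 1) ω) else 0 := by
        funext ω
        have h1 : (x t ω, U.ξ (t + 1) ω, U.D (t + 1) ω) ∈ S ↔ U.ξ (t + 1) ω ∈ U.Θ (t + 1) := by
          have := U.D_mem (t + 1) ω
          simp [hS, this]
        simp only [hxs, h1]
      constructor
      · rw [heq]
        refine @measurable_ite_mem_finset n Ω _ (U.filt (t + 1)) _ _ _
          (fun ω => (x t ω, U.ξ (t + 1) ω, U.D (t + 1) ω)) ?_ S
          (fun p : Dec n × Ξ × ℕ => Φ (t + 1) p.1 p.2.1 p.2.2)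
        refine Measurable.prodMk (ih.1.mono (hmono t) le_rfl) ?_
        refine Measurable.prodMk ?_ ?_
        · exact Measurable.of_comap_le (le_sup_left.trans (hfilt t))
        · exact Measurable.of_comap_le (le_sup_right.trans (hfilt t))
      · refine (((S.image fun p => Φ (t + 1) p.1 p.2.1 p.2.2).finite_toSet).insert 0).subset ?_
        rintro _ ⟨ω, rfl⟩
        rw [heq]
        beta_reduce
        split_ifs with h
        · exact Set.mem_insert_of_mem _ (Finset.mem_coe.2 (Finset.mem_image_of_mem _ h))
        · exact Set.mem_insert _ _
  have hξ : ∀ᵐ ω ∂P, ∀ t ∈ Finset.Icc 1 U.Tmax, U.ξ t ω ∈ U.Θ t :=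
    (ae_ball_iff (Finset.countable_toSet _)).2 fun t ht => U.ξ_mem t ht
  have hgood : ∀ᵐ ω ∂P, ∀ t, t + 1 ≤ U.Tmax →
      x t ω ∈ K t ∧ x (t + 1) ω ∈ M.feas (t + 1) (x t ω) (U.ξ (t + 1) ω) ∧
        (M.cost (t + 1) (x (t + 1) ω) (x t ω) (U.ξ (t + 1) ω)).toReal +
          toGo M U (t + 2) (x (t + 1) ω) (U.D (t + 1) ω) ≤
            stageOpt M U (t + 1) (x t ω) (U.ξ (t + 1) ω) (U.D (t + 1) ω) + δ := by
    filter_upwards [hξ] with ω hω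
    have step : ∀ t, t + 1 ≤ U.Tmax → x t ω ∈ K t →
        x (t + 1) ω ∈ M.feas (t + 1) (x t ω) (U.ξ (t + 1) ω) ∧
        (M.cost (t + 1) (x (t + 1) ω) (x t ω) (U.ξ (t + 1) ω)).toReal +
          toGo M U (t + 2) (x (t + 1) ω) (U.D (t + 1) ω) ≤
            stageOpt M U (t + 1) (x t ω) (U.ξ (t + 1) ω) (U.D (t + 1) ω) + δ := by
      intro t ht hxt
      have ht' : t + 1 ∈ Finset.Icc 1 U.Tmax := Finset.mem_Icc.2 (by omega)
      rw [hxs, if_pos (hω _ ht')]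
      exact hΦ (t + 1) _ _ _ ht' hxt (hω _ ht') (U.D_mem _ _)
    intro t
    induction t with
    | zero => exact fun ht => ⟨hK.init_mem, step 0 ht hK.init_mem⟩
    | succ t ih =>
      intro ht
      have ht' : t + 1 ∈ Finset.Icc 1 U.Tmax := Finset.mem_Icc.2 (by omega)
      obtain ⟨h1, h2, -⟩ := ih (by omega)
      have h3 := (hK.recourse (t + 1) ht' _ h1 _ (hω _ ht')).subset h2
      exact ⟨h3, step _ ht h3⟩
  refine ⟨x, ⟨fun _ => rfl, fun t _ => (hmeas t).1, fun t ht => ?_⟩, fun t ht => ?_⟩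
  · have ht' := Finset.mem_Icc.1 ht
    obtain ⟨s, rfl⟩ : ∃ s, t = s + 1 := ⟨t - 1, by omega⟩
    filter_upwards [hgood] with ω hω using (hω s ht'.2).2.1
  · have ht' := Finset.mem_Icc.1 ht
    obtain ⟨s, rfl⟩ : ∃ s, t = s + 1 := ⟨t - 1, by omega⟩
    filter_upwards [hgood] with ω hω
    have h1 := (hω s ht'.2).2.2
    simp only [excess, Nat.add_sub_cancel]
    rcases U.D_mem s ω with h | h
    · rw [h]; simp [hδ.le]
    · rw [h, Nat.cast_one, one_mul]
      linarith

variable [IsProbabilityMeasure P]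

/-- The suboptimalities of a policy are nonnegative, and can be made arbitrarily small. -/
theorem optVal_eq (hK : IsInvariant M U x₀ K) (hmin : HasAffineMinorants M U) :
    optVal M U x₀ = ((stageOpt M U 1 x₀ U.ξ₁ 1 : ℝ) : EReal) := by
  refine le_antisymm ?_ ?_
  · refine EReal.le_of_forall_lt_iff_le.1 fun z hz => ?_
    have hT : (0 : ℝ) < U.Tmax := by have := U.two_le_Tmax; positivity
    rw [EReal.coe_lt_coe_iff] at hz
    obtain ⟨x, hx, hle⟩ := exists_policy_excess_le hK hmin
      (δ := (z - stageOpt M U 1 x₀ U.ξ₁ 1) / U.Tmax) (div_pos (by linarith) hT)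
    refine (iInf₂_le x hx).trans ?_
    rw [hx.expect_totalCost hK hmin, EReal.coe_le_coe_iff]
    have h1 : ∑ t ∈ Finset.Icc 1 U.Tmax, ∫ ω, excess M U x t ω ∂P ≤
        ∑ t ∈ Finset.Icc 1 U.Tmax, (z - stageOpt M U 1 x₀ U.ξ₁ 1) / U.Tmax := by
      refine Finset.sum_le_sum fun t ht => ?_
      have h2 := integral_mono_ae (hx.integrable_stage ht fun d d' y y' θ =>
        d * ((M.cost t y' y θ).toReal + toGo M U (t + 1) y' d' - stageOpt M U t y θ d'))
        (integrable_const _) (hle t ht)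
      simpa [excess] using h2
    rw [Finset.sum_const, Nat.card_Icc, Nat.add_sub_cancel, nsmul_eq_mul,
      mul_div_cancel₀ _ hT.ne'] at h1
    linarith
  · refine le_iInf₂ fun x hx => ?_
    rw [hx.expect_totalCost hK hmin, EReal.coe_le_coe_iff]
    have h1 : 0 ≤ ∑ t ∈ Finset.Icc 1 U.Tmax, ∫ ω, excess M U x t ω ∂P :=
      Finset.sum_nonneg fun t ht => integral_nonneg_of_ae (hx.ae_excess_nonneg hK hmin ht)
    linarith

end Policy

/-! ### The cuts computed by the algorithm -/

section Run

variable {Ω Ω' Ξ : Type*} {n : ℕ} {S : Trace n Ξ Ω'} {ω : Ω'}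

/-- The real function `𝒬_t^k(·, 1)`, `t ≤ Tmax`. -/
noncomputable def Trace.cuts (S : Trace n Ξ Ω') (k t : ℕ) (ω : Ω') (y : Dec n) : ℝ :=
  cutMax (fun j => S.θ j t ω) (fun j => S.β j t ω) k y

theorem Trace.approx_one {N k t : ℕ} (ht : t ≤ N) (y : Dec n) :
    S.approx N k t ω y 1 = (S.cuts k t ω y : EReal) := by
  simp [Trace.approx, Trace.cuts, cutMax, not_lt.2 ht]

theorem Trace.approx_zero (N k t : ℕ) (y : Dec n) : S.approx N k t ω y 0 = 0 := by
  simp [Trace.approx]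

theorem Trace.approx_of_lt {N k t : ℕ} (ht : N < t) (y : Dec n) (d : ℕ) :
    S.approx N k t ω y d = 0 := by
  simp [Trace.approx, ht]

theorem Trace.approx_mono {N j k t : ℕ} (h : j ≤ k) (y : Dec n) :
    S.approx N j t ω y 1 ≤ S.approx N k t ω y 1 := by
  rcases Nat.lt_or_ge N t with ht | ht
  · rw [Trace.approx_of_lt ht, Trace.approx_of_lt ht]
  · rw [Trace.approx_one ht, Trace.approx_one ht, EReal.coe_le_coe_iff]
    exact cutMax_mono h y

/-- The increase of the approximate cost-to-go function of stage `t` at iteration `k + 1`, at the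
decision `x_{t-1}^{k+1}`. -/
noncomputable def Trace.rise (S : Trace n Ξ Ω') (k t : ℕ) (ω : Ω') : ℝ :=
  S.cuts (k + 1) t ω (S.x (k + 1) (t - 1) ω) - S.cuts k t ω (S.x (k + 1) (t - 1) ω)

theorem Trace.rise_nonneg (k t : ℕ) : 0 ≤ S.rise k t ω :=
  sub_nonneg.2 (cutMax_mono (Nat.le_succ k) _)

variable [MeasurableSpace Ω] [MeasurableSpace Ξ] {P : Measure Ω} {M : StageModel n Ξ}
  {U : Uncertainty P Ξ} {x₀ : Dec n} {K : ℕ → Set (Dec n)}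

/-- The properties of a run of the algorithm that hold for almost all samples. -/
structure RunsAt (M : StageModel n Ξ) (U : Uncertainty P Ξ) (x₀ : Dec n) (S : Trace n Ξ Ω')
    (ω : Ω') : Prop where
  valid : ∀ k, 1 ≤ k → S.sample U.Tmax k ω ∈ U.validTraj
  x_zero : ∀ k, S.x k 0 ω = x₀
  D_zero : ∀ k, S.Ds k 0 ω = 1
  init : ∀ t ∈ Finset.Icc 2 U.Tmax, ∀ x,
    ((S.θ 0 t ω + inner ℝ (S.β 0 t ω) x : ℝ) : EReal) ≤ costToGo M U t x 1
  forward : ∀ k, 1 ≤ k → ∀ t ∈ Finset.Icc 1 U.Tmax,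
    S.x k t ω ∈ M.feas t (S.x k (t - 1) ω) (S.ξs k t ω) ∧
    ∀ y ∈ M.feas t (S.x k (t - 1) ω) (S.ξs k t ω),
      (S.Ds k (t - 1) ω : EReal) * M.cost t (S.x k t ω) (S.x k (t - 1) ω) (S.ξs k t ω) +
          S.approx U.Tmax (k - 1) (t + 1) ω (S.x k t ω) (S.Ds k t ω) ≤
        (S.Ds k (t - 1) ω : EReal) * M.cost t y (S.x k (t - 1) ω) (S.ξs k t ω) +
          S.approx U.Tmax (k - 1) (t + 1) ω y (S.Ds k t ω)
  βs_subgradient : ∀ k, 1 ≤ k → ∀ t ∈ Finset.Icc 2 U.Tmax, ∀ θ ∈ U.Θ t,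
    IsSubgradientAt (fun x => stageVal M (S.approx U.Tmax k (t + 1) ω) t x 1 θ 1)
      (S.x k (t - 1) ω) (S.βs k t θ ω)
  γs_subgradient : ∀ k, 1 ≤ k → ∀ t ∈ Finset.Icc 2 U.Tmax, ∀ θ ∈ U.Θ t,
    IsSubgradientAt (fun x => stageVal M (costToGo M U (t + 1)) t x 1 θ 0)
      (S.x k (t - 1) ω) (S.γs k t θ ω)
  θ_eq : ∀ k, 1 ≤ k → ∀ t ∈ Finset.Icc 2 U.Tmax,
    S.θ k t ω =
      (1 - U.q t) * ∑ θ ∈ U.Θ t, U.p t θ *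
          ((stageVal M (S.approx U.Tmax k (t + 1) ω) t (S.x k (t - 1) ω) 1 θ 1).toReal -
            inner ℝ (S.βs k t θ ω) (S.x k (t - 1) ω)) +
        U.q t * ∑ θ ∈ U.Θ t, U.p t θ *
          ((stageVal M (costToGo M U (t + 1)) t (S.x k (t - 1) ω) 1 θ 0).toReal -
            inner ℝ (S.γs k t θ ω) (S.x k (t - 1) ω))
  β_eq : ∀ k, 1 ≤ k → ∀ t ∈ Finset.Icc 2 U.Tmax,
    S.β k t ω = (1 - U.q t) • ∑ θ ∈ U.Θ t, U.p t θ • S.βs k t θ ω +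
      U.q t • ∑ θ ∈ U.Θ t, U.p t θ • S.γs k t θ ω

theorem IsSubgradientAt.coe_le {h : Dec n → EReal} {x s : Dec n} (H : IsSubgradientAt h x s)
    (y : Dec n) : (((h x).toReal - inner ℝ s x + inner ℝ s y : ℝ) : EReal) ≤ h y := by
  have h1 := H.2.2 y
  rw [← EReal.coe_toReal H.1 H.2.1, ← EReal.coe_add, inner_sub_right] at h1
  refine le_trans (EReal.coe_le_coe_iff.2 ?_) h1
  linarith

namespace RunsAt

/-- The value of the newest cut as an affine function. -/
theorem cut_eq (H : RunsAt M U x₀ S ω) {k : ℕ} (hk : 1 ≤ k) {t : ℕ} (ht : t ∈ Finset.Icc 2 U.Tmax)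
    (y : Dec n) : S.θ k t ω + inner ℝ (S.β k t ω) y =
      (1 - U.q t) * ∑ θ ∈ U.Θ t, U.p t θ *
        ((stageVal M (S.approx U.Tmax k (t + 1) ω) t (S.x k (t - 1) ω) 1 θ 1).toReal -
          inner ℝ (S.βs k t θ ω) (S.x k (t - 1) ω) + inner ℝ (S.βs k t θ ω) y) +
      U.q t * ∑ θ ∈ U.Θ t, U.p t θ *
        ((stageVal M (costToGo M U (t + 1)) t (S.x k (t - 1) ω) 1 θ 0).toReal -
          inner ℝ (S.γs k t θ ω) (S.x k (t - 1) ω) + inner ℝ (S.γs k t θ ω) y) := by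
  rw [H.θ_eq k hk t ht, H.β_eq k hk t ht]
  simp only [inner_add_left, real_inner_smul_left, sum_inner, mul_add, Finset.sum_add_distrib]
  ring

/-- Every cut is a minorant of the true cost-to-go function, by the subgradient inequalities and
the validity of the cuts of the next stage. -/
theorem approx_le_costToGo [IsProbabilityMeasure P] (H : RunsAt M U x₀ S ω) {t : ℕ}
    (ht : t ∈ Finset.Icc 2 (U.Tmax + 1)) (k : ℕ) (y : Dec n) :
    S.approx U.Tmax k t ω y 1 ≤ costToGo M U t y 1 := by
  suffices h : ∀ r : ℕ, ∀ t ∈ Finset.Icc 2 (U.Tmax + 1), U.Tmax + 1 - t = r → ∀ k y,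
      S.approx U.Tmax k t ω y 1 ≤ costToGo M U t y 1 from h _ t ht rfl k y
  clear ht k y t
  intro r
  induction r with
  | zero =>
    intro t ht hr k y
    obtain rfl : t = U.Tmax + 1 := by have := Finset.mem_Icc.1 ht; omega
    rw [Trace.approx_of_lt (by omega), costToGo_last]
  | succ r ih =>
    intro t ht hr k y
    have ht1 := Finset.mem_Icc.1 ht
    have ht2 : t ∈ Finset.Icc 2 U.Tmax := Finset.mem_Icc.2 (by omega)
    have ih' := ih (t + 1) (Finset.mem_Icc.2 (by omega)) (by omega)
    have hq0 := U.q_nonneg t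
    have hq1 := U.q_le_one ht2
    have hcut : ∀ j, ((S.θ j t ω + inner ℝ (S.β j t ω) y : ℝ) : EReal) ≤ costToGo M U t y 1 := by
      intro j
      rcases Nat.eq_zero_or_pos j with rfl | hj
      · exact H.init t ht2 y
      rw [H.cut_eq hj ht2, costToGo_one M U t (by omega), EReal.coe_add, EReal.coe_mul (1 - U.q t),
        EReal.coe_mul (U.q t), ereal_coe_sum, ereal_coe_sum]
      refine add_le_add (mul_le_mul_of_nonneg_left (Finset.sum_le_sum fun θ hθ => ?_)
        (EReal.coe_nonneg.2 (by linarith))) (mul_le_mul_of_nonneg_left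
        (Finset.sum_le_sum fun θ hθ => ?_) (EReal.coe_nonneg.2 hq0))
      · rw [EReal.coe_mul]
        refine mul_le_mul_of_nonneg_left ?_ (EReal.coe_nonneg.2 (U.p_nonneg t θ))
        exact ((H.βs_subgradient j hj t ht2 θ hθ).coe_le y).trans (stageVal_mono (ih' j))
      · rw [EReal.coe_mul]
        refine mul_le_mul_of_nonneg_left ?_ (EReal.coe_nonneg.2 (U.p_nonneg t θ))
        exact (H.γs_subgradient j hj t ht2 θ hθ).coe_le y
    rw [Trace.approx_one (by omega)]
    obtain ⟨j, -, hj⟩ := Finset.exists_mem_eq_sup' (Finset.nonempty_range_add_one (n := k))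
      (fun j => S.θ j t ω + inner ℝ (S.β j t ω) y)
    rw [Trace.cuts, cutMax, hj]
    exact hcut j

theorem x_mem (H : RunsAt M U x₀ S ω) (hK : IsInvariant M U x₀ K) {k : ℕ} (hk : 1 ≤ k) {t : ℕ}
    (ht : t ≤ U.Tmax) : S.x k t ω ∈ K t := by
  induction t with
  | zero => rw [H.x_zero]; exact hK.init_mem
  | succ t ih =>
    have ht' : t + 1 ∈ Finset.Icc 1 U.Tmax := Finset.mem_Icc.2 (by omega)
    exact (hK.recourse _ ht' _ (ih (by omega)) _ ((H.valid k hk).1 ⟨t + 1, ht'⟩).1).subset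
      (H.forward k hk _ ht').1

theorem finiteBddBelowOn_approx (hK : IsInvariant M U x₀ K) (k : ℕ) {t : ℕ}
    (ht : t ∈ Finset.Icc 2 (U.Tmax + 1)) (ω : Ω') {d : ℕ} (hd : d = 0 ∨ d = 1) :
    FiniteBddBelowOn (fun y => S.approx U.Tmax k t ω y d) (K (t - 1)) := by
  have ht' := Finset.mem_Icc.1 ht
  have zero : FiniteBddBelowOn (fun _ : Dec n => (0 : EReal)) (K (t - 1)) :=
    ⟨fun _ _ => EReal.zero_ne_top, 0, fun _ _ => le_rfl⟩
  rcases hd with rfl | rfl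
  · simpa only [Trace.approx_zero] using zero
  rcases Nat.lt_or_ge U.Tmax t with h | h
  · simpa only [Trace.approx_of_lt h] using zero
  simp only [Trace.approx_one h]
  obtain ⟨m, hm⟩ := exists_le_affine_of_isBounded
    (hK.bounded (t - 1) (Finset.mem_Icc.2 (by omega))) (S.θ 0 t ω) (S.β 0 t ω)
  exact ⟨fun y _ => EReal.coe_ne_top _, m, fun y hy =>
    EReal.coe_le_coe_iff.2 ((hm y hy).trans (le_cutMax (θ := fun j => S.θ j t ω) (β := fun j => S.β j t ω)
      (Nat.zero_le k) y))⟩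

end RunsAt

/-! ### The gap between the true and the approximate cost-to-go functions -/

/-- The real optimal value of the stage-`t` problem with the approximate cost-to-go function. -/
noncomputable def Trace.stageApprox (S : Trace n Ξ Ω') (M : StageModel n Ξ) (N k t : ℕ) (ω : Ω')
    (y : Dec n) (θ : Ξ) : ℝ :=
  (stageVal M (S.approx N k (t + 1) ω) t y 1 θ 1).toReal

/-- The gap between the cost-to-go function of stage `t` and its approximation by the cuts of the
iterations up to `k`, at the decision `x_{t-1}^{k+1}` of the next iteration. -/
noncomputable def Trace.gap (S : Trace n Ξ Ω') (M : StageModel n Ξ) (U : Uncertainty P Ξ) (k t : ℕ)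
    (ω : Ω') : ℝ :=
  toGo M U t (S.x (k + 1) (t - 1) ω) 1 -
    (S.approx U.Tmax k t ω (S.x (k + 1) (t - 1) ω) 1).toReal

namespace RunsAt

variable [IsProbabilityMeasure P]

theorem gap_nonneg (H : RunsAt M U x₀ S ω) (hK : IsInvariant M U x₀ K)
    (hmin : HasAffineMinorants M U) (k : ℕ) {t : ℕ} (ht : t ∈ Finset.Icc 2 (U.Tmax + 1)) :
    0 ≤ S.gap M U k t ω := by
  have ht' := Finset.mem_Icc.1 ht
  have hx := H.x_mem hK (k := k + 1) (by omega) (t := t - 1) (by omega)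
  rw [Trace.gap, sub_nonneg, toGo, ← EReal.coe_le_coe_iff,
    (hK.finiteBddBelowOn_costToGo hmin ht 1 (Or.inr rfl)).coe_toReal hx,
    (finiteBddBelowOn_approx hK k ht ω (Or.inr rfl)).coe_toReal hx]
  exact H.approx_le_costToGo ht k _

/-- The gap is at most the increase due to the newest cut plus the expected gap of the stage
problems, as the newest cut is exact for the approximate stage problems. -/
theorem gap_le (H : RunsAt M U x₀ S ω) (hK : IsInvariant M U x₀ K)
    (hmin : HasAffineMinorants M U) (k : ℕ) {t : ℕ} (ht : t ∈ Finset.Icc 2 U.Tmax) :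
    S.gap M U k t ω ≤ S.rise k t ω + (1 - U.q t) * ∑ θ ∈ U.Θ t, U.p t θ *
      (stageOpt M U t (S.x (k + 1) (t - 1) ω) θ 1 -
        S.stageApprox M U.Tmax k t ω (S.x (k + 1) (t - 1) ω) θ) := by
  have ht' := Finset.mem_Icc.1 ht
  have ht1 : t ∈ Finset.Icc 1 U.Tmax := Finset.mem_Icc.2 (by omega)
  have ht2 : t + 1 ∈ Finset.Icc 2 (U.Tmax + 1) := Finset.mem_Icc.2 (by omega)
  have hx := H.x_mem hK (k := k + 1) (by omega) (t := t - 1) (by omega)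
  set x := S.x (k + 1) (t - 1) ω with hxdef
  have hrec := hK.recourse t ht1 x hx
  have hq1 := U.q_le_one ht
  have hcut := H.cut_eq (k := k + 1) (by omega) ht x
  have hle : S.θ (k + 1) t ω + inner ℝ (S.β (k + 1) t ω) x ≤ S.cuts (k + 1) t ω x :=
    le_cutMax (θ := fun j => S.θ j t ω) (β := fun j => S.β j t ω) (le_refl (k + 1)) x
  simp only [← hxdef, sub_add_cancel] at hcut
  have hmono : ∑ θ ∈ U.Θ t, U.p t θ * S.stageApprox M U.Tmax k t ω x θ ≤
      ∑ θ ∈ U.Θ t, U.p t θ *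
        (stageVal M (S.approx U.Tmax (k + 1) (t + 1) ω) t x 1 θ 1).toReal := by
    refine Finset.sum_le_sum fun θ hθ => mul_le_mul_of_nonneg_left ?_ (U.p_nonneg t θ)
    rw [← EReal.coe_le_coe_iff, Trace.stageApprox,
      (hrec θ hθ).coe_toReal_stageVal (finiteBddBelowOn_approx hK k ht2 ω (Or.inr rfl)),
      (hrec θ hθ).coe_toReal_stageVal (finiteBddBelowOn_approx hK (k + 1) ht2 ω (Or.inr rfl))]
    exact stageVal_mono fun y => Trace.approx_mono (Nat.le_succ k) y
  have hmono' := mul_le_mul_of_nonneg_left hmono (sub_nonneg.2 hq1)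
  have hV : toGo M U t x 1 = (1 - U.q t) * ∑ θ ∈ U.Θ t, U.p t θ * stageOpt M U t x θ 1 +
      U.q t * ∑ θ ∈ U.Θ t, U.p t θ * stageOpt M U t x θ 0 := by
    rw [toGo, costToGo_eq_coe ht hrec fun d hd => hK.finiteBddBelowOn_costToGo hmin ht2 d hd]
    rfl
  rw [Trace.gap, ← hxdef, hV, Trace.approx_one ht'.2, EReal.toReal_coe, Trace.rise, ← hxdef]
  simp only [mul_sub, Finset.sum_sub_distrib]
  simp only [stageOpt] at *
  linarith

omit [IsProbabilityMeasure P] in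
/-- If the sampled process is alive after stage `t`, the gap of the sampled stage problem is at most
the gap of the next cost-to-go function at the decision computed by the forward pass. -/
theorem stage_gap_le (H : RunsAt M U x₀ S ω) (hK : IsInvariant M U x₀ K)
    (hmin : HasAffineMinorants M U) (k : ℕ) {t : ℕ} (ht : t ∈ Finset.Icc 1 U.Tmax)
    (hD : S.Ds (k + 1) (t - 1) ω = 1) (hD' : S.Ds (k + 1) t ω = 1) :
    stageOpt M U t (S.x (k + 1) (t - 1) ω) (S.ξs (k + 1) t ω) 1 -
      S.stageApprox M U.Tmax k t ω (S.x (k + 1) (t - 1) ω) (S.ξs (k + 1) t ω) ≤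
        S.gap M U k (t + 1) ω := by
  have ht' := Finset.mem_Icc.1 ht
  have ht2 : t + 1 ∈ Finset.Icc 2 (U.Tmax + 1) := Finset.mem_Icc.2 (by omega)
  have hx := H.x_mem hK (k := k + 1) (by omega) (t := t - 1) (by omega)
  have hθ : S.ξs (k + 1) t ω ∈ U.Θ t := ((H.valid (k + 1) (by omega)).1 ⟨t, ht⟩).1
  have hrec := hK.recourse t ht _ hx _ hθ
  have hfa := finiteBddBelowOn_approx (S := S) hK k ht2 ω (Or.inr rfl)
  obtain ⟨hfeas, hopt⟩ := H.forward (k + 1) (by omega) t ht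
  simp only [hD, hD', Nat.cast_one, one_mul, Nat.add_sub_cancel] at hopt
  have h1 := hrec.toReal_stageVal_le (hK.finiteBddBelowOn_costToGo hmin ht2 1 (Or.inr rfl)) hfeas
  have h2 : (M.cost t (S.x (k + 1) t ω) (S.x (k + 1) (t - 1) ω) (S.ξs (k + 1) t ω)).toReal +
      (S.approx U.Tmax k (t + 1) ω (S.x (k + 1) t ω) 1).toReal ≤
      S.stageApprox M U.Tmax k t ω (S.x (k + 1) (t - 1) ω) (S.ξs (k + 1) t ω) := by
    rw [← EReal.coe_le_coe_iff, hrec.coe_toReal_add hfa hfeas, Trace.stageApprox,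
      hrec.coe_toReal_stageVal hfa, stageVal_one]
    exact le_iInf₂ hopt
  simp only [Trace.gap, toGo, stageOpt, Nat.add_sub_cancel] at *
  linarith

end RunsAt

/-! ### Almost sure properties of a run -/

variable [MeasurableSpace Ω'] {P' : Measure Ω'}

theorem ae_forall_iter_stage {μ : Measure Ω'} {p : ℕ → ℕ → Ω' → Prop} {s : Finset ℕ}
    (h : ∀ k, 1 ≤ k → ∀ t ∈ s, ∀ᵐ ω ∂μ, p k t ω) :
    ∀ᵐ ω ∂μ, ∀ k, 1 ≤ k → ∀ t ∈ s, p k t ω :=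
  ae_all_iff.2 fun k => Filter.eventually_imp_distrib_left.2 fun hk =>
    (ae_ball_iff (Finset.countable_toSet _)).2 fun t ht => h k hk t ht

theorem IsRun.ae_runsAt [MeasurableSingletonClass Ξ] (hS : IsRun P' M U x₀ S) :
    ∀ᵐ ω ∂P', RunsAt M U x₀ S ω := by
  have h1 : ∀ᵐ ω ∂P', ∀ k, 1 ≤ k → S.sample U.Tmax k ω ∈ U.validTraj :=
    ae_all_iff.2 fun k => Filter.eventually_imp_distrib_left.2 fun hk =>
      (hS.sample_law k hk).symm.ae_snd U.measurableSet_validTraj U.ae_traj_valid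
  have h2 := ae_forall_iter_stage hS.forward
  have h3 := ae_forall_iter_stage fun k hk t ht =>
    (ae_ball_iff (Finset.countable_toSet _)).2 fun θ hθ => hS.βs_subgradient k hk t ht θ hθ
  have h4 := ae_forall_iter_stage fun k hk t ht =>
    (ae_ball_iff (Finset.countable_toSet _)).2 fun θ hθ => hS.γs_subgradient k hk t ht θ hθ
  have h5 := ae_forall_iter_stage hS.θ_eq
  have h6 := ae_forall_iter_stage hS.β_eq
  filter_upwards [h1, h2, h3, h4, h5, h6] with ω h1 h2 h3 h4 h5 h6
  refine ⟨h1, fun k => hS.x_zero k ω, fun k => hS.D_zero k ω, fun t ht x => ?_, h2, h3, h4, h5, h6⟩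
  obtain ⟨a, s, h, h'⟩ := hS.init t ht
  rw [(h ω).1, (h ω).2]
  exact h' x

theorem IsRun.hasAffineMinorants (hS : IsRun P' M U x₀ S) : HasAffineMinorants M U := by
  intro t ht
  obtain ⟨a, s, -, h⟩ := hS.init t ht
  exact ⟨a, s, h⟩

end Run

/-! ### Dependence of the run on the samples -/

section Data

variable {Ω Ω' Ξ : Type*} [MeasurableSpace Ω] [MeasurableSpace Ω'] [MeasurableSpace Ξ]
  {n : ℕ} {P : Measure Ω} {P' : Measure Ω'} {M : StageModel n Ξ} {U : Uncertainty P Ξ} {x₀ : Dec n}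
  {S : Trace n Ξ Ω'} {K : ℕ → Set (Dec n)}

/-- The samples of the iterations `1, …, k`. -/
def Trace.past (S : Trace n Ξ Ω') (N k : ℕ) (ω : Ω') :
    Finset.range k → Finset.Icc 1 N → Ξ × ℕ :=
  fun i => S.sample N (i + 1) ω

/-- Two outcomes with the same samples in the iterations `1, …, k` and in the first `t` stages of
iteration `k + 1`. -/
abbrev Trace.SameData (S : Trace n Ξ Ω') (N k t : ℕ) : Ω' → Ω' → Prop :=
  SamePrefix (S.past N k) (S.sample N (k + 1)) t

omit [MeasurableSpace Ω'] [MeasurableSpace Ξ] in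
theorem Trace.SameData.of_succ {N k : ℕ} (ω ω' : Ω') (h : S.SameData N (k + 1) 0 ω ω') :
    S.SameData N k N ω ω' := by
  have h1 : ∀ i < k + 1, S.sample N (i + 1) ω = S.sample N (i + 1) ω' := fun i hi =>
    congrFun h.1 ⟨i, Finset.mem_range.2 hi⟩
  refine ⟨funext fun i => h1 i ?_, fun s _ => congrFun (h1 k (Nat.lt_succ_self k)) s⟩
  have := Finset.mem_range.1 i.2
  omega

omit [MeasurableSpace Ω'] in
theorem Trace.info_le_saturated {N k t : ℕ} (ht : t ≤ N) :
    S.info N (k + 1) t ≤ saturated (S.SameData N k t) SamePrefix.symm := by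
  refine sup_le (iSup₂_le fun i hi => ?_) (iSup₂_le fun s hs => ?_)
  · refine comap_le_saturated _ fun ω ω' h => ?_
    have hi' := Finset.mem_Ico.1 hi
    have h1 := congrFun h.1 ⟨i - 1, Finset.mem_range.2 (by omega)⟩
    simpa [Trace.past, Nat.sub_add_cancel hi'.1] using h1
  · have hs' := Finset.mem_Icc.1 hs
    have h1 : ∀ ω ω', S.SameData N k t ω ω' →
        (S.ξs (k + 1) s ω, S.Ds (k + 1) s ω) = (S.ξs (k + 1) s ω', S.Ds (k + 1) s ω') :=
      fun ω ω' h => h.2 ⟨s, Finset.mem_Icc.2 (by omega)⟩ hs'.2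
    exact sup_le (comap_le_saturated _ fun ω ω' h => (Prod.mk.inj (h1 ω ω' h)).1)
      (comap_le_saturated _ fun ω ω' h => (Prod.mk.inj (h1 ω ω' h)).2)

namespace IsRun

theorem measurable_sample (hS : IsRun P' M U x₀ S) {k : ℕ} (hk : 1 ≤ k) :
    Measurable (S.sample U.Tmax k) :=
  measurable_pi_lambda _ fun s =>
    (hS.measurable_ξs k hk s s.2).prodMk (hS.measurable_Ds k hk s s.2)

theorem isFreshSample [MeasurableSingletonClass Ξ] (hS : IsRun P' M U x₀ S) (k : ℕ) :
    IsFreshSample P' U (S.past U.Tmax k) (S.sample U.Tmax (k + 1)) where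
  measurable_past := measurable_pi_lambda _ fun i => hS.measurable_sample (by omega)
  finite_past := by
    classical
    refine ⟨Fintype.piFinset fun _ => Fintype.piFinset fun s : Finset.Icc 1 U.Tmax =>
      U.Θ s ×ˢ {0, 1}, ?_⟩
    filter_upwards [hS.ae_runsAt] with ω hω
    refine Fintype.mem_piFinset.2 fun i => Fintype.mem_piFinset.2 fun s => ?_
    have := (hω.valid (i + 1) (by omega)).1 s
    simpa [Trace.past] using this
  law := hS.sample_law (k + 1) (by omega)
  measurable_cur := hS.measurable_sample (by omega)
  indep := by
    have h := hS.sample_indep.indepFun_finset (Finset.range k) {k} (by simp)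
      (fun i => hS.measurable_sample (by omega))
    exact h.comp measurable_id (measurable_pi_apply ⟨k, Finset.mem_singleton_self k⟩)

theorem determinedBy_x (hS : IsRun P' M U x₀ S) (k : ℕ) {t : ℕ} (ht : t ≤ U.Tmax) :
    DeterminedBy P' (S.SameData U.Tmax k t) (S.x (k + 1) t) := by
  refine DeterminedBy.of_forall fun ω ω' h => ?_
  rcases Nat.eq_zero_or_pos t with rfl | h0
  · rw [hS.x_zero, hS.x_zero]
  · exact eq_of_measurable_saturated (Trace.info_le_saturated ht)
      (hS.x_adapted (k + 1) (by omega) t (Finset.mem_Icc.2 ⟨h0, ht⟩)) h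

omit [MeasurableSpace Ξ] in
theorem _root_.SDDP.Trace.determinedBy_approx {N k t : ℕ} {r : Ω' → Ω' → Prop}
    (h : ∀ j ≤ k, DeterminedBy P' r (fun ω => (S.θ j t ω, S.β j t ω))) :
    DeterminedBy P' r (S.approx N k t) := by
  have h1 : DeterminedBy P' r (fun ω (j : {j // j ≤ k}) => (S.θ j t ω, S.β j t ω)) :=
    DeterminedBy.pi fun j => h j j.2
  refine h1.of_imp fun ω ω' h2 => ?_
  have h3 : ∀ j ≤ k, S.θ j t ω = S.θ j t ω' ∧ S.β j t ω = S.β j t ω' := fun j hj =>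
    Prod.mk.inj (congrFun h2 ⟨j, hj⟩)
  funext y d
  unfold Trace.approx
  split_ifs
  · rfl
  · congr 1
    refine Finset.sup'_congr _ rfl fun j hj => ?_
    obtain ⟨h4, h5⟩ := h3 j (by have := Finset.mem_range.1 hj; omega)
    rw [h4, h5]

/-- The cuts of the iterations up to `k` depend on the samples of these iterations only. -/
theorem determinedBy_cut [MeasurableSingletonClass Ξ] (hS : IsRun P' M U x₀ S) (k : ℕ) :
    ∀ j ≤ k, ∀ t ∈ Finset.Icc 2 U.Tmax,
      DeterminedBy P' (S.SameData U.Tmax k 0) (fun ω => (S.θ j t ω, S.β j t ω)) := by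
  induction k with
  | zero =>
    intro j hj t ht
    obtain rfl : j = 0 := by omega
    obtain ⟨a, s, h, -⟩ := hS.init t ht
    exact DeterminedBy.of_forall fun ω ω' _ => by rw [(h ω).1, (h ω).2, (h ω').1, (h ω').2]
  | succ k ih =>
    have hold : ∀ j ≤ k, ∀ t ∈ Finset.Icc 2 U.Tmax,
        DeterminedBy P' (S.SameData U.Tmax (k + 1) 0) (fun ω => (S.θ j t ω, S.β j t ω)) :=
      fun j hj t ht => (ih j hj t ht).mono fun ω ω' h =>
        SamePrefix.mono (Nat.zero_le _) _ _ (Trace.SameData.of_succ ω ω' h)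
    suffices hnew : ∀ r : ℕ, ∀ t ∈ Finset.Icc 2 U.Tmax, U.Tmax - t = r →
        DeterminedBy P' (S.SameData U.Tmax (k + 1) 0)
          (fun ω => (S.θ (k + 1) t ω, S.β (k + 1) t ω)) by
      intro j hj t ht
      rcases Nat.lt_or_ge j (k + 1) with h | h
      · exact hold j (by omega) t ht
      · obtain rfl : j = k + 1 := by omega
        exact hnew _ t ht rfl
    -- The backward pass computes the cut of stage `t` from the new cuts of stage `t + 1`.
    intro r
    induction r using Nat.strong_induction_on with
    | _ r ihr =>
    intro t ht hr
    have ht' := Finset.mem_Icc.1 ht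
    have happ : DeterminedBy P' (S.SameData U.Tmax (k + 1) 0) (S.approx U.Tmax (k + 1) (t + 1)) := by
      rcases Nat.lt_or_ge U.Tmax (t + 1) with h | h
      · refine DeterminedBy.of_forall fun ω ω' _ => ?_
        funext y d
        rw [Trace.approx_of_lt h, Trace.approx_of_lt h]
      · have ht2 : t + 1 ∈ Finset.Icc 2 U.Tmax := Finset.mem_Icc.2 (by omega)
        refine Trace.determinedBy_approx fun j hj => ?_
        rcases Nat.lt_or_ge j (k + 1) with h1 | h1
        · exact hold j (by omega) _ ht2
        · obtain rfl : j = k + 1 := by omega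
          exact ihr _ (by omega) (t + 1) ht2 rfl
    have hx : DeterminedBy P' (S.SameData U.Tmax (k + 1) 0) (S.x (k + 1) (t - 1)) :=
      (hS.determinedBy_x k (t := t - 1) (by omega)).mono fun ω ω' h =>
        SamePrefix.mono (by omega) _ _ (Trace.SameData.of_succ ω ω' h)
    have hsub : DeterminedBy P' (S.SameData U.Tmax (k + 1) 0)
        (fun ω (θ : U.Θ t) => (S.βs (k + 1) t θ ω, S.γs (k + 1) t θ ω)) := by
      refine DeterminedBy.pi fun θ => DeterminedBy.of_forall fun ω ω' h => ?_
      have h' := Trace.SameData.of_succ ω ω' h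
      rw [eq_of_measurable_saturated (Trace.info_le_saturated le_rfl)
          (hS.βs_adapted (k + 1) (by omega) t ht θ θ.2) h',
        eq_of_measurable_saturated (Trace.info_le_saturated le_rfl)
          (hS.γs_adapted (k + 1) (by omega) t ht θ θ.2) h']
    have hpair := (happ.comp₂ hx Prod.mk).comp₂ hsub Prod.mk
    refine (hpair.of_imp (G := fun ω => (
      (1 - U.q t) * ∑ θ ∈ U.Θ t, U.p t θ *
          ((stageVal M (S.approx U.Tmax (k + 1) (t + 1) ω) t (S.x (k + 1) (t - 1) ω) 1 θ 1).toReal -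
            inner ℝ (S.βs (k + 1) t θ ω) (S.x (k + 1) (t - 1) ω)) +
        U.q t * ∑ θ ∈ U.Θ t, U.p t θ *
          ((stageVal M (costToGo M U (t + 1)) t (S.x (k + 1) (t - 1) ω) 1 θ 0).toReal -
            inner ℝ (S.γs (k + 1) t θ ω) (S.x (k + 1) (t - 1) ω)),
      (1 - U.q t) • ∑ θ ∈ U.Θ t, U.p t θ • S.βs (k + 1) t θ ω +
        U.q t • ∑ θ ∈ U.Θ t, U.p t θ • S.γs (k + 1) t θ ω)) fun ω ω' h => ?_).congr ?_
    · obtain ⟨h1, h2⟩ := Prod.mk.inj h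
      obtain ⟨h3, h4⟩ := Prod.mk.inj h1
      have h5 : ∀ θ ∈ U.Θ t, S.βs (k + 1) t θ ω = S.βs (k + 1) t θ ω' ∧
          S.γs (k + 1) t θ ω = S.γs (k + 1) t θ ω' := fun θ hθ =>
        Prod.mk.inj (congrFun h2 ⟨θ, hθ⟩)
      beta_reduce
      rw [h3, h4]
      congr 1
      · congr 2
        · exact Finset.sum_congr rfl fun θ hθ => by rw [(h5 θ hθ).1]
        · exact Finset.sum_congr rfl fun θ hθ => by rw [(h5 θ hθ).2]
      · congr 2
        · exact Finset.sum_congr rfl fun θ hθ => by rw [(h5 θ hθ).1]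
        · exact Finset.sum_congr rfl fun θ hθ => by rw [(h5 θ hθ).2]
    · filter_upwards [hS.ae_runsAt] with ω hω
      rw [hω.θ_eq (k + 1) (by omega) t ht, hω.β_eq (k + 1) (by omega) t ht]

theorem determinedBy_approx [MeasurableSingletonClass Ξ] (hS : IsRun P' M U x₀ S) (k : ℕ) {t : ℕ}
    (ht : 2 ≤ t) : DeterminedBy P' (S.SameData U.Tmax k 0) (S.approx U.Tmax k t) := by
  rcases Nat.lt_or_ge U.Tmax t with h | h
  · refine DeterminedBy.of_forall fun ω ω' _ => ?_
    funext y d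
    rw [Trace.approx_of_lt h, Trace.approx_of_lt h]
  · exact Trace.determinedBy_approx fun j hj =>
      hS.determinedBy_cut k j hj t (Finset.mem_Icc.2 ⟨ht, h⟩)

variable [MeasurableSingletonClass Ξ] [IsProbabilityMeasure P']

theorem integrable_gap (hS : IsRun P' M U x₀ S) (k : ℕ) {t : ℕ}
    (ht : t ∈ Finset.Icc 2 (U.Tmax + 1)) : Integrable (S.gap M U k t) P' := by
  have ht' := Finset.mem_Icc.1 ht
  refine (hS.isFreshSample k).integrable (t := t - 1) ?_
  exact (((hS.determinedBy_approx k ht'.1).mono (SamePrefix.mono (Nat.zero_le _))).comp₂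
    (hS.determinedBy_x k (t := t - 1) (by omega)) fun V y => toGo M U t y 1 - (V y 1).toReal)

theorem integrable_rise (hS : IsRun P' M U x₀ S) (k : ℕ) {t : ℕ} (ht : t ∈ Finset.Icc 2 U.Tmax) :
    Integrable (S.rise k t) P' := by
  have ht' := Finset.mem_Icc.1 ht
  refine (hS.isFreshSample (k + 1)).integrable (t := 0) ?_
  have h1 : DeterminedBy P' (S.SameData U.Tmax (k + 1) 0) (S.approx U.Tmax k t) :=
    (hS.determinedBy_approx k ht'.1).mono fun ω ω' h =>
      SamePrefix.mono (Nat.zero_le _) _ _ (Trace.SameData.of_succ ω ω' h)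
  have h2 : DeterminedBy P' (S.SameData U.Tmax (k + 1) 0) (S.x (k + 1) (t - 1)) :=
    (hS.determinedBy_x k (t := t - 1) (by omega)).mono fun ω ω' h =>
      SamePrefix.mono (by omega) _ _ (Trace.SameData.of_succ ω ω' h)
  have h3 := (((hS.determinedBy_approx (k + 1) ht'.1).comp₂ h1 Prod.mk).comp₂ h2
    fun V y => (V.1 y 1).toReal - (V.2 y 1).toReal)
  simp only [Trace.approx_one ht'.2, EReal.toReal_coe] at h3
  exact h3

variable [IsProbabilityMeasure P]

/-- The expected gap at stage `t`, on the event that the process is alive, exceeds the one at stage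
`t + 1` by at most the expected increase due to the newest cut. -/
theorem setIntegral_gap_le (hS : IsRun P' M U x₀ S) (hK : IsInvariant M U x₀ K) (k : ℕ) {t : ℕ}
    (ht : t ∈ Finset.Icc 2 U.Tmax) :
    ∫ ω in {ω | S.Ds (k + 1) (t - 1) ω = 1}, S.gap M U k t ω ∂P' ≤
      ∫ ω, S.rise k t ω ∂P' +
        ∫ ω in {ω | S.Ds (k + 1) t ω = 1}, S.gap M U k (t + 1) ω ∂P' := by
  have ht' := Finset.mem_Icc.1 ht
  have ht1 : t ∈ Finset.Icc 1 U.Tmax := Finset.mem_Icc.2 (by omega)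
  have ht2 : t - 1 ∈ Finset.Icc 1 U.Tmax := Finset.mem_Icc.2 (by omega)
  have ht3 : t ∈ Finset.Icc 2 (U.Tmax + 1) := Finset.mem_Icc.2 (by omega)
  have ht4 : t + 1 ∈ Finset.Icc 2 (U.Tmax + 1) := Finset.mem_Icc.2 (by omega)
  have hmin := hS.hasAffineMinorants
  have hfresh := hS.isFreshSample k
  set E : Set Ω' := {ω | S.Ds (k + 1) (t - 1) ω = 1} with hE
  set E' : Set Ω' := {ω | S.Ds (k + 1) t ω = 1} with hE'
  have hEm : MeasurableSet E := hS.measurable_Ds (k + 1) (by omega) _ ht2 (measurableSet_singleton 1)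
  have hEm' : MeasurableSet E' :=
    hS.measurable_Ds (k + 1) (by omega) _ ht1 (measurableSet_singleton 1)
  let F : Ξ → ℕ → Ω' → ℝ := fun θ d ω => if d = 1 then
    stageOpt M U t (S.x (k + 1) (t - 1) ω) θ 1 -
      S.stageApprox M U.Tmax k t ω (S.x (k + 1) (t - 1) ω) θ else 0
  have hF : ∀ θ ∈ U.Θ t, ∀ d, d = 0 ∨ d = 1 →
      DeterminedBy P' (S.SameData U.Tmax k (t - 1)) (F θ d) := by
    intro θ _ d _
    have h1 := (hS.determinedBy_approx k (t := t + 1) (by omega)).mono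
      (SamePrefix.mono (Nat.zero_le (t - 1)))
    exact h1.comp₂ (hS.determinedBy_x k (t := t - 1) (by omega)) fun V y => if d = 1 then
      stageOpt M U t y θ 1 - (stageVal M V t y 1 θ 1).toReal else 0
  have hFi : ∀ θ ∈ U.Θ t, Integrable (F θ 1) P' := fun θ hθ =>
    hfresh.integrable (hF θ hθ 1 (Or.inr rfl))
  have hstage := hfresh.setIntegral_stage ht1 ht2 hF
  have hset : {ω | (S.sample U.Tmax (k + 1) ω ⟨t - 1, ht2⟩).2 = 1} = E := rfl
  rw [hset] at hstage
  have hFsum : Integrable (fun ω => (1 - U.q t) * ∑ θ ∈ U.Θ t, U.p t θ * F θ 1 ω) P' :=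
    (integrable_finsetSum _ fun θ hθ => (hFi θ hθ).const_mul _).const_mul _
  calc ∫ ω in E, S.gap M U k t ω ∂P'
      ≤ ∫ ω in E, (S.rise k t ω + (1 - U.q t) * ∑ θ ∈ U.Θ t, U.p t θ * F θ 1 ω) ∂P' := by
        refine integral_mono_ae (hS.integrable_gap k ht3).restrict
          ((hS.integrable_rise k ht).add hFsum).restrict (ae_restrict_of_ae ?_)
        filter_upwards [hS.ae_runsAt] with ω hω
        simpa [F] using hω.gap_le hK hmin k ht
    _ = ∫ ω in E, S.rise k t ω ∂P' +
          ∫ ω in E, (1 - U.q t) * ∑ θ ∈ U.Θ t, U.p t θ * F θ 1 ω ∂P' :=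
        integral_add (hS.integrable_rise k ht).restrict hFsum.restrict
    _ ≤ ∫ ω, S.rise k t ω ∂P' + ∫ ω in E', S.gap M U k (t + 1) ω ∂P' := by
        refine add_le_add (setIntegral_le_integral (hS.integrable_rise k ht)
          (Eventually.of_forall fun ω => Trace.rise_nonneg k t)) ?_
        have h1 : ∫ ω in E, (1 - U.q t) * ∑ θ ∈ U.Θ t, U.p t θ * F θ 1 ω ∂P' =
            ∫ ω in E, F (S.ξs (k + 1) t ω) (S.Ds (k + 1) t ω) ω ∂P' := by
          refine Eq.trans ?_ hstage
          simp [F]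
        rw [h1, ← integral_indicator hEm, ← integral_indicator hEm']
        -- Both sides vanish if the process dies at stage `t`; it was alive before if it is alive.
        have hle : E.indicator (fun ω => F (S.ξs (k + 1) t ω) (S.Ds (k + 1) t ω) ω) ≤ᵐ[P']
            E'.indicator (S.gap M U k (t + 1)) := by
          filter_upwards [hS.ae_runsAt] with ω hω
          have hv := hω.valid (k + 1) (by omega)
          rcases (hv.1 ⟨t, ht1⟩).2 with hd | hd
          · have hd' : S.Ds (k + 1) t ω = 0 := hd
            have hn : ω ∉ E' := fun h => by simp [hE', hd'] at h
            rw [Set.indicator_of_notMem hn]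
            by_cases hω' : ω ∈ E
            · rw [Set.indicator_of_mem hω', hd']
              simp [F]
            · rw [Set.indicator_of_notMem hω']
          · have hd' : S.Ds (k + 1) t ω = 1 := hd
            have hd2 : S.Ds (k + 1) (t - 1) ω = 1 :=
              hv.2.1 ⟨t - 1, ht2⟩ ⟨t, ht1⟩ (Nat.sub_le t 1) hd
            rw [Set.indicator_of_mem (show ω ∈ E from hd2),
              Set.indicator_of_mem (show ω ∈ E' from hd'), hd']
            simpa [F] using hω.stage_gap_le hK hmin k ht1 hd2 hd'
        have hi : Integrable (fun ω => F (S.ξs (k + 1) t ω) (S.Ds (k + 1) t ω) ω) P' := by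
          refine hfresh.integrable (t := t) ?_
          have h2 := (hS.determinedBy_approx k (t := t + 1) (by omega)).mono
            (SamePrefix.mono (Nat.zero_le t))
          have h3 := (hS.determinedBy_x k (t := t - 1) (by omega)).mono
            (SamePrefix.mono (Nat.sub_le t 1))
          have h4 : DeterminedBy P' (S.SameData U.Tmax k t)
              (fun ω => S.sample U.Tmax (k + 1) ω ⟨t, ht1⟩) :=
            DeterminedBy.of_forall fun ω ω' h => h.2 ⟨t, ht1⟩ le_rfl
          exact (h2.comp₂ h3 Prod.mk).comp₂ h4 fun V c => if c.2 = 1 then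
            stageOpt M U t V.2 c.1 1 - (stageVal M V.1 t V.2 1 c.1 1).toReal else 0
        exact integral_mono_ae (hi.indicator hEm) ((hS.integrable_gap k ht4).indicator hEm') hle

end IsRun

end Data

/-! ### Convergence of the lower bounds -/

section Convergence

variable {Ω Ω' Ξ : Type*} [MeasurableSpace Ω] [MeasurableSpace Ω'] [MeasurableSpace Ξ]
  {n : ℕ} {P : Measure Ω} {P' : Measure Ω'} {M : StageModel n Ξ} {U : Uncertainty P Ξ} {x₀ : Dec n}
  {S : Trace n Ξ Ω'} {K R : ℕ → Set (Dec n)} {ω : Ω'}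

/-- Sets `R t ⊇ K t` on which the cost-to-go functions are bounded above, and in which trial points
of `K t` can be extrapolated. -/
structure IsExtrapolating (M : StageModel n Ξ) (U : Uncertainty P Ξ) (K R : ℕ → Set (Dec n)) :
    Prop where
  subset : ∀ t ∈ Finset.Icc 2 U.Tmax, K (t - 1) ⊆ R (t - 1)
  extrapolates : ∀ t ∈ Finset.Icc 2 U.Tmax, Extrapolates (K (t - 1)) (R (t - 1))
  bddAbove : ∀ t ∈ Finset.Icc 2 U.Tmax, ∃ C : ℝ, ∀ x ∈ R (t - 1), costToGo M U t x 1 ≤ C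

omit [MeasurableSpace Ω'] in
theorem RunsAt.tendsto_rise [IsProbabilityMeasure P] (H : RunsAt M U x₀ S ω)
    (hK : IsInvariant M U x₀ K) (hR : IsExtrapolating M U K R) {t : ℕ}
    (ht : t ∈ Finset.Icc 2 U.Tmax) : Tendsto (fun k => S.rise k t ω) atTop (𝓝 0) := by
  have ht' := Finset.mem_Icc.1 ht
  obtain ⟨C, hC⟩ := hR.bddAbove t ht
  obtain ⟨c₀, hc₀⟩ := exists_le_affine_of_isBounded
    (hK.bounded (t - 1) (Finset.mem_Icc.2 (by omega))) (S.θ 0 t ω) (S.β 0 t ω)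
  refine tendsto_cutMax_increment (θ := fun j => S.θ j t ω) (β := fun j => S.β j t ω)
    (x := fun k => S.x k (t - 1) ω) (hR.extrapolates t ht) (hR.subset t ht)
    (fun k => H.x_mem hK (by omega) (by omega)) (c₀ := c₀) (C := C) (fun k y hy => ?_) hc₀
  have h1 := (H.approx_le_costToGo (Finset.mem_Icc.2 (by omega) : t ∈ _) k y).trans (hC y hy)
  rw [Trace.approx_one ht'.2, EReal.coe_le_coe_iff] at h1
  exact (le_cutMax (θ := fun j => S.θ j t ω) (β := fun j => S.β j t ω) le_rfl y).trans h1

namespace IsRun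

variable [MeasurableSingletonClass Ξ] [IsProbabilityMeasure P] [IsProbabilityMeasure P']

theorem tendsto_integral_rise (hS : IsRun P' M U x₀ S) (hK : IsInvariant M U x₀ K)
    (hR : IsExtrapolating M U K R) {t : ℕ} (ht : t ∈ Finset.Icc 2 U.Tmax) :
    Tendsto (fun k => ∫ ω, S.rise k t ω ∂P') atTop (𝓝 0) := by
  have ht' := Finset.mem_Icc.1 ht
  obtain ⟨C, hC⟩ := hR.bddAbove t ht
  obtain ⟨a, s, has, -⟩ := hS.init t ht
  obtain ⟨c₀, hc₀⟩ := exists_le_affine_of_isBounded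
    (hK.bounded (t - 1) (Finset.mem_Icc.2 (by omega))) a s
  have h : Tendsto (fun k => ∫ ω, S.rise k t ω ∂P') atTop (𝓝 (∫ _, (0 : ℝ) ∂P')) := by
    refine tendsto_integral_of_dominated_convergence (fun _ => C - c₀)
      (fun k => (hS.integrable_rise k ht).aestronglyMeasurable) (integrable_const _)
      (fun k => ?_) ?_
    · filter_upwards [hS.ae_runsAt] with ω hω
      have hx := hω.x_mem hK (k := k + 1) (by omega) (t := t - 1) (by omega)
      rw [Real.norm_of_nonneg (Trace.rise_nonneg k t)]
      have h1 := (hω.approx_le_costToGo (Finset.mem_Icc.2 (by omega) : t ∈ _) (k + 1)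
        (S.x (k + 1) (t - 1) ω)).trans (hC _ (hR.subset t ht hx))
      rw [Trace.approx_one ht'.2, EReal.coe_le_coe_iff] at h1
      have h2 : a + inner ℝ s (S.x (k + 1) (t - 1) ω) ≤ S.cuts k t ω (S.x (k + 1) (t - 1) ω) := by
        have h3 := le_cutMax (θ := fun j => S.θ j t ω) (β := fun j => S.β j t ω) (Nat.zero_le k)
          (S.x (k + 1) (t - 1) ω)
        rwa [(has ω).1, (has ω).2] at h3
      have h3 := hc₀ _ hx
      rw [Trace.rise]
      linarith
    · filter_upwards [hS.ae_runsAt] with ω hω using hω.tendsto_rise hK hR ht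
  simpa using h

/-- The expected first stage gap is at most the sum over the stages of the expected increases due to
the newest cuts: `setIntegral_gap_le` is iterated down from stage `Tmax + 1`, where the gap is zero. -/
theorem integral_gap_le (hS : IsRun P' M U x₀ S) (hK : IsInvariant M U x₀ K) (k : ℕ) :
    ∫ ω, S.gap M U k 2 ω ∂P' ≤ ∑ t ∈ Finset.Ico 2 (U.Tmax + 1), ∫ ω, S.rise k t ω ∂P' := by
  have hT := U.two_le_Tmax
  have key : ∀ r : ℕ, ∀ t ∈ Finset.Icc 2 (U.Tmax + 1), U.Tmax + 1 - t = r →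
      ∫ ω in {ω | S.Ds (k + 1) (t - 1) ω = 1}, S.gap M U k t ω ∂P' ≤
        ∑ s ∈ Finset.Ico t (U.Tmax + 1), ∫ ω, S.rise k s ω ∂P' := by
    intro r
    induction r with
    | zero =>
      intro t ht hr
      obtain rfl : t = U.Tmax + 1 := by have := Finset.mem_Icc.1 ht; omega
      simp [Trace.gap, toGo_last, Trace.approx_of_lt]
    | succ r ih =>
      intro t ht hr
      have ht' := Finset.mem_Icc.1 ht
      have h1 := hS.setIntegral_gap_le hK k (t := t) (Finset.mem_Icc.2 (by omega))
      have h2 := ih (t + 1) (Finset.mem_Icc.2 (by omega)) (by omega)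
      rw [Finset.sum_eq_sum_Ico_succ_bot (by omega)]
      simp only [Nat.add_sub_cancel] at h2
      linarith
  have h1 : ∀ᵐ ω ∂P', ω ∈ {ω | S.Ds (k + 1) (2 - 1) ω = 1} := by
    filter_upwards [hS.ae_runsAt] with ω hω
    exact (hω.valid (k + 1) (by omega)).2.2 ⟨1, Finset.mem_Icc.2 (by omega)⟩ rfl
  rw [integral_eq_setIntegral h1]
  exact key _ 2 (Finset.mem_Icc.2 (by omega)) rfl

theorem tendsto_integral_gap (hS : IsRun P' M U x₀ S) (hK : IsInvariant M U x₀ K)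
    (hR : IsExtrapolating M U K R) :
    Tendsto (fun k => ∫ ω, S.gap M U k 2 ω ∂P') atTop (𝓝 0) := by
  have hT := U.two_le_Tmax
  have h1 : Tendsto (fun k => ∑ t ∈ Finset.Ico 2 (U.Tmax + 1), ∫ ω, S.rise k t ω ∂P') atTop
      (𝓝 (∑ _t ∈ Finset.Ico 2 (U.Tmax + 1), (0 : ℝ))) :=
    tendsto_finsetSum _ fun t ht => hS.tendsto_integral_rise hK hR (Finset.mem_Icc.2 (by
      have := Finset.mem_Ico.1 ht; omega))
  rw [Finset.sum_const_zero] at h1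
  refine squeeze_zero (fun k => integral_nonneg_of_ae ?_) (fun k => hS.integral_gap_le hK k) h1
  filter_upwards [hS.ae_runsAt] with ω hω
  exact hω.gap_nonneg hK hS.hasAffineMinorants k (Finset.mem_Icc.2 (by omega))

/-- Almost surely the first stage gap becomes arbitrarily small. This weak statement suffices, as
the lower bounds are monotone. -/
theorem ae_exists_gap_lt (hS : IsRun P' M U x₀ S) (hK : IsInvariant M U x₀ K)
    (hR : IsExtrapolating M U K R) :
    ∀ᵐ ω ∂P', ∀ m : ℕ, ∃ k, S.gap M U k 2 ω < 1 / ((m : ℝ) + 1) := by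
  have hT := U.two_le_Tmax
  refine ae_all_iff.2 fun m => ?_
  have hε : 0 < 1 / ((m : ℝ) + 1) := by positivity
  set ε : ℝ := 1 / ((m : ℝ) + 1) with hεdef
  rw [ae_iff]
  push Not
  have hnn : ∀ k, 0 ≤ᵐ[P'] S.gap M U k 2 := fun k => by
    filter_upwards [hS.ae_runsAt] with ω hω
    exact hω.gap_nonneg hK hS.hasAffineMinorants k (Finset.mem_Icc.2 (by omega))
  have hle : ∀ k, ε * P'.real {ω | ∀ k, ε ≤ S.gap M U k 2 ω} ≤ ∫ ω, S.gap M U k 2 ω ∂P' := by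
    intro k
    refine le_trans (mul_le_mul_of_nonneg_left (measureReal_mono fun ω hω => ?_) hε.le)
      (mul_meas_ge_le_integral_of_nonneg (hnn k)
        (hS.integrable_gap k (Finset.mem_Icc.2 (by omega))) ε)
    exact hω k
  have h0 := ge_of_tendsto' (hS.tendsto_integral_gap hK hR) hle
  have h1 : P'.real {ω | ∀ k, ε ≤ S.gap M U k 2 ω} = 0 := by
    refine le_antisymm ?_ measureReal_nonneg
    by_contra hc
    push Not at hc
    exact absurd h0 (not_le.2 (mul_pos hε hc))
  exact (measureReal_eq_zero_iff (measure_ne_top _ _)).1 h1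

end IsRun

/-- The optimal value of the first stage problem of the forward pass of iteration `k + 1`. -/
noncomputable def Trace.firstValue (S : Trace n Ξ Ω') (M : StageModel n Ξ) (N : ℕ) (ξ₁ : Ξ)
    (x₀ : Dec n) (k : ℕ) (ω : Ω') : ℝ :=
  (M.cost 1 (S.x (k + 1) 1 ω) x₀ ξ₁).toReal + (S.approx N k 2 ω (S.x (k + 1) 1 ω) 1).toReal

namespace RunsAt

omit [MeasurableSpace Ω']

variable [IsProbabilityMeasure P]

theorem first_stage (H : RunsAt M U x₀ S ω) (k : ℕ) :
    S.x (k + 1) 1 ω ∈ M.feas 1 x₀ U.ξ₁ ∧ ∀ y ∈ M.feas 1 x₀ U.ξ₁,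
      M.cost 1 (S.x (k + 1) 1 ω) x₀ U.ξ₁ + S.approx U.Tmax k 2 ω (S.x (k + 1) 1 ω) 1 ≤
        M.cost 1 y x₀ U.ξ₁ + S.approx U.Tmax k 2 ω y 1 := by
  have hT := U.two_le_Tmax
  have h1 : 1 ∈ Finset.Icc 1 U.Tmax := Finset.mem_Icc.2 (by omega)
  obtain ⟨h2, h3⟩ := H.forward (k + 1) (by omega) 1 h1
  have hv := H.valid (k + 1) (by omega)
  have hξ : S.ξs (k + 1) 1 ω = U.ξ₁ := by
    have : S.ξs (k + 1) 1 ω ∈ U.Θ 1 := (hv.1 ⟨1, h1⟩).1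
    rwa [U.support_one, Finset.mem_singleton] at this
  have hD : S.Ds (k + 1) 1 ω = 1 := hv.2.2 ⟨1, h1⟩ rfl
  simp only [Nat.sub_self, H.x_zero, H.D_zero, hξ, hD, Nat.cast_one, one_mul,
    Nat.add_sub_cancel] at h2 h3
  exact ⟨h2, h3⟩

theorem recourse_one (hK : IsInvariant M U x₀ K) : Recourse M (K 1) 1 x₀ U.ξ₁ :=
  hK.recourse 1 (Finset.mem_Icc.2 ⟨le_rfl, by have := U.two_le_Tmax; omega⟩) x₀ hK.init_mem _ (by
    rw [U.support_one]; exact Finset.mem_singleton_self _)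

theorem finite_approx_two (hK : IsInvariant M U x₀ K) (k : ℕ) :
    FiniteBddBelowOn (fun y => S.approx U.Tmax k 2 ω y 1) (K 1) :=
  finiteBddBelowOn_approx hK k (t := 2)
    (Finset.mem_Icc.2 (by have := U.two_le_Tmax; omega)) ω (Or.inr rfl)

theorem finite_costToGo_two (hK : IsInvariant M U x₀ K) (hmin : HasAffineMinorants M U) :
    FiniteBddBelowOn (fun y => costToGo M U 2 y 1) (K 1) :=
  hK.finiteBddBelowOn_costToGo hmin (t := 2)
    (Finset.mem_Icc.2 (by have := U.two_le_Tmax; omega)) 1 (Or.inr rfl)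

theorem coe_firstValue (H : RunsAt M U x₀ S ω) (hK : IsInvariant M U x₀ K) (k : ℕ) :
    (S.firstValue M U.Tmax U.ξ₁ x₀ k ω : EReal) =
      M.cost 1 (S.x (k + 1) 1 ω) x₀ U.ξ₁ + S.approx U.Tmax k 2 ω (S.x (k + 1) 1 ω) 1 :=
  (recourse_one hK).coe_toReal_add (finite_approx_two hK k) (H.first_stage k).1

theorem firstValue_mono (H : RunsAt M U x₀ S ω) (hK : IsInvariant M U x₀ K) :
    Monotone fun k => S.firstValue M U.Tmax U.ξ₁ x₀ k ω := by
  refine monotone_nat_of_le_succ fun k => ?_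
  rw [← EReal.coe_le_coe_iff, H.coe_firstValue hK, H.coe_firstValue hK]
  exact ((H.first_stage k).2 _ (H.first_stage (k + 1)).1).trans
    (add_le_add le_rfl (Trace.approx_mono (Nat.le_succ k) _))

theorem firstValue_le (H : RunsAt M U x₀ S ω) (hK : IsInvariant M U x₀ K)
    (hmin : HasAffineMinorants M U) (k : ℕ) :
    S.firstValue M U.Tmax U.ξ₁ x₀ k ω ≤ stageOpt M U 1 x₀ U.ξ₁ 1 := by
  have hT := U.two_le_Tmax
  rw [← EReal.coe_le_coe_iff, H.coe_firstValue hK, stageOpt,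
    (recourse_one hK).coe_toReal_stageVal (finite_costToGo_two hK hmin), stageVal_one]
  refine le_iInf₂ fun y hy => ((H.first_stage k).2 y hy).trans (add_le_add le_rfl ?_)
  exact H.approx_le_costToGo (Finset.mem_Icc.2 (by omega)) k y

theorem stageOpt_sub_firstValue_le (H : RunsAt M U x₀ S ω) (hK : IsInvariant M U x₀ K)
    (hmin : HasAffineMinorants M U) (k : ℕ) :
    stageOpt M U 1 x₀ U.ξ₁ 1 - S.firstValue M U.Tmax U.ξ₁ x₀ k ω ≤ S.gap M U k 2 ω := by
  have h1 := (recourse_one hK).toReal_stageVal_le (finite_costToGo_two hK hmin)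
    (H.first_stage k).1
  simp only [stageOpt, Trace.firstValue, Trace.gap, toGo, show 2 - 1 = 1 from rfl] at h1 ⊢
  linarith

theorem tendsto_firstValue (H : RunsAt M U x₀ S ω) (hK : IsInvariant M U x₀ K)
    (hmin : HasAffineMinorants M U) (hgap : ∀ m : ℕ, ∃ k, S.gap M U k 2 ω < 1 / ((m : ℝ) + 1)) :
    Tendsto (fun k => S.firstValue M U.Tmax U.ξ₁ x₀ k ω) atTop (𝓝 (stageOpt M U 1 x₀ U.ξ₁ 1)) := by
  refine tendsto_atTop_isLUB (H.firstValue_mono hK) ⟨?_, fun b hb => ?_⟩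
  · rintro _ ⟨k, rfl⟩
    exact H.firstValue_le hK hmin k
  · refine le_of_forall_pos_le_add fun ε hε => ?_
    obtain ⟨m, hm⟩ := exists_nat_one_div_lt hε
    obtain ⟨k, hk⟩ := hgap m
    have h1 := H.stageOpt_sub_firstValue_le hK hmin k
    have h2 : S.firstValue M U.Tmax U.ξ₁ x₀ k ω ≤ b := hb ⟨k, rfl⟩
    linarith

theorem lowerBound_le (H : RunsAt M U x₀ S ω) (hK : IsInvariant M U x₀ K)
    (hmin : HasAffineMinorants M U) (k : ℕ) :
    S.lowerBound M U.Tmax U.ξ₁ x₀ k ω ≤ ((stageOpt M U 1 x₀ U.ξ₁ 1 : ℝ) : EReal) := by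
  have hT := U.two_le_Tmax
  rw [stageOpt, (recourse_one hK).coe_toReal_stageVal (finite_costToGo_two hK hmin), stageVal_one]
  exact iInf₂_mono fun y _ => add_le_add le_rfl
    (H.approx_le_costToGo (Finset.mem_Icc.2 (by omega)) k y)

end RunsAt

variable [MeasurableSingletonClass Ξ] [IsProbabilityMeasure P] [IsProbabilityMeasure P']

/-- Validity of the cuts and of the lower bounds, and convergence, from the existence of suitable
sets of trial points. -/
theorem IsRun.converges (hS : IsRun P' M U x₀ S) (hK : IsInvariant M U x₀ K)
    (hR : IsExtrapolating M U K R) :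
    (∀ᵐ ω ∂P', ∀ t ∈ Finset.Icc 2 (U.Tmax + 1), ∀ k : ℕ, ∀ x : Dec n,
      S.approx U.Tmax k t ω x 1 ≤ costToGo M U t x 1) ∧
    (∀ᵐ ω ∂P', ∀ k : ℕ, 1 ≤ k → S.lowerBound M U.Tmax U.ξ₁ x₀ k ω ≤ optVal M U x₀) ∧
    (∃ v : ℝ, optVal M U x₀ = (v : EReal) ∧
      ∀ᵐ ω ∂P', Tendsto
        (fun k : ℕ => M.cost 1 (S.x k 1 ω) x₀ U.ξ₁ + S.approx U.Tmax k 2 ω (S.x k 1 ω) 1)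
        atTop (𝓝 (v : EReal))) := by
  have hT := U.two_le_Tmax
  have hmin := hS.hasAffineMinorants
  refine ⟨?_, ?_, stageOpt M U 1 x₀ U.ξ₁ 1, optVal_eq hK hmin, ?_⟩
  · filter_upwards [hS.ae_runsAt] with ω hω t ht k x using hω.approx_le_costToGo ht k x
  · filter_upwards [hS.ae_runsAt] with ω hω k _
    rw [optVal_eq hK hmin]
    exact hω.lowerBound_le hK hmin k
  · filter_upwards [hS.ae_runsAt, hS.ae_exists_gap_lt hK hR] with ω hω hgap
    have h1 := (hω.tendsto_firstValue hK hmin hgap).add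
      (hω.tendsto_rise hK hR (t := 2) (Finset.mem_Icc.2 (by omega)))
    -- The values of iteration `k + 1` use the newest cut, which the first stage problem of its
    -- forward pass does not know yet: they differ from `firstValue` by `rise`.
    rw [add_zero] at h1
    refine (tendsto_add_atTop_iff_nat 1).1 ((EReal.tendsto_coe.2 h1).congr fun k => ?_)
    have h2 := (RunsAt.recourse_one hK).cost.coe_toReal (hω.first_stage k).1
    beta_reduce at h2
    rw [← h2, Trace.approx_one hT, ← EReal.coe_add, EReal.coe_eq_coe_iff, Trace.firstValue,
      Trace.approx_one hT, EReal.toReal_coe, Trace.rise]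
    ring

end Convergence

/-! ### The linear case -/

section Linear

variable {Ω Ξ : Type*} [MeasurableSpace Ω] [MeasurableSpace Ξ] {n : ℕ} {P : Measure Ω}
  {U : Uncertainty P Ξ} {x₀ : Dec n} {L : LinearData n Ξ}

/-- `x` is a sequence of feasible decisions up to stage `t` along the realizations `ζ`. -/
def IsPath (M : StageModel n Ξ) (U : Uncertainty P Ξ) (x₀ : Dec n) (t : ℕ) (ζ : ℕ → Ξ)
    (x : ℕ → Dec n) : Prop :=
  x 0 = x₀ ∧ ∀ τ ∈ Finset.Icc 1 t, ζ τ ∈ U.Θ τ ∧ x τ ∈ M.feas τ (x (τ - 1)) (ζ τ)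

/-- The decisions that can be reached at stage `t`. -/
def reach (M : StageModel n Ξ) (U : Uncertainty P Ξ) (x₀ : Dec n) (t : ℕ) : Set (Dec n) :=
  {y | ∃ ζ x, IsPath M U x₀ t ζ x ∧ x t = y}

section Reach

variable {M : StageModel n Ξ} {t : ℕ} {ζ : ℕ → Ξ} {x : ℕ → Dec n}

theorem IsPath.mono (h : IsPath M U x₀ t ζ x) {s : ℕ} (hs : s ≤ t) : IsPath M U x₀ s ζ x :=
  ⟨h.1, fun τ hτ => h.2 τ (Finset.Icc_subset_Icc_right hs hτ)⟩

theorem mem_reach_zero : x₀ ∈ reach M U x₀ 0 :=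
  ⟨fun _ => U.ξ₁, fun _ => x₀, ⟨rfl, by simp⟩, rfl⟩

theorem eq_of_mem_reach_zero {y : Dec n} (hy : y ∈ reach M U x₀ 0) : y = x₀ := by
  obtain ⟨ζ, x, h, rfl⟩ := hy
  exact h.1

/-- Extension of a path by one stage. -/
theorem IsPath.update (h : IsPath M U x₀ t ζ x) {θ : Ξ} (hθ : θ ∈ U.Θ (t + 1))
    {z : Dec n} (hz : z ∈ M.feas (t + 1) (x t) θ) :
    IsPath M U x₀ (t + 1) (Function.update ζ (t + 1) θ) (Function.update x (t + 1) z) := by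
  refine ⟨by rw [Function.update_of_ne (by omega), h.1], fun τ hτ => ?_⟩
  have hτ' := Finset.mem_Icc.1 hτ
  rcases Nat.lt_or_ge τ (t + 1) with h1 | h1
  · rw [Function.update_of_ne (by omega), Function.update_of_ne (by omega),
      Function.update_of_ne (by omega)]
    exact h.2 τ (Finset.mem_Icc.2 (by omega))
  · obtain rfl : τ = t + 1 := by omega
    rw [Function.update_self, Function.update_self, Function.update_of_ne (by omega)]
    exact ⟨hθ, hz⟩

theorem feas_subset_reach {y : Dec n} (hy : y ∈ reach M U x₀ t) {θ : Ξ} (hθ : θ ∈ U.Θ (t + 1)) :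
    M.feas (t + 1) y θ ⊆ reach M U x₀ (t + 1) := by
  classical
  obtain ⟨ζ, x, h, rfl⟩ := hy
  exact fun z hz => ⟨_, _, h.update hθ hz, Function.update_self _ _ _⟩

theorem exists_of_mem_reach_succ {z : Dec n} (hz : z ∈ reach M U x₀ (t + 1)) :
    ∃ y ∈ reach M U x₀ t, ∃ θ ∈ U.Θ (t + 1), z ∈ M.feas (t + 1) y θ := by
  obtain ⟨ζ, x, h, rfl⟩ := hz
  obtain ⟨h1, h2⟩ := h.2 (t + 1) (Finset.mem_Icc.2 (by omega))
  exact ⟨x t, ⟨ζ, x, h.mono (Nat.le_succ t), rfl⟩, _, h1, h2⟩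

end Reach

namespace LinearData.H2L

variable (H : L.H2L U.Tmax U.Θ U.ξ₁ x₀)
include H

theorem feas_nonempty_bounded {t : ℕ} (ht : t + 1 ≤ U.Tmax) {y : Dec n}
    (hy : y ∈ reach L.toModel U x₀ t) {θ : Ξ} (hθ : θ ∈ U.Θ (t + 1)) :
    (L.toModel.feas (t + 1) y θ).Nonempty ∧
      Bornology.IsBounded (L.toModel.feas (t + 1) y θ) := by
  classical
  rcases Nat.eq_zero_or_pos t with rfl | h0
  · rw [zero_add, U.support_one, Finset.mem_singleton] at hθ
    rw [eq_of_mem_reach_zero hy, hθ]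
    exact ⟨H.1, H.2.1⟩
  obtain ⟨ζ, x, h, rfl⟩ := hy
  have h1 := H.2.2 (t + 1) (Finset.mem_Icc.2 (by omega)) (Function.update ζ (t + 1) θ)
    (fun τ hτ => ?_) x ?_ (fun τ hτ => ?_)
  · simpa using h1
  · have hτ' := Finset.mem_Icc.1 hτ
    rcases Nat.lt_or_ge τ (t + 1) with h2 | h2
    · rw [Function.update_of_ne (by omega)]
      exact (h.2 τ (Finset.mem_Icc.2 (by omega))).1
    · obtain rfl : τ = t + 1 := by omega
      rwa [Function.update_self]
  · obtain ⟨h3, h4⟩ := h.2 1 (Finset.mem_Icc.2 (by omega))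
    rw [U.support_one, Finset.mem_singleton] at h3
    rw [h3, Nat.sub_self, h.1] at h4
    exact h4
  · have hτ' := Finset.mem_Icc.1 hτ
    rw [Function.update_of_ne (by omega)]
    exact (h.2 τ (Finset.mem_Icc.2 (by omega))).2

/-- Every feasible set `{z ≥ 0 : A z = b - B y}` with `y` reachable is bounded; the union over all
reachable `y` is bounded too, as these `b - B y` form a bounded set. -/
theorem isBounded_reach {t : ℕ} (ht : t ≤ U.Tmax) :
    Bornology.IsBounded (reach L.toModel U x₀ t) := by
  induction t with
  | zero =>
    exact Bornology.isBounded_singleton.subset (fun y hy => eq_of_mem_reach_zero hy)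
  | succ t ih =>
    have hb := ih (by omega)
    rcases (reach L.toModel U x₀ t).eq_empty_or_nonempty with he | ⟨y₀, hy₀⟩
    · convert Bornology.isBounded_empty
      refine Set.eq_empty_of_forall_notMem fun z hz => ?_
      obtain ⟨y, hy, -⟩ := exists_of_mem_reach_succ hz
      rw [he] at hy
      exact hy
    have hcov : reach L.toModel U x₀ (t + 1) ⊆ ⋃ θ ∈ U.Θ (t + 1),
        {z : Dec n | L.A (t + 1) θ *ᵥ z.ofLp ∈
          (fun y : Dec n => L.b (t + 1) θ - L.B (t + 1) θ *ᵥ y.ofLp) ''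
            reach L.toModel U x₀ t ∧ ∀ i, 0 ≤ z i} := by
      intro z hz
      obtain ⟨y, hy, θ, hθ, hz1, hz2⟩ := exists_of_mem_reach_succ hz
      refine Set.mem_biUnion hθ ⟨⟨y, hy, ?_⟩, hz2⟩
      rw [← hz1]
      exact add_sub_cancel_right _ _
    refine ((Bornology.isBounded_biUnion_finset _).2 fun θ hθ => ?_).subset hcov
    have hset : {z : Dec n | L.A (t + 1) θ *ᵥ z.ofLp =
        L.b (t + 1) θ - L.B (t + 1) θ *ᵥ y₀.ofLp ∧ ∀ i, 0 ≤ z i} =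
        L.toModel.feas (t + 1) y₀ θ := by
      ext z
      exact and_congr_left fun _ => eq_sub_iff_add_eq
    obtain ⟨h1, h2⟩ := H.feas_nonempty_bounded ht hy₀ hθ
    rw [← hset] at h1 h2
    refine isBounded_nonneg_preimage _ h1 h2 ?_
    have hcont : Continuous fun y : Dec n => L.b (t + 1) θ - L.B (t + 1) θ *ᵥ y.ofLp :=
      continuous_const.sub (Continuous.matrix_mulVec continuous_const (PiLp.continuous_ofLp 2 _))
    exact (hb.isCompact_closure.image hcont).isBounded.subset (Set.image_mono subset_closure)

theorem cost_bounds {t : ℕ} (ht : t ≤ U.Tmax) (θ : Ξ) :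
    ∃ m C : ℝ, ∀ y ∈ reach L.toModel U x₀ t, ∀ x, (m : EReal) ≤ L.toModel.cost t y x θ ∧
      L.toModel.cost t y x θ ≤ C := by
  have heq : ∀ y x : Dec n, L.toModel.cost t y x θ =
      ((0 + inner ℝ (WithLp.toLp 2 (L.c t θ)) y : ℝ) : EReal) := by
    intro y x
    rw [EuclideanSpace.inner_eq_star_dotProduct, zero_add, dotProduct_comm]
    rfl
  have heq' : ∀ y x : Dec n, L.toModel.cost t y x θ =
      ((-(0 + inner ℝ (-WithLp.toLp 2 (L.c t θ)) y) : ℝ) : EReal) := by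
    intro y x
    rw [heq, inner_neg_left]
    simp
  obtain ⟨m, hm⟩ := exists_le_affine_of_isBounded (H.isBounded_reach ht) 0
    (WithLp.toLp 2 (L.c t θ))
  obtain ⟨C, hC⟩ := exists_le_affine_of_isBounded (H.isBounded_reach ht) 0
    (-WithLp.toLp 2 (L.c t θ))
  refine ⟨m, -C, fun y hy x => ⟨?_, ?_⟩⟩
  · rw [heq, EReal.coe_le_coe_iff]
    exact hm y hy
  · rw [heq', EReal.coe_le_coe_iff]
    linarith [hC y hy]

theorem isInvariant : IsInvariant L.toModel U x₀ (reach L.toModel U x₀) where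
  init_mem := mem_reach_zero
  recourse t ht y hy θ hθ := by
    have ht' := Finset.mem_Icc.1 ht
    obtain ⟨s, rfl⟩ : ∃ s, t = s + 1 := ⟨t - 1, by omega⟩
    rw [Nat.add_sub_cancel] at hy
    refine ⟨(H.feas_nonempty_bounded ht'.2 hy hθ).1, feas_subset_reach hy hθ,
      fun z _ => EReal.coe_ne_top _, ?_⟩
    obtain ⟨m, C, h⟩ := H.cost_bounds ht'.2 θ
    exact ⟨m, fun z hz => (h z (feas_subset_reach hy hθ hz) y).1⟩
  bounded t ht := H.isBounded_reach (Finset.mem_Icc.1 ht).2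

/-- Paths along the same realizations form a polyhedron, in which extrapolation only has to
respect the nonnegativity constraints; by Dickson's lemma these are respected infinitely often. -/
theorem extrapolates_reach {t : ℕ} (ht : t ≤ U.Tmax) :
    Extrapolates (reach L.toModel U x₀ t) (reach L.toModel U x₀ t) := by
  intro u hu c hc
  choose ζ x hpath hxu using hu
  obtain ⟨B, hB⟩ : ∃ B : ℝ, ∀ τ : Finset.Icc 1 t, ∀ y ∈ reach L.toModel U x₀ τ, ‖y‖ ≤ B := by
    have h1 : ∀ τ : Finset.Icc 1 t, ∃ B : ℝ, ∀ y ∈ reach L.toModel U x₀ τ, ‖y‖ ≤ B := fun τ =>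
      (H.isBounded_reach ((Finset.mem_Icc.1 τ.2).2.trans ht)).exists_norm_le
    choose B hB using h1
    obtain ⟨C, hC⟩ := (Set.finite_range B).bddAbove
    exact ⟨C, fun τ y hy => (hB τ y hy).trans (hC ⟨τ, rfl⟩)⟩
  -- Infinitely many of the paths follow the same realizations.
  let f : ℕ → (τ : Finset.Icc 1 t) → U.Θ τ := fun k τ => ⟨ζ k τ, ((hpath k).2 τ τ.2).1⟩
  obtain ⟨e, he⟩ := Finite.exists_infinite_fiber f
  obtain ⟨φ, hφ, hφe⟩ := extraction_of_frequently_atTop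
    (Nat.frequently_atTop_iff_infinite.2 (Set.infinite_coe_iff.1 he))
  have hζ : ∀ i j, ∀ τ ∈ Finset.Icc 1 t, ζ (φ i) τ = ζ (φ j) τ := by
    intro i j τ hτ
    have h1 : f (φ i) = f (φ j) := (hφe i).trans (hφe j).symm
    exact congrArg Subtype.val (congrFun h1 ⟨τ, hτ⟩)
  obtain ⟨j, k, hjk, hle⟩ := exists_lt_forall_mul_le (B := B) hc
    (fun i (p : Finset.Icc 1 t × Fin n) => x (φ i) p.1 p.2)
    (fun i p => ((hpath (φ i)).2 p.1 p.1.2).2.2 p.2)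
    (fun i p => (le_abs_self _).trans ((PiLp.norm_apply_le (x (φ i) p.1) p.2).trans
      (hB p.1 _ ⟨_, _, (hpath (φ i)).mono (Finset.mem_Icc.1 p.1.2).2, rfl⟩)))
  refine ⟨φ j, φ k, hφ hjk, ζ (φ j), fun τ => x (φ j) τ + c • (x (φ j) τ - x (φ k) τ), ⟨?_, ?_⟩, ?_⟩
  · beta_reduce
    rw [(hpath _).1, (hpath _).1, sub_self, smul_zero, add_zero]
  · intro τ hτ
    obtain ⟨h1, h2, -⟩ := (hpath (φ j)).2 τ hτ
    obtain ⟨-, h3, -⟩ := (hpath (φ k)).2 τ hτ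
    rw [hζ k j τ hτ] at h3
    refine ⟨h1, ?_, fun i => ?_⟩
    · simp only [WithLp.ofLp_add, WithLp.ofLp_smul, WithLp.ofLp_sub, Matrix.mulVec_add,
        Matrix.mulVec_smul, Matrix.mulVec_sub]
      rw [← sub_eq_zero] at h2 h3 ⊢
      have h4 : ∀ a a' b b' r : Fin (L.rows τ) → ℝ, a + c • (a - a') + (b + c • (b - b')) - r =
          (1 + c) • (a + b - r) - c • (a' + b' - r) := by
        intro a a' b b' r
        module
      rw [h4, h2, h3, smul_zero, smul_zero, sub_zero]
    · have h4 := hle (⟨τ, hτ⟩, i)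
      simp only [PiLp.add_apply, PiLp.smul_apply, PiLp.sub_apply, smul_eq_mul] at h4 ⊢
      linarith
  · beta_reduce
    rw [hxu, hxu]

theorem costToGo_bddAbove [IsProbabilityMeasure P] (hmin : HasAffineMinorants L.toModel U) {t : ℕ}
    (ht : t ∈ Finset.Icc 2 (U.Tmax + 1)) :
    ∃ C : ℝ, ∀ x ∈ reach L.toModel U x₀ (t - 1), costToGo L.toModel U t x 1 ≤ C := by
  suffices h : ∀ r : ℕ, ∀ t ∈ Finset.Icc 2 (U.Tmax + 1), U.Tmax + 1 - t = r → ∃ C : ℝ,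
      ∀ x ∈ reach L.toModel U x₀ (t - 1), costToGo L.toModel U t x 1 ≤ C from h _ t ht rfl
  clear ht t
  intro r
  induction r with
  | zero =>
    intro t ht hr
    obtain rfl : t = U.Tmax + 1 := by have := Finset.mem_Icc.1 ht; omega
    exact ⟨0, fun x _ => by rw [costToGo_last]; rfl⟩
  | succ r ih =>
    intro t ht hr
    have ht' := Finset.mem_Icc.1 ht
    have ht1 : t ∈ Finset.Icc 1 U.Tmax := Finset.mem_Icc.2 (by omega)
    have ht2 : t ∈ Finset.Icc 2 U.Tmax := Finset.mem_Icc.2 (by omega)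
    have ht3 : t + 1 ∈ Finset.Icc 2 (U.Tmax + 1) := Finset.mem_Icc.2 (by omega)
    have hV : ∀ d, d = 0 ∨ d = 1 → FiniteBddBelowOn
        (fun y => costToGo L.toModel U (t + 1) y d) (reach L.toModel U x₀ t) := fun d hd =>
      H.isInvariant.finiteBddBelowOn_costToGo hmin ht3 d hd
    obtain ⟨C₁, hC₁⟩ := ih (t + 1) ht3 (by omega)
    have hb : ∀ d, d = 0 ∨ d = 1 → ∃ C : ℝ, ∀ y ∈ reach L.toModel U x₀ t,
        (costToGo L.toModel U (t + 1) y d).toReal ≤ C := by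
      rintro d (rfl | rfl)
      · exact ⟨0, fun y _ => by rw [costToGo_zero]; rfl⟩
      · refine ⟨C₁, fun y hy => ?_⟩
        rw [← EReal.coe_le_coe_iff, (hV 1 (Or.inr rfl)).coe_toReal hy]
        exact hC₁ y hy
    have hs : ∀ (d : ℕ) (θ : Ξ), ∃ C : ℝ, (d = 0 ∨ d = 1) → θ ∈ U.Θ t →
        ∀ x ∈ reach L.toModel U x₀ (t - 1), stageOpt L.toModel U t x θ d ≤ C := by
      intro d θ
      by_cases hd : d = 0 ∨ d = 1
      · obtain ⟨C, hC⟩ := hb d hd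
        obtain ⟨m, C', h⟩ := H.cost_bounds (t := t) (by omega) θ
        refine ⟨C' + C, fun _ hθ x hx => ?_⟩
        have hrec := H.isInvariant.recourse t ht1 x hx θ hθ
        obtain ⟨y, hy⟩ := hrec.nonempty
        have h1 := (h y (hrec.subset hy) x).2
        rw [← hrec.cost.coe_toReal hy, EReal.coe_le_coe_iff] at h1
        exact (hrec.toReal_stageVal_le (hV d hd) hy).trans (add_le_add h1 (hC y (hrec.subset hy)))
      · exact ⟨0, fun h => absurd h hd⟩
    choose C hC using hs
    refine ⟨(1 - U.q t) * ∑ θ ∈ U.Θ t, U.p t θ * C 1 θ + U.q t * ∑ θ ∈ U.Θ t, U.p t θ * C 0 θ,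
      fun x hx => ?_⟩
    rw [costToGo_eq_coe ht2 (H.isInvariant.recourse t ht1 x hx) hV, EReal.coe_le_coe_iff]
    refine add_le_add
      (mul_le_mul_of_nonneg_left (Finset.sum_le_sum fun θ hθ => ?_)
        (sub_nonneg.2 (U.q_le_one ht2)))
      (mul_le_mul_of_nonneg_left (Finset.sum_le_sum fun θ hθ => ?_) (U.q_nonneg t))
    · exact mul_le_mul_of_nonneg_left (hC 1 θ (Or.inr rfl) hθ x hx) (U.p_nonneg t θ)
    · exact mul_le_mul_of_nonneg_left (hC 0 θ (Or.inl rfl) hθ x hx) (U.p_nonneg t θ)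

theorem isExtrapolating [IsProbabilityMeasure P] (hmin : HasAffineMinorants L.toModel U) :
    IsExtrapolating L.toModel U (reach L.toModel U x₀) (reach L.toModel U x₀) where
  subset _ _ := subset_rfl
  extrapolates t ht := H.extrapolates_reach (by have := Finset.mem_Icc.1 ht; omega)
  bddAbove t ht := H.costToGo_bddAbove hmin (Finset.Icc_subset_Icc_right (Nat.le_succ _) ht)

end LinearData.H2L

end Linear

/-! ### The nonlinear case -/

section Nonlinear

/-- The optimal value of a jointly convex problem is a convex function of its parameter. -/
theorem convexOn_stageVal {n : ℕ} {Ξ : Type*} {M : StageModel n Ξ} {C K : Set (Dec n)} {t : ℕ}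
    {θ : Ξ} {V : Dec n → ℕ → EReal} {d : ℕ} (hC : Convex ℝ C)
    (hrec : ∀ x ∈ C, Recourse M K t x θ)
    (hcost : ConvexOn ℝ (K ×ˢ C) fun z : Dec n × Dec n => (M.cost t z.1 z.2 θ).toReal)
    (hfeas : ∀ x ∈ C, ∀ x' ∈ C, ∀ y ∈ M.feas t x θ, ∀ y' ∈ M.feas t x' θ, ∀ a b : ℝ, 0 ≤ a →
      0 ≤ b → a + b = 1 → a • y + b • y' ∈ M.feas t (a • x + b • x') θ)
    (hV : FiniteBddBelowOn (fun y => V y d) K) (hVc : ConvexOn ℝ K fun y => (V y d).toReal) :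
    ConvexOn ℝ C fun x => (stageVal M V t x 1 θ d).toReal := by
  refine ⟨hC, fun x hx x' hx' a b ha hb hab => le_of_forall_pos_le_add fun δ hδ => ?_⟩
  obtain ⟨y, hy, h1⟩ := (hrec x hx).exists_le_add hV hδ
  obtain ⟨y', hy', h2⟩ := (hrec x' hx').exists_le_add hV hδ
  have hyK := (hrec x hx).subset hy
  have hyK' := (hrec x' hx').subset hy'
  have h3 := (hrec _ (hC hx hx' ha hb hab)).toReal_stageVal_le hV
    (hfeas x hx x' hx' y hy y' hy' a b ha hb hab)
  have h4 := hcost.2 (x := (y, x)) ⟨hyK, hx⟩ (y := (y', x')) ⟨hyK', hx'⟩ ha hb hab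
  have h5 := hVc.2 hyK hyK' ha hb hab
  simp only [Prod.smul_mk, Prod.mk_add_mk, smul_eq_mul] at h4 h5 ⊢
  have h6 := mul_le_mul_of_nonneg_left h1 ha
  have h7 := mul_le_mul_of_nonneg_left h2 hb
  have h8 : a * δ + b * δ = δ := by rw [← add_mul, hab, one_mul]
  linarith

theorem convexOn_sum {ι E : Type*} [AddCommGroup E] [Module ℝ E] {C : Set E} (hC : Convex ℝ C)
    (s : Finset ι) {f : ι → E → ℝ} (hf : ∀ i ∈ s, ConvexOn ℝ C (f i)) :
    ConvexOn ℝ C fun x => ∑ i ∈ s, f i x := by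
  classical
  induction s using Finset.induction_on with
  | empty => simpa using convexOn_const 0 hC
  | insert i s hi ih =>
    simp only [Finset.sum_insert hi]
    exact (hf i (Finset.mem_insert_self i s)).add
      (ih fun j hj => hf j (Finset.mem_insert_of_mem hj))

variable {Ω Ξ : Type*} [MeasurableSpace Ω] [MeasurableSpace Ξ] {n : ℕ} {P : Measure Ω}
  {U : Uncertainty P Ξ} {x₀ : Dec n} {N : NonlinearData n Ξ} {ε : ℕ → ℝ}

/-- The part of assumption (H2-NL) which the convergence depends on, with `ε t` the radius of the
neighborhood of `𝒳_{t-1}` on which the stage-`t` problems are feasible. -/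
structure NonlinearData.IsRegular (N : NonlinearData n Ξ) (U : Uncertainty P Ξ) (x₀ : Dec n)
    (ε : ℕ → ℝ) : Prop where
  dom_zero : N.dom 0 = {x₀}
  pos : ∀ t ∈ Finset.Icc 1 U.Tmax, 0 < ε t
  convex : ∀ t ∈ Finset.Icc 1 U.Tmax, Convex ℝ (N.dom t)
  isCompact : ∀ t ∈ Finset.Icc 1 U.Tmax, IsCompact (N.dom t)
  cost : ∀ t ∈ Finset.Icc 1 U.Tmax, ∀ θ ∈ U.Θ t,
    ConvexLscFiniteOn (N.dom t ×ˢ Metric.cthickening (ε t) (N.dom (t - 1)))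
      (fun z : Dec n × Dec n => N.f t z.1 z.2 θ)
  ineq : ∀ t ∈ Finset.Icc 1 U.Tmax, ∀ θ ∈ U.Θ t, ∀ i,
    ConvexLscFiniteOn (N.dom t ×ˢ Metric.cthickening (ε t) (N.dom (t - 1)))
      (fun z : Dec n × Dec n => N.g t i z.1 z.2 θ)
  nonempty : ∀ t ∈ Finset.Icc 1 U.Tmax, ∀ θ ∈ U.Θ t,
    ∀ y ∈ Metric.cthickening (ε t) (N.dom (t - 1)), (N.toModel.feas t y θ).Nonempty

theorem NonlinearData.H2NL.exists_isRegular (H : N.H2NL U.Tmax U.Θ x₀) :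
    ∃ ε, N.IsRegular U x₀ ε := by
  classical
  choose! ε hε using H.2
  exact ⟨ε, H.1, fun t ht => (hε t ht).1, fun t ht => (hε t ht).2.1.2.1,
    fun t ht => (hε t ht).2.1.2.2, fun t ht => (hε t ht).2.2.2.1,
    fun t ht => (hε t ht).2.2.2.2.1, fun t ht => (hε t ht).2.2.2.2.2.1⟩

namespace NonlinearData.IsRegular

variable (H : N.IsRegular U x₀ ε) {t : ℕ}
include H

theorem convex_cthickening (ht : t ∈ Finset.Icc 1 U.Tmax) :
    Convex ℝ (Metric.cthickening (ε t) (N.dom (t - 1))) := by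
  refine Convex.cthickening ?_ _
  have ht' := Finset.mem_Icc.1 ht
  rcases Nat.lt_or_ge 1 t with h | h
  · exact H.convex _ (Finset.mem_Icc.2 (by omega))
  · obtain rfl : t = 1 := by omega
    rw [Nat.sub_self, H.dom_zero]
    exact convex_singleton _

theorem recourse (ht : t ∈ Finset.Icc 1 U.Tmax) {x : Dec n}
    (hx : x ∈ Metric.cthickening (ε t) (N.dom (t - 1))) {θ : Ξ} (hθ : θ ∈ U.Θ t) :
    Recourse N.toModel (N.dom t) t x θ where
  nonempty := H.nonempty t ht θ hθ x hx
  subset _ hy := hy.1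
  cost := by
    obtain ⟨hfin, -, hlsc⟩ := H.cost t ht θ hθ
    refine ⟨fun y hy => (hfin (y, x) ⟨hy.1, hx⟩).1, ?_⟩
    obtain ⟨y₁, hy₁⟩ := H.nonempty t ht θ hθ x hx
    have h1 : LowerSemicontinuousOn (fun y => N.f t y x θ) (N.dom t) :=
      LowerSemicontinuousOn.comp (g := fun y : Dec n => (y, x)) hlsc
        (by fun_prop) (fun y hy => ⟨hy, hx⟩)
    obtain ⟨y₀, hy₀, hmin⟩ := h1.exists_isMinOn ⟨y₁, hy₁.1⟩ (H.isCompact t ht)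
    have h2 := hfin (y₀, x) ⟨hy₀, hx⟩
    refine ⟨(N.f t y₀ x θ).toReal, fun y hy => ?_⟩
    rw [EReal.coe_toReal h2.1 h2.2]
    exact hmin hy.1

theorem isInvariant : IsInvariant N.toModel U x₀ N.dom where
  init_mem := by rw [H.dom_zero]; rfl
  recourse _ ht _ hx _ hθ := H.recourse ht (Metric.self_subset_cthickening _ hx) hθ
  bounded t ht := (H.isCompact t ht).isBounded

theorem combo_mem_feas (ht : t ∈ Finset.Icc 1 U.Tmax) {θ : Ξ} (hθ : θ ∈ U.Θ t) {x x' y y' : Dec n}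
    (hx : x ∈ Metric.cthickening (ε t) (N.dom (t - 1)))
    (hx' : x' ∈ Metric.cthickening (ε t) (N.dom (t - 1)))
    (hy : y ∈ N.toModel.feas t x θ) (hy' : y' ∈ N.toModel.feas t x' θ) {a b : ℝ} (ha : 0 ≤ a)
    (hb : 0 ≤ b) (hab : a + b = 1) : a • y + b • y' ∈ N.toModel.feas t (a • x + b • x') θ := by
  refine ⟨H.convex t ht hy.1 hy'.1 ha hb hab, fun i => ?_, ?_⟩
  · obtain ⟨hfin, hconv, -⟩ := H.ineq t ht θ hθ i
    have h1 := hconv.2 (x := (y, x)) ⟨hy.1, hx⟩ (y := (y', x')) ⟨hy'.1, hx'⟩ ha hb hab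
    have h2 := hfin (a • y + b • y', a • x + b • x') ⟨H.convex t ht hy.1 hy'.1 ha hb hab,
      H.convex_cthickening ht hx hx' ha hb hab⟩
    beta_reduce at h2
    have h3 : (N.g t i y x θ).toReal ≤ 0 := EReal.toReal_nonpos (hy.2.1 i)
    have h4 : (N.g t i y' x' θ).toReal ≤ 0 := EReal.toReal_nonpos (hy'.2.1 i)
    rw [← EReal.coe_toReal h2.1 h2.2, ← EReal.coe_zero, EReal.coe_le_coe_iff]
    simp only [Prod.smul_mk, Prod.mk_add_mk, smul_eq_mul] at h1
    have h5 := mul_nonpos_of_nonneg_of_nonpos ha h3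
    have h6 := mul_nonpos_of_nonneg_of_nonpos hb h4
    linarith
  · have h1 := hy.2.2
    have h2 := hy'.2.2
    simp only [WithLp.ofLp_add, WithLp.ofLp_smul, Matrix.mulVec_add, Matrix.mulVec_smul]
    rw [add_add_add_comm, ← smul_add, ← smul_add, h1, h2, ← add_smul, hab, one_smul]

variable [IsProbabilityMeasure P] (hmin : HasAffineMinorants N.toModel U)
include hmin

omit [IsProbabilityMeasure P] in
theorem coe_toGo (ht : t ∈ Finset.Icc 2 U.Tmax) {x : Dec n}
    (hx : x ∈ Metric.cthickening (ε t) (N.dom (t - 1))) :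
    ((toGo N.toModel U t x 1 : ℝ) : EReal) = costToGo N.toModel U t x 1 ∧
    toGo N.toModel U t x 1 =
      (1 - U.q t) * ∑ θ ∈ U.Θ t, U.p t θ * stageOpt N.toModel U t x θ 1 +
        U.q t * ∑ θ ∈ U.Θ t, U.p t θ * stageOpt N.toModel U t x θ 0 := by
  have ht' := Finset.mem_Icc.1 ht
  have h := costToGo_eq_coe ht
    (fun θ hθ => H.recourse (Finset.mem_Icc.2 (by omega)) hx hθ)
    (fun d hd => H.isInvariant.finiteBddBelowOn_costToGo hmin
      (t := t + 1) (Finset.mem_Icc.2 (by omega)) d hd)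
  unfold toGo stageOpt
  rw [h]
  exact ⟨by rw [EReal.toReal_coe], EReal.toReal_coe _⟩

theorem convexOn_toGo_of_succ (ht : t ∈ Finset.Icc 2 U.Tmax)
    (hconv : ConvexOn ℝ (N.dom t) fun y => toGo N.toModel U (t + 1) y 1) :
    ConvexOn ℝ (Metric.cthickening (ε t) (N.dom (t - 1))) fun x => toGo N.toModel U t x 1 := by
  have ht' := Finset.mem_Icc.1 ht
  have ht1 : t ∈ Finset.Icc 1 U.Tmax := Finset.mem_Icc.2 (by omega)
  have hC := H.convex_cthickening ht1
  have hstage : ∀ θ ∈ U.Θ t, ∀ d, d = 0 ∨ d = 1 →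
      ConvexOn ℝ (Metric.cthickening (ε t) (N.dom (t - 1)))
        fun x => stageOpt N.toModel U t x θ d := by
    intro θ hθ d hd
    refine convexOn_stageVal hC (fun x hx => H.recourse ht1 hx hθ) (H.cost t ht1 θ hθ).2.1
      (fun x hx x' hx' y hy y' hy' a b => H.combo_mem_feas ht1 hθ hx hx' hy hy')
      (H.isInvariant.finiteBddBelowOn_costToGo hmin (t := t + 1) (Finset.mem_Icc.2 (by omega)) d hd)
      ?_
    rcases hd with rfl | rfl
    · simpa only [costToGo_zero] using convexOn_const _ (H.convex t ht1)
    · exact hconv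
  have hsum : ∀ d, d = 0 ∨ d = 1 → ConvexOn ℝ (Metric.cthickening (ε t) (N.dom (t - 1)))
      fun x => ∑ θ ∈ U.Θ t, U.p t θ * stageOpt N.toModel U t x θ d := fun d hd =>
    convexOn_sum hC _ fun θ hθ => (hstage θ hθ d hd).smul (U.p_nonneg t θ)
  exact (((hsum 1 (Or.inr rfl)).smul (sub_nonneg.2 (U.q_le_one ht))).add
    ((hsum 0 (Or.inl rfl)).smul (U.q_nonneg t))).congr
      fun x hx => ((H.coe_toGo hmin ht hx).2).symm

theorem convexOn_toGo (ht : t ∈ Finset.Icc 2 U.Tmax) :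
    ConvexOn ℝ (Metric.cthickening (ε t) (N.dom (t - 1))) fun x => toGo N.toModel U t x 1 := by
  suffices h : ∀ r : ℕ, ∀ t ∈ Finset.Icc 2 U.Tmax, U.Tmax - t = r →
      ConvexOn ℝ (Metric.cthickening (ε t) (N.dom (t - 1))) fun x => toGo N.toModel U t x 1 from
    h _ t ht rfl
  intro r
  induction r with
  | zero =>
    intro t ht hr
    have ht' := Finset.mem_Icc.1 ht
    obtain rfl : t = U.Tmax := by omega
    refine H.convexOn_toGo_of_succ hmin ht ?_
    simp only [toGo_last]
    exact convexOn_const _ (H.convex _ (Finset.mem_Icc.2 (by omega)))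
  | succ r ih =>
    intro t ht hr
    have ht' := Finset.mem_Icc.1 ht
    exact H.convexOn_toGo_of_succ hmin ht
      ((ih (t + 1) (Finset.mem_Icc.2 (by omega)) (by omega)).subset
        (Metric.self_subset_cthickening _) (H.convex t (Finset.mem_Icc.2 (by omega))))

/-- A convex function is continuous in the interior of its domain, hence bounded on the compact
neighborhood of half the radius. -/
theorem isExtrapolating : IsExtrapolating N.toModel U N.dom
    fun s => Metric.cthickening (ε (s + 1) / 2) (N.dom s) where
  subset t _ := Metric.self_subset_cthickening _
  extrapolates t ht := by
    have ht' := Finset.mem_Icc.1 ht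
    exact extrapolates_cthickening (H.isCompact _ (Finset.mem_Icc.2 (by omega)))
      (half_pos (H.pos _ (Finset.mem_Icc.2 (by omega))))
  bddAbove t ht := by
    have ht' := Finset.mem_Icc.1 ht
    have hpos := H.pos t (Finset.mem_Icc.2 (by omega))
    rw [Nat.sub_add_cancel (by omega)]
    have hint : Metric.cthickening (ε t / 2) (N.dom (t - 1)) ⊆
        interior (Metric.cthickening (ε t) (N.dom (t - 1))) :=
      (Metric.cthickening_subset_thickening' hpos (half_lt_self hpos) _).trans
        (interior_maximal (Metric.thickening_subset_cthickening _ _) Metric.isOpen_thickening)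
    have hcomp : IsCompact (Metric.cthickening (ε t / 2) (N.dom (t - 1))) :=
      (H.isCompact _ (Finset.mem_Icc.2 (by omega))).cthickening
    obtain ⟨C, hC⟩ := hcomp.bddAbove_image
      ((H.convexOn_toGo hmin ht).continuousOn_interior.mono hint)
    refine ⟨C, fun x hx => ?_⟩
    rw [← (H.coe_toGo hmin ht (interior_subset (hint hx))).1, EReal.coe_le_coe_iff]
    exact hC ⟨x, hx, rfl⟩

end NonlinearData.IsRegular

end Nonlinear

end SDDP

theorem mainTheorem1 {Ω Ω' Ξ : Type*} [MeasurableSpace Ω] [MeasurableSpace Ω']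
    [MeasurableSpace Ξ] [MeasurableSingletonClass Ξ] {n : ℕ}
    (P : Measure Ω) [IsProbabilityMeasure P] (P' : Measure Ω') [IsProbabilityMeasure P']
    (M : SDDP.StageModel n Ξ) (U : SDDP.Uncertainty P Ξ) (x₀ : SDDP.Dec n)
    (hM : (∃ L : SDDP.LinearData n Ξ, M = L.toModel ∧ L.H2L U.Tmax U.Θ U.ξ₁ x₀) ∨
      (∃ N : SDDP.NonlinearData n Ξ, M = N.toModel ∧ N.H2NL U.Tmax U.Θ x₀))
    (S : SDDP.Trace n Ξ Ω') (hS : SDDP.IsRun P' M U x₀ S) :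
    (∀ᵐ ω ∂P', ∀ t ∈ Finset.Icc 2 (U.Tmax + 1), ∀ k : ℕ, ∀ x : SDDP.Dec n,
      S.approx U.Tmax k t ω x 1 ≤ SDDP.costToGo M U t x 1) ∧
    (∀ᵐ ω ∂P', ∀ k : ℕ, 1 ≤ k →
      S.lowerBound M U.Tmax U.ξ₁ x₀ k ω ≤ SDDP.optVal M U x₀) ∧
    (∃ v : ℝ, SDDP.optVal M U x₀ = (v : EReal) ∧
      ∀ᵐ ω ∂P', Tendsto
        (fun k : ℕ => M.cost 1 (S.x k 1 ω) x₀ U.ξ₁ + S.approx U.Tmax k 2 ω (S.x k 1 ω) 1)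
        atTop (𝓝 (v : EReal))) := by
  rcases hM with ⟨L, rfl, H⟩ | ⟨N, rfl, H⟩
  · exact hS.converges H.isInvariant (H.isExtrapolating hS.hasAffineMinorants)
  · obtain ⟨ε, H⟩ := H.exists_isRegular
    exact hS.converges H.isInvariant (H.isExtrapolating hS.hasAffineMinorants)
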